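/- Let $\Phi\subset\mathbb{R}^3$ be a smooth closed surface, that is, a compact subset in which every point has a relatively open neighbourhood that is the image of a $C^\infty$ embedding $\mathbb{R}^2\to\mathbb{R}^3$ with everywhere injective differential. Assume that $\Phi$ is homeomorphic to the sphere $S^2$ or to the torus $S^1\times S^1$. Suppose that through each point of $\Phi$ there pass at least $7$ distinct circles fully contained in $\Phi$ and depending continuously on the point, in the following (local) sense: every $p\in\Phi$ has a neighbourhood $W$ in $\Phi$ and, for each $x\in W$, there are $7$ pairwise distinct circles $\gamma_1(x),\dots,\gamma_7(x)$ of positive radius with $x\in\gamma_i(x)\subset\Phi$, such that for each $i$ the centre, the radius and a unit normal vector of the plane of $\gamma_i(x)$ can be chosen to depend continuously on $x\in W$. Then $\Phi$ is a round sphere: there are $c\in\mathbb{R}^3$ and $r>0$ with $\Phi=\{x\in\mathbb{R}^3 : |x-c|=r\}$. -/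

import Mathlib

open scoped ContDiff

/-- Euclidean three-space. -/
abbrev E3 : Type := EuclideanSpace ℝ (Fin 3)

/-- The Euclidean plane. -/
abbrev E2 : Type := EuclideanSpace ℝ (Fin 2)

/-- A smooth closed (compact, without boundary) surface embedded in `ℝ³`: a compact set in which
every point has a relatively open neighbourhood that is the image of a `C^∞` embedding
`ℝ² → ℝ³` whose differential is injective everywhere. -/
def IsSmoothClosedSurface (Φ : Set E3) : Prop :=
  IsCompact Φ ∧
    ∀ p ∈ Φ, ∃ V : Set E3, IsOpen V ∧ p ∈ V ∧
      ∃ φ : E2 → E3, ContDiff ℝ ∞ φ ∧ (∀ u, Function.Injective (fderiv ℝ φ u)) ∧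
        Topology.IsEmbedding φ ∧ Set.range φ = Φ ∩ V

/-- The circle with centre `c` and radius `r` in the plane through `c` orthogonal to `n`
(a genuine circle when `0 < r` and `‖n‖ = 1`). -/
def circleSet (c n : E3) (r : ℝ) : Set E3 :=
  {x | dist x c = r ∧ inner ℝ (x - c) n = 0}

/-- `γ` assigns to each point of `W` a circle of positive radius in `ℝ³`, depending continuously
on the point: centre, unit normal of the plane and radius are continuous on `W`. -/
def IsContinuousCircleFamily (W : Set E3) (γ : E3 → Set E3) : Prop :=
  ∃ (c n : E3 → E3) (r : E3 → ℝ),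
    ContinuousOn c W ∧ ContinuousOn n W ∧ ContinuousOn r W ∧
      ∀ x ∈ W, 0 < r x ∧ ‖n x‖ = 1 ∧ γ x = circleSet (c x) (n x) (r x)

/-- Through each point of `Φ` there pass (at least) `k` distinct circles contained in `Φ`,
depending continuously on the point. The continuous choice is required only locally, near each
point of `Φ`: on a topological sphere there is no global one, since the tangent lines of the chosen
circles would form a continuous line field. -/
def HasCirclesThroughEachPoint (k : ℕ) (Φ : Set E3) : Prop :=
  ∀ p ∈ Φ, ∃ V : Set E3, IsOpen V ∧ p ∈ V ∧
    ∃ γ : Fin k → E3 → Set E3,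
      (∀ i, IsContinuousCircleFamily (Φ ∩ V) (γ i)) ∧
      ∀ x ∈ Φ ∩ V, (∀ i, x ∈ γ i x ∧ γ i x ⊆ Φ) ∧ Function.Injective (fun i => γ i x)

/-!
Two circles on `Φ` through `p` whose classes intersect evenly modulo `2` are tangent at `p` or meet
again. The parity is read off the line spanned by the values of an `ℝ²`-valued equation of one
circle: it extends continuously across that circle, so along the other circle it turns a
well-defined number of times modulo `2`. On a sphere all intersections are even; on a torus the
classes modulo `2` take only four values, so among seven circles some three intersect evenly in
pairs.

By Meusnier's theorem such circles have the same normal curvature at `p`, so they lie on one common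
sphere or plane tangent to `Φ` at `p`. In a continuous family, the neighbours of a suitable one of
three such circles meet the two others in at least three points, hence lie on that sphere too: a
piece of `Φ` near `p` is spherical. Where `Φ` is spherical the normal curvature and the centre are
constant, so the spherical pieces, being dense, all belong to one sphere.
-/

open Filter Topology ComplexConjugate

/-! ### Spheres, planes and circles -/

section CrossProduct
open scoped Matrix

variable (a b c v : E3)

/-- The cross product on Euclidean three-space. -/
noncomputable def cross (a b : E3) : E3 := WithLp.toLp 2 (a.ofLp ⨯₃ b.ofLp)

theorem inner_cross_left : inner ℝ (cross a b) a = 0 := by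
  simp [EuclideanSpace.inner_eq_star_dotProduct, cross]

theorem inner_cross_right : inner ℝ (cross a b) b = 0 := by
  simp [EuclideanSpace.inner_eq_star_dotProduct, cross]

theorem cross_cross_right :
    cross a (cross b c) = (inner ℝ a c : ℝ) • b - (inner ℝ a b : ℝ) • c := by
  ext i
  fin_cases i <;> simp [PiLp.inner_apply, Fin.sum_univ_three, cross, cross_apply] <;> ring

theorem norm_sq_cross : ‖cross a b‖ ^ 2 = ‖a‖ ^ 2 * ‖b‖ ^ 2 - (inner ℝ a b : ℝ) ^ 2 := by
  simp [EuclideanSpace.real_norm_sq_eq, PiLp.inner_apply, Fin.sum_univ_three, cross, cross_apply]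
  ring

theorem cross_add_right : cross a (b + c) = cross a b + cross a c := by
  simp [cross]

theorem cross_smul_right (k : ℝ) : cross a (k • b) = k • cross a b := by
  simp [cross]

theorem continuous_cross : Continuous fun p : E3 × E3 => cross p.1 p.2 := by
  simp only [cross, cross_apply]
  fun_prop

theorem norm_sq_cross_smul : ‖cross a b‖ ^ 2 • v =
    (inner ℝ (cross a b) v : ℝ) • cross a b +
      ((inner ℝ v a * inner ℝ b b - inner ℝ v b * inner ℝ a b : ℝ) • a +
       (inner ℝ v b * inner ℝ a a - inner ℝ v a * inner ℝ a b : ℝ) • b) := by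
  ext i
  fin_cases i <;>
    simp [EuclideanSpace.real_norm_sq_eq, PiLp.inner_apply, Fin.sum_univ_three, cross,
      cross_apply] <;> ring

variable {a b v}

theorem norm_sq_cross_smul_of_inner_eq_zero (ha : inner ℝ v a = 0) (hb : inner ℝ v b = 0) :
    ‖cross a b‖ ^ 2 • v = (inner ℝ (cross a b) v : ℝ) • cross a b := by
  simp [norm_sq_cross_smul, ha, hb]

end CrossProduct

section SphereFun

variable {E : Type*} [NormedAddCommGroup E] [InnerProductSpace ℝ E]

/-- The function whose zero set is the general sphere (`b ≠ 0`) or hyperplane (`b = 0`) through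
`p`, normalised so that its gradient at `p` is `w`. -/
noncomputable def sphereFun (w : E) (b : ℝ) (p x : E) : ℝ := inner ℝ w (x - p) + b * ‖x - p‖ ^ 2

variable {w p : E} {b : ℝ}

theorem sphereFun_self (w : E) (b : ℝ) (p : E) : sphereFun w b p p = 0 := by simp [sphereFun]

theorem continuous_sphereFun (w : E) (b : ℝ) (p : E) : Continuous (sphereFun w b p) := by
  unfold sphereFun; fun_prop

theorem sphereFun_add (w : E) (b : ℝ) (p x v : E) : sphereFun w b p (x + v) =
    sphereFun w b p x + (inner ℝ (w + (2 * b) • (x - p)) v + b * ‖v‖ ^ 2) := by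
  rw [sphereFun, sphereFun, add_sub_right_comm, norm_add_sq_real, inner_add_right, inner_add_left,
    real_inner_smul_left]
  ring

theorem sphereFun_rebase {q : E} (hq : sphereFun w b p q = 0) (x : E) :
    sphereFun w b p x = sphereFun (w + (2 * b) • (q - p)) b q x := by
  rw [← add_sub_cancel q x, sphereFun_add, hq, zero_add, sphereFun, add_sub_cancel_left]

theorem hasFDerivAt_sphereFun (w : E) (b : ℝ) (p x : E) :
    HasFDerivAt (sphereFun w b p) (innerSL ℝ (w + (2 * b) • (x - p))) x := by
  have hsub := (hasFDerivAt_id (𝕜 := ℝ) x).sub_const p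
  convert! ((innerSL ℝ w).hasFDerivAt.comp x hsub).add (hsub.norm_sq.const_mul b) using 1
  ext v
  simp
  ring

theorem hasDerivAt_sphereFun_comp {σ : ℝ → E} {v : E} {t : ℝ} (hσ : HasDerivAt σ v t) :
    HasDerivAt (fun s => sphereFun w b p (σ s)) (inner ℝ (w + (2 * b) • (σ t - p)) v) t :=
  (hasFDerivAt_sphereFun w b p (σ t)).comp_hasDerivAt t hσ

theorem norm_sq_add_smul_sub (w : E) (b : ℝ) (p x : E) :
    ‖w + (2 * b) • (x - p)‖ ^ 2 = ‖w‖ ^ 2 + 4 * b * sphereFun w b p x := by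
  rw [sphereFun, norm_add_sq_real, inner_smul_right, norm_smul, mul_pow, Real.norm_eq_abs, sq_abs]
  ring

end SphereFun

/-- A circle in three-space, given by its centre, a unit normal of its plane and its positive
radius. The choice of the normal orients the circle. -/
structure OrientedCircle where
  center : E3
  normal : E3
  radius : ℝ
  radius_pos : 0 < radius
  norm_normal : ‖normal‖ = 1

namespace OrientedCircle

/-- The set of points of a circle. -/
def carrier (C : OrientedCircle) : Set E3 := circleSet C.center C.normal C.radius

/-- The velocity at `x` of the rotation with unit angular speed along the circle. -/
noncomputable def velocity (C : OrientedCircle) (x : E3) : E3 := cross C.normal (x - C.center)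

/-- The rotation of the point `x` by the angle `t` along the circle. -/
noncomputable def rotate (C : OrientedCircle) (x : E3) (t : ℝ) : E3 :=
  C.center + Real.cos t • (x - C.center) + Real.sin t • C.velocity x

section Basic

variable (C : OrientedCircle) {x y : E3}

theorem mem_carrier :
    x ∈ C.carrier ↔ ‖x - C.center‖ = C.radius ∧ inner ℝ (x - C.center) C.normal = 0 := by
  simp [carrier, circleSet, dist_eq_norm]

theorem inner_velocity_normal : inner ℝ (C.velocity x) C.normal = 0 := inner_cross_left _ _

theorem inner_velocity_sub_center : inner ℝ (C.velocity x) (x - C.center) = 0 :=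
  inner_cross_right _ _

theorem rotate_zero : C.rotate x 0 = x := by simp [rotate]

theorem rotate_add_two_pi (t : ℝ) : C.rotate x (t + 2 * Real.pi) = C.rotate x t := by simp [rotate]

theorem rotate_sub_center (t : ℝ) :
    C.rotate x t - C.center = Real.cos t • (x - C.center) + Real.sin t • C.velocity x := by
  simp [rotate, add_assoc]

theorem rotate_sub_self (t : ℝ) :
    C.rotate x t - x = (Real.cos t - 1) • (x - C.center) + Real.sin t • C.velocity x := by
  simp only [rotate]; module

theorem continuous_rotate : Continuous (C.rotate x) := by
  unfold rotate
  fun_prop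

variable {C}

theorem norm_velocity (hx : x ∈ C.carrier) : ‖C.velocity x‖ = C.radius := by
  obtain ⟨hnorm, hplane⟩ := C.mem_carrier.1 hx
  rw [← sq_eq_sq₀ (norm_nonneg _) C.radius_pos.le, velocity, norm_sq_cross, C.norm_normal, hnorm,
    real_inner_comm, hplane]
  ring

theorem velocity_ne_zero (hx : x ∈ C.carrier) : C.velocity x ≠ 0 := by
  rw [← norm_pos_iff, norm_velocity hx]; exact C.radius_pos

theorem norm_sq_smul_add_smul_velocity (hx : x ∈ C.carrier) (k l : ℝ) :
    ‖k • (x - C.center) + l • C.velocity x‖ ^ 2 = (k ^ 2 + l ^ 2) * C.radius ^ 2 := by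
  rw [norm_add_sq_real, norm_smul, norm_smul, mul_pow, mul_pow, norm_velocity hx,
    (C.mem_carrier.1 hx).1, inner_smul_left, inner_smul_right, real_inner_comm,
    inner_velocity_sub_center]
  simp only [Real.norm_eq_abs, sq_abs]
  ring

theorem velocity_rotate (hx : x ∈ C.carrier) (t : ℝ) :
    C.velocity (C.rotate x t) = -Real.sin t • (x - C.center) + Real.cos t • C.velocity x := by
  have hcross : cross C.normal (C.velocity x) = -(x - C.center) := by
    rw [velocity, cross_cross_right, real_inner_comm, (C.mem_carrier.1 hx).2,
      real_inner_self_eq_norm_sq, C.norm_normal]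
    simp
  rw [velocity, rotate_sub_center, cross_add_right, cross_smul_right, cross_smul_right, hcross,
    ← velocity]
  module

theorem hasDerivAt_rotate (hx : x ∈ C.carrier) (t : ℝ) :
    HasDerivAt (C.rotate x) (C.velocity (C.rotate x t)) t := by
  rw [velocity_rotate hx]
  exact (((Real.hasDerivAt_cos t).smul_const (x - C.center)).const_add C.center).add
    ((Real.hasDerivAt_sin t).smul_const (C.velocity x))

theorem rotate_mem_carrier (hx : x ∈ C.carrier) (t : ℝ) : C.rotate x t ∈ C.carrier := by
  refine C.mem_carrier.2 ⟨?_, ?_⟩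
  · rw [rotate_sub_center, ← sq_eq_sq₀ (norm_nonneg _) C.radius_pos.le,
      norm_sq_smul_add_smul_velocity hx, Real.cos_sq_add_sin_sq, one_mul]
  · rw [rotate_sub_center, inner_add_left, inner_smul_left, inner_smul_left,
      (C.mem_carrier.1 hx).2, inner_velocity_normal]
    simp

theorem norm_sq_rotate_sub_rotate (hx : x ∈ C.carrier) (s t : ℝ) :
    ‖C.rotate x s - C.rotate x t‖ ^ 2 = (2 * C.radius * Real.sin ((s - t) / 2)) ^ 2 := by
  have hsub : C.rotate x s - C.rotate x t =
      (Real.cos s - Real.cos t) • (x - C.center) + (Real.sin s - Real.sin t) • C.velocity x := by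
    simp only [rotate]; module
  rw [hsub, norm_sq_smul_add_smul_velocity hx, Real.cos_sub_cos, Real.sin_sub_sin]
  linear_combination 4 * C.radius ^ 2 * Real.sin ((s - t) / 2) ^ 2 *
    Real.sin_sq_add_cos_sq ((s + t) / 2)

theorem rotate_eq_rotate_iff (hx : x ∈ C.carrier) {s t : ℝ} :
    C.rotate x s = C.rotate x t ↔ Real.sin ((s - t) / 2) = 0 := by
  rw [← sub_eq_zero, ← norm_eq_zero, ← sq_eq_zero_iff, norm_sq_rotate_sub_rotate hx]
  simp [C.radius_pos.ne']

theorem rotate_eq_self_iff (hx : x ∈ C.carrier) {t : ℝ} :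
    C.rotate x t = x ↔ Real.sin (t / 2) = 0 := by
  simpa [rotate_zero] using rotate_eq_rotate_iff hx (s := t) (t := 0)

theorem rotate_ne_rotate (hx : x ∈ C.carrier) {s t : ℝ} (hst : s < t) (hts : t < s + 2 * Real.pi) :
    C.rotate x s ≠ C.rotate x t := fun h =>
  (Real.sin_pos_of_pos_of_lt_pi (by linarith) (by linarith)).ne'
    ((rotate_eq_rotate_iff hx (s := t) (t := s)).1 h.symm)

theorem exists_eq_smul_velocity (hx : x ∈ C.carrier) {v : E3} (hv : inner ℝ v C.normal = 0)
    (hv' : inner ℝ v (x - C.center) = 0) : ∃ k : ℝ, v = k • C.velocity x := by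
  have hsmul := norm_sq_cross_smul_of_inner_eq_zero hv hv'
  rw [← velocity, norm_velocity hx] at hsmul
  refine ⟨(inner ℝ (C.velocity x) v : ℝ) / C.radius ^ 2, ?_⟩
  rw [div_eq_inv_mul, mul_smul, ← hsmul, inv_smul_smul₀ (pow_pos C.radius_pos 2).ne']

theorem exists_rotate_eq (hx : x ∈ C.carrier) (hy : y ∈ C.carrier) :
    ∃ t ∈ Set.Ioc (-Real.pi) Real.pi, C.rotate x t = y := by
  obtain ⟨hxnorm, hxplane⟩ := C.mem_carrier.1 hx
  obtain ⟨hynorm, hyplane⟩ := C.mem_carrier.1 hy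
  have hr := (pow_pos C.radius_pos 2).ne'
  set a : ℝ := inner ℝ (y - C.center) (x - C.center) / C.radius ^ 2 with ha
  obtain ⟨b, hb⟩ : ∃ b : ℝ, y - C.center - a • (x - C.center) = b • C.velocity x := by
    refine exists_eq_smul_velocity hx ?_ ?_
    · simp [inner_sub_left, inner_smul_left, hyplane, hxplane]
    · simp [inner_sub_left, inner_smul_left, hxnorm, ha, hr]
  rw [sub_eq_iff_eq_add'] at hb
  have hab : a ^ 2 + b ^ 2 = 1 := by
    have hnorm := norm_sq_smul_add_smul_velocity hx a b
    rw [← hb, hynorm] at hnorm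
    exact (mul_eq_right₀ hr).1 hnorm.symm
  have hz : ‖(⟨a, b⟩ : ℂ)‖ = 1 := by
    rw [← sq_eq_sq₀ (norm_nonneg _) zero_le_one, Complex.sq_norm, Complex.normSq_mk]
    linarith
  have hz0 : (⟨a, b⟩ : ℂ) ≠ 0 := norm_ne_zero_iff.1 (hz ▸ one_ne_zero)
  refine ⟨Complex.arg ⟨a, b⟩, ⟨Complex.neg_pi_lt_arg _, Complex.arg_le_pi _⟩, ?_⟩
  rw [← sub_left_inj (a := C.center), rotate_sub_center, Complex.cos_arg hz0, Complex.sin_arg, hz,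
    hb, div_one, div_one]

end Basic

variable {C D : OrientedCircle} {p x y z w : E3} {b : ℝ}

/-- The curvature vector at `p` of a circle through `p`. -/
noncomputable def curvatureVector (C : OrientedCircle) (p : E3) : E3 :=
  (C.radius ^ 2)⁻¹ • (C.center - p)

theorem sphereFun_rotate (hp : p ∈ C.carrier) (w : E3) (b t : ℝ) :
    sphereFun w b p (C.rotate p t) = 2 * Real.sin (t / 2) *
      (Real.cos (t / 2) * inner ℝ w (C.velocity p) +
        C.radius ^ 2 * Real.sin (t / 2) * (2 * b + inner ℝ w (C.curvatureVector p))) := by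
  have hradial : C.radius ^ 2 * inner ℝ w (C.curvatureVector p) = -inner ℝ w (p - C.center) := by
    rw [← inner_smul_right, curvatureVector, smul_inv_smul₀ (pow_pos C.radius_pos 2).ne',
      ← inner_neg_right, neg_sub]
  have hsin : Real.sin t = 2 * Real.sin (t / 2) * Real.cos (t / 2) := by
    rw [← Real.sin_two_mul, mul_div_cancel₀ t two_ne_zero]
  have hcos : Real.cos t = 1 - 2 * Real.sin (t / 2) ^ 2 := by
    rw [← Real.cos_two_mul_eq_one_sub, mul_div_cancel₀ t two_ne_zero]
  have hnorm := norm_sq_rotate_sub_rotate hp t 0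
  rw [rotate_zero, sub_zero] at hnorm
  rw [sphereFun, hnorm, rotate_sub_self, inner_add_right, inner_smul_right, inner_smul_right, hsin,
    hcos]
  linear_combination -2 * Real.sin (t / 2) ^ 2 * hradial

theorem hasDerivAt_sphereFun_rotate (hx : x ∈ C.carrier) {t : ℝ} (h : C.rotate x t = p) :
    HasDerivAt (fun s => sphereFun w b p (C.rotate x s)) (inner ℝ w (C.velocity p)) t := by
  simpa [h] using hasDerivAt_sphereFun_comp (w := w) (b := b) (p := p) (hasDerivAt_rotate hx t)

theorem cos_half_mul_add_eq_zero (hp : p ∈ C.carrier) {t : ℝ} (ht : C.rotate p t ≠ p)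
    (h : sphereFun w b p (C.rotate p t) = 0) :
    Real.cos (t / 2) * inner ℝ w (C.velocity p) +
      C.radius ^ 2 * Real.sin (t / 2) * (2 * b + inner ℝ w (C.curvatureVector p)) = 0 := by
  rw [sphereFun_rotate hp] at h
  refine (mul_eq_zero.1 h).resolve_left (mul_ne_zero two_ne_zero ?_)
  rwa [Ne, ← rotate_eq_self_iff hp]

theorem two_mul_add_inner_curvatureVector_eq_zero (hp : p ∈ C.carrier) (hy : y ∈ C.carrier)
    (hyp : y ≠ p) (ht : inner ℝ w (C.velocity p) = 0) (h : sphereFun w b p y = 0) :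
    2 * b + inner ℝ w (C.curvatureVector p) = 0 := by
  obtain ⟨s, -, rfl⟩ := exists_rotate_eq hp hy
  have hs := cos_half_mul_add_eq_zero hp hyp h
  rw [ht, mul_zero, zero_add] at hs
  rw [Ne, rotate_eq_self_iff hp] at hyp
  exact (mul_eq_zero.1 hs).resolve_left (mul_ne_zero (pow_pos C.radius_pos 2).ne' hyp)

theorem sphereFun_eq_zero_of_curvatureVector (hp : p ∈ C.carrier)
    (ht : inner ℝ w (C.velocity p) = 0) (hκ : 2 * b + inner ℝ w (C.curvatureVector p) = 0) {v : E3}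
    (hv : v ∈ C.carrier) : sphereFun w b p v = 0 := by
  obtain ⟨t, -, rfl⟩ := exists_rotate_eq hp hv
  rw [sphereFun_rotate hp, ht, hκ]
  ring

theorem sphereFun_eq_zero_of_tangent (hp : p ∈ C.carrier) (hy : y ∈ C.carrier) (hyp : y ≠ p)
    (ht : inner ℝ w (C.velocity p) = 0) (h : sphereFun w b p y = 0) {v : E3}
    (hv : v ∈ C.carrier) : sphereFun w b p v = 0 :=
  sphereFun_eq_zero_of_curvatureVector hp ht
    (two_mul_add_inner_curvatureVector_eq_zero hp hy hyp ht h) hv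

theorem sphereFun_eq_zero_of_three (hx : x ∈ C.carrier) (hy : y ∈ C.carrier) (hz : z ∈ C.carrier)
    (hxy : x ≠ y) (hxz : x ≠ z) (hyz : y ≠ z) (hpx : sphereFun w b p x = 0)
    (hpy : sphereFun w b p y = 0) (hpz : sphereFun w b p z = 0) {v : E3} (hv : v ∈ C.carrier) :
    sphereFun w b p v = 0 := by
  rw [sphereFun_rebase hpx] at hpy hpz ⊢
  obtain ⟨s, -, rfl⟩ := exists_rotate_eq hx hy
  obtain ⟨t, -, rfl⟩ := exists_rotate_eq hx hz
  have hs := cos_half_mul_add_eq_zero hx hxy.symm hpy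
  have ht := cos_half_mul_add_eq_zero hx hxz.symm hpz
  refine sphereFun_eq_zero_of_tangent hx hy hxy.symm ?_ hpy hv
  have hdet : Real.sin ((s - t) / 2) ≠ 0 := by rwa [Ne, ← rotate_eq_rotate_iff hx]
  refine (mul_eq_zero.1 ?_).resolve_left hdet
  rw [sub_div, Real.sin_sub]
  linear_combination Real.sin (s / 2) * ht - Real.sin (t / 2) * hs

theorem mem_carrier_iff_sphereFun (hp : p ∈ C.carrier) :
    x ∈ C.carrier ↔
      sphereFun C.normal 0 p x = 0 ∧ sphereFun ((2 : ℝ) • (p - C.center)) 1 p x = 0 := by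
  obtain ⟨hnorm, hplane⟩ := C.mem_carrier.1 hp
  have hx : x - C.center = (x - p) + (p - C.center) := by abel
  rw [mem_carrier, sphereFun, sphereFun, ← sq_eq_sq₀ (norm_nonneg _) C.radius_pos.le, hx,
    norm_add_sq_real, inner_add_left, hnorm, hplane, inner_smul_left,
    real_inner_comm (x - p) C.normal, real_inner_comm (x - p) (p - C.center)]
  simp only [conj_trivial]
  constructor <;> rintro ⟨_, _⟩ <;> constructor <;> linarith

theorem carrier_subset_of_three (hx : x ∈ C.carrier) (hy : y ∈ C.carrier) (hz : z ∈ C.carrier)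
    (hxy : x ≠ y) (hxz : x ≠ z) (hyz : y ≠ z) (hx' : x ∈ D.carrier) (hy' : y ∈ D.carrier)
    (hz' : z ∈ D.carrier) : C.carrier ⊆ D.carrier := fun v hv => by
  have hD {u : E3} (hu : u ∈ D.carrier) := (mem_carrier_iff_sphereFun hx').1 hu
  exact (mem_carrier_iff_sphereFun hx').2
    ⟨sphereFun_eq_zero_of_three hx hy hz hxy hxz hyz (hD hx').1 (hD hy').1 (hD hz').1 hv,
     sphereFun_eq_zero_of_three hx hy hz hxy hxz hyz (hD hx').2 (hD hy').2 (hD hz').2 hv⟩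

theorem carrier_eq_of_three (hx : x ∈ C.carrier) (hy : y ∈ C.carrier) (hz : z ∈ C.carrier)
    (hxy : x ≠ y) (hxz : x ≠ z) (hyz : y ≠ z) (hx' : x ∈ D.carrier) (hy' : y ∈ D.carrier)
    (hz' : z ∈ D.carrier) : C.carrier = D.carrier :=
  (carrier_subset_of_three hx hy hz hxy hxz hyz hx' hy' hz').antisymm
    (carrier_subset_of_three hx' hy' hz' hxy hxz hyz hx hy hz)

/-- Two circles through `p` have the same tangent line there; it is encoded by proportional
velocities. -/
def IsTangentAt (C D : OrientedCircle) (p : E3) : Prop :=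
  ∃ k : ℝ, k ≠ 0 ∧ D.velocity p = k • C.velocity p

theorem IsTangentAt.symm (h : IsTangentAt C D p) : IsTangentAt D C p := by
  obtain ⟨k, hk, hD⟩ := h
  exact ⟨k⁻¹, inv_ne_zero hk, by rw [hD, inv_smul_smul₀ hk]⟩

theorem IsTangentAt.trans {F : OrientedCircle} (hCD : IsTangentAt C D p)
    (hDF : IsTangentAt D F p) : IsTangentAt C F p := by
  obtain ⟨k, hk, hD⟩ := hCD
  obtain ⟨l, hl, hF⟩ := hDF
  exact ⟨l * k, mul_ne_zero hl hk, by rw [hF, hD, smul_smul]⟩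

theorem isTangentAt_of_inner (hC : p ∈ C.carrier) (hD : p ∈ D.carrier)
    (hnormal : inner ℝ (D.velocity p) C.normal = 0)
    (hradial : inner ℝ (D.velocity p) (p - C.center) = 0) : IsTangentAt C D p := by
  obtain ⟨k, hk⟩ := exists_eq_smul_velocity hC hnormal hradial
  refine ⟨k, ?_, hk⟩
  rintro rfl
  exact velocity_ne_zero hD (by rw [hk, zero_smul])

theorem carrier_subset_of_isTangentAt (hC : p ∈ C.carrier) (hD : p ∈ D.carrier)
    (ht : IsTangentAt C D p) (hyC : y ∈ C.carrier) (hyD : y ∈ D.carrier) (hy : y ≠ p) :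
    D.carrier ⊆ C.carrier := fun v hv => by
  obtain ⟨k, -, hk⟩ := ht
  obtain ⟨hplane, hsphere⟩ := (mem_carrier_iff_sphereFun hC).1 hyC
  refine (mem_carrier_iff_sphereFun hC).2
    ⟨sphereFun_eq_zero_of_tangent hD hyD hy ?_ hplane hv,
      sphereFun_eq_zero_of_tangent hD hyD hy ?_ hsphere hv⟩
  · rw [hk, inner_smul_right, real_inner_comm, inner_velocity_normal, mul_zero]
  · rw [hk, inner_smul_right, inner_smul_left, real_inner_comm, inner_velocity_sub_center]
    simp

theorem carrier_eq_of_isTangentAt (hC : p ∈ C.carrier) (hD : p ∈ D.carrier)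
    (ht : IsTangentAt C D p) (hyC : y ∈ C.carrier) (hyD : y ∈ D.carrier) (hy : y ≠ p) :
    C.carrier = D.carrier :=
  (carrier_subset_of_isTangentAt hD hC ht.symm hyD hyC hy).antisymm
    (carrier_subset_of_isTangentAt hC hD ht hyC hyD hy)

end OrientedCircle

/-! ### Normals of a surface and Meusnier's theorem -/

section Normal

variable {E : Type*} [NormedAddCommGroup E] [InnerProductSpace ℝ E]

/-- `N` is a unit normal of `Φ` at `p`, in the strict sense: the chords of `Φ` near `p` are almost
orthogonal to `N`. -/
structure IsNormalAt (Φ : Set E) (p N : E) : Prop where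
  norm_eq_one : ‖N‖ = 1
  isLittleO : (fun z : E × E => (inner ℝ N (z.1 - z.2) : ℝ)) =o[𝓝[Φ] p ×ˢ 𝓝[Φ] p]
    fun z => z.1 - z.2

theorem IsNormalAt.inner_eq_zero_of_tendsto {Φ : Set E} {p N : E} (h : IsNormalAt Φ p N)
    {ι : Type*} {l : Filter ι} [l.NeBot] {x y : ι → E} {s : ι → ℝ} {d : E}
    (hx : Tendsto x l (𝓝[Φ] p)) (hy : Tendsto y l (𝓝[Φ] p))
    (hd : Tendsto (fun i => s i • (x i - y i)) l (𝓝 d)) : inner ℝ N d = 0 := by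
  have hsmall : (fun i => (inner ℝ N (s i • (x i - y i)) : ℝ)) =o[l]
      fun i => s i • (x i - y i) := by
    simp only [inner_smul_right]
    exact (Asymptotics.isBigO_refl s l).smul_isLittleO (h.isLittleO.comp_tendsto (hx.prodMk hy))
  exact tendsto_nhds_unique (tendsto_const_nhds.inner hd)
    ((hsmall.trans_isBigO (hd.isBigO_one ℝ)).tendsto_zero_of_tendsto tendsto_const_nhds)

theorem isNormalAt_of_hasStrictFDerivAt {F : Type*} [NormedAddCommGroup F] [NormedSpace ℝ F]
    [FiniteDimensional ℝ F] {φ : F → E} {L : F →L[ℝ] E} {u : F} {Φ : Set E} {N : E}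
    (hφ : HasStrictFDerivAt φ L u) (hL : Function.Injective L) (hmap : map φ (𝓝 u) = 𝓝[Φ] (φ u))
    (hN : ‖N‖ = 1) (hNL : ∀ d, inner ℝ N (L d) = 0) : IsNormalAt Φ (φ u) N := by
  refine ⟨hN, ?_⟩
  obtain ⟨K, -, hK⟩ := (L : F →ₗ[ℝ] E).exists_antilipschitzWith (LinearMap.ker_eq_bot.2 hL)
  have hrev : (fun z : F × F => z.1 - z.2) =O[𝓝 (u, u)] fun z => φ z.1 - φ z.2 := by
    have hLrev : (fun z : F × F => z.1 - z.2) =O[𝓝 (u, u)] fun z => L (z.1 - z.2) :=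
      .of_bound K <| .of_forall fun z => by simpa [dist_eq_norm] using hK.le_mul_dist (z.1 - z.2) 0
    have := hφ.isLittleO.trans_isBigO hLrev
    exact hLrev.trans (by simpa using this.right_isBigO_add)
  have hinner : (fun z : F × F => (inner ℝ N (φ z.1 - φ z.2) : ℝ)) =O[𝓝 (u, u)]
      fun z => φ z.1 - φ z.2 - L (z.1 - z.2) :=
    .of_bound 1 <| .of_forall fun z => by
      calc ‖(inner ℝ N (φ z.1 - φ z.2) : ℝ)‖
          = ‖(inner ℝ N (φ z.1 - φ z.2 - L (z.1 - z.2)) : ℝ)‖ := by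
            rw [inner_sub_right N (φ z.1 - φ z.2) (L _), hNL, sub_zero]
        _ ≤ 1 * ‖φ z.1 - φ z.2 - L (z.1 - z.2)‖ := hN ▸ norm_inner_le_norm _ _
  rw [← hmap, prod_map_map_eq, Asymptotics.isLittleO_map, ← nhds_prod_eq]
  exact (hinner.trans_isLittleO hφ.isLittleO).trans_isBigO hrev

theorem exists_unit_normal_of_finrank_add_one [FiniteDimensional ℝ E] (S : Submodule ℝ E)
    (hS : Module.finrank ℝ S + 1 = Module.finrank ℝ E) :
    ∃ N : E, ‖N‖ = 1 ∧ ∀ v, inner ℝ N v = 0 ↔ v ∈ S := by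
  have hfin : Module.finrank ℝ Sᗮ = 1 := by
    have := S.finrank_add_finrank_orthogonal
    omega
  have : Nontrivial Sᗮ := Module.nontrivial_of_finrank_eq_succ hfin
  obtain ⟨N, hN⟩ := exists_norm_eq Sᗮ zero_le_one
  have hspan : ℝ ∙ (N : E) = Sᗮ := by
    refine Submodule.eq_of_le_of_finrank_eq ((Submodule.span_singleton_le_iff_mem _ _).2 N.2) ?_
    rw [finrank_span_singleton (ne_zero_of_norm_ne_zero (a := (N : E)) ?_), hfin]
    exact hN ▸ one_ne_zero
  refine ⟨N, hN, fun v => ?_⟩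
  rw [← Submodule.mem_orthogonal_singleton_iff_inner_right, hspan, S.orthogonal_orthogonal]

end Normal

theorem IsSmoothClosedSurface.exists_chart {Φ : Set E3} (hΦ : IsSmoothClosedSurface Φ) {p : E3}
    (hp : p ∈ Φ) : ∃ (φ : E2 → E3) (u₀ : E2), ContDiff ℝ ∞ φ ∧
      (∀ u, Function.Injective (fderiv ℝ φ u)) ∧ (∀ u, map φ (𝓝 u) = 𝓝[Φ] (φ u)) ∧
      (∀ u, φ u ∈ Φ) ∧ φ u₀ = p := by
  obtain ⟨V, hV, hpV, φ, hsmooth, hinj, hemb, hrange⟩ := hΦ.2 p hp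
  have hmem : ∀ u, φ u ∈ Φ ∩ V := fun u => hrange ▸ Set.mem_range_self u
  obtain ⟨u₀, hu₀⟩ : p ∈ Set.range φ := hrange ▸ ⟨hp, hpV⟩
  refine ⟨φ, u₀, hsmooth, hinj, fun u => ?_, fun u => (hmem u).1, hu₀⟩
  rw [hemb.map_nhds_eq, hrange, nhdsWithin_inter_of_mem']
  exact mem_nhdsWithin_of_mem_nhds (hV.mem_nhds (hmem u).2)

theorem IsSmoothClosedSurface.exists_normal {Φ : Set E3} (hΦ : IsSmoothClosedSurface Φ) {p : E3}
    (hp : p ∈ Φ) : ∃ N : E3, IsNormalAt Φ p N ∧ ∀ v : E3, inner ℝ N v = 0 →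
      ∃ σ : ℝ → E3, HasDerivAt σ v 0 ∧ σ 0 = p ∧ ∀ t, σ t ∈ Φ := by
  obtain ⟨φ, u₀, hsmooth, hinj, hmap, hmem, rfl⟩ := hΦ.exists_chart hp
  have hφ : HasStrictFDerivAt φ (fderiv ℝ φ u₀) u₀ :=
    hsmooth.contDiffAt.hasStrictFDerivAt (by simp)
  obtain ⟨N, hN, hrange⟩ := exists_unit_normal_of_finrank_add_one
    (LinearMap.range (fderiv ℝ φ u₀ : E2 →ₗ[ℝ] E3)) (by
      rw [LinearMap.finrank_range_of_inj (hinj u₀)]; simp)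
  refine ⟨N, isNormalAt_of_hasStrictFDerivAt hφ (hinj u₀) (hmap u₀) hN
    fun d => (hrange _).2 ⟨d, rfl⟩, fun v hv => ?_⟩
  obtain ⟨d, rfl⟩ := (hrange v).1 hv
  refine ⟨fun t => φ (u₀ + t • d), ?_, by simp, fun t => hmem _⟩
  have hline : HasDerivAt (fun t : ℝ => u₀ + t • d) d 0 := by
    simpa using ((hasDerivAt_id (0 : ℝ)).smul_const d).const_add u₀
  exact HasFDerivAt.comp_hasDerivAt_of_eq (0 : ℝ) hφ.hasFDerivAt hline (by simp)

theorem OrientedCircle.tendsto_rotate {Φ : Set E3} {C : OrientedCircle} {p : E3}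
    (hC : C.carrier ⊆ Φ) (hp : p ∈ C.carrier) {ι : Type*} {l : Filter ι} {f : ι → ℝ}
    (hf : Tendsto f l (𝓝 0)) : Tendsto (fun i => C.rotate p (f i)) l (𝓝[Φ] p) := by
  refine tendsto_nhdsWithin_iff.2 ⟨?_, .of_forall fun i => hC (rotate_mem_carrier hp _)⟩
  simpa only [rotate_zero, Function.comp_def] using
    ((C.continuous_rotate (x := p)).tendsto 0).comp hf

theorem IsNormalAt.inner_velocity {Φ : Set E3} {C : OrientedCircle} {p N : E3}
    (h : IsNormalAt Φ p N) (hC : C.carrier ⊆ Φ) (hp : p ∈ C.carrier) :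
    inner ℝ N (C.velocity p) = 0 := by
  have hslope := hasDerivAt_iff_tendsto_slope_zero.1 (OrientedCircle.hasDerivAt_rotate hp 0)
  simp only [C.rotate_zero, zero_add] at hslope
  exact h.inner_eq_zero_of_tendsto
    (OrientedCircle.tendsto_rotate hC hp (tendsto_id.mono_left nhdsWithin_le_nhds))
    (tendsto_nhdsWithin_iff.2 ⟨tendsto_const_nhds, .of_forall fun _ => hC hp⟩) hslope

theorem eventually_abs_mul_lt_one (k : ℝ) : ∀ᶠ u : ℝ in 𝓝[≠] 0, |k * u| < 1 := by
  have hcont : Continuous fun u : ℝ => |k * u| := by fun_prop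
  exact tendsto_nhdsWithin_of_tendsto_nhds (hcont.tendsto' 0 0 (by simp))
    |>.eventually_lt_const one_pos

theorem tendsto_inv_sq_mul_cos_arcsin_sub_one (k : ℝ) :
    Tendsto (fun u : ℝ => (u⁻¹) ^ 2 * (Real.cos (Real.arcsin (k * u)) - 1)) (𝓝[≠] 0)
      (𝓝 (-(k ^ 2 / 2))) := by
  have hcont : Tendsto (fun u : ℝ => -(k ^ 2 / (1 + √(1 - (k * u) ^ 2)))) (𝓝[≠] 0)
      (𝓝 (-(k ^ 2 / 2))) := by
    have : Continuous fun u : ℝ => -(k ^ 2 / (1 + √(1 - (k * u) ^ 2))) :=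
      (continuous_const.div (by fun_prop) fun u => by positivity).neg
    refine tendsto_nhdsWithin_of_tendsto_nhds (this.tendsto' 0 _ ?_)
    norm_num
  refine hcont.congr' ?_
  filter_upwards [eventually_abs_mul_lt_one k, self_mem_nhdsWithin] with u hu (hu0 : u ≠ 0)
  have hsq := Real.sq_sqrt (sub_nonneg.2 ((sq_lt_one_iff_abs_lt_one (k * u)).2 hu).le)
  have hpos : 0 < 1 + √(1 - (k * u) ^ 2) := by positivity
  rw [Real.cos_arcsin, inv_pow, neg_eq_iff_eq_neg, div_eq_iff hpos.ne']
  generalize √(1 - (k * u) ^ 2) = c at hsq hpos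
  field_simp
  linear_combination hsq

/-- Meusnier's theorem for circles. Parametrising both by the arcsine of the same parameter cancels
the tangential parts of the chord between them, so that its leading term is the difference of the
accelerations. -/
theorem IsNormalAt.inner_curvatureVector_eq {Φ : Set E3} {C D : OrientedCircle} {p N : E3}
    (h : IsNormalAt Φ p N) (hC : C.carrier ⊆ Φ) (hD : D.carrier ⊆ Φ) (hpC : p ∈ C.carrier)
    (hpD : p ∈ D.carrier) (ht : C.IsTangentAt D p) :
    inner ℝ N (C.curvatureVector p) = inner ℝ N (D.curvatureVector p) := by
  obtain ⟨k, hk0, hk⟩ := ht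
  have hradius : D.radius ^ 2 = k ^ 2 * C.radius ^ 2 := by
    rw [← OrientedCircle.norm_velocity hpC, ← OrientedCircle.norm_velocity hpD, hk, norm_smul,
      mul_pow, Real.norm_eq_abs, sq_abs]
  have hzero (k : ℝ) : Tendsto (fun u : ℝ => Real.arcsin (k * u)) (𝓝[≠] 0) (𝓝 0) := by
    refine tendsto_nhdsWithin_of_tendsto_nhds (Continuous.tendsto' ?_ 0 _ (by simp))
    fun_prop
  have hchord : Tendsto (fun u : ℝ => (u⁻¹) ^ 2 •
      (C.rotate p (Real.arcsin (k * u)) - D.rotate p (Real.arcsin (1 * u)))) (𝓝[≠] 0)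
      (𝓝 (-(k ^ 2 / 2) • (p - C.center) - (-(1 ^ 2 / 2 : ℝ)) • (p - D.center))) := by
    refine (((tendsto_inv_sq_mul_cos_arcsin_sub_one k).smul_const (p - C.center)).sub
      ((tendsto_inv_sq_mul_cos_arcsin_sub_one 1).smul_const (p - D.center))).congr' ?_
    filter_upwards [eventually_abs_mul_lt_one k, eventually_abs_mul_lt_one 1] with u hku h1u
    rw [abs_lt] at hku h1u
    rw [← sub_sub_sub_cancel_right (C.rotate p _) _ p, C.rotate_sub_self, D.rotate_sub_self, hk,
      Real.sin_arcsin hku.1.le hku.2.le, Real.sin_arcsin h1u.1.le h1u.2.le]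
    module
  have hinner := h.inner_eq_zero_of_tendsto (OrientedCircle.tendsto_rotate hC hpC (hzero k))
    (OrientedCircle.tendsto_rotate hD hpD (hzero 1)) hchord
  rw [inner_sub_right, inner_smul_right, inner_smul_right] at hinner
  have hC0 := C.radius_pos.ne'
  rw [OrientedCircle.curvatureVector, OrientedCircle.curvatureVector, inner_smul_right,
    inner_smul_right, ← neg_sub p C.center, ← neg_sub p D.center, inner_neg_right, inner_neg_right,
    hradius]
  field_simp
  linarith

/-! ### The equation of a circle along the surface -/

namespace OrientedCircle

/-- The equations of the plane and of the diametral sphere of a circle, as one complex-valued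
function whose zero set is the circle. -/
noncomputable def complexEquation (C : OrientedCircle) (x : E3) : ℂ :=
  (inner ℝ C.normal (x - C.center) : ℝ) +
    (inner ℝ (x - C.center) (x - C.center) - C.radius ^ 2 : ℝ) * Complex.I

/-- A point of the circle close to `x`, with the same coordinate along the tangent at `q`. -/
noncomputable def foot (C : OrientedCircle) (q x : E3) : E3 :=
  C.rotate q (Real.arcsin (inner ℝ (x - q) (C.velocity q) / C.radius ^ 2))

variable {C D : OrientedCircle} {q x v w N : E3} {Φ : Set E3}

theorem complexEquation_eq_zero_iff : C.complexEquation x = 0 ↔ x ∈ C.carrier := by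
  rw [mem_carrier, complexEquation, Complex.ext_iff]
  simp only [Complex.add_re, Complex.add_im, Complex.ofReal_re, Complex.ofReal_im,
    Complex.re_ofReal_mul, Complex.im_ofReal_mul, Complex.I_re, Complex.I_im, Complex.zero_re,
    Complex.zero_im, mul_zero, mul_one, add_zero, zero_add, sub_eq_zero, real_inner_self_eq_norm_sq]
  rw [sq_eq_sq₀ (norm_nonneg _) C.radius_pos.le, and_comm, real_inner_comm]

theorem contDiff_complexEquation : ContDiff ℝ ∞ C.complexEquation := by
  have hsub : ContDiff ℝ ∞ fun x : E3 => x - C.center := contDiff_id.sub contDiff_const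
  exact (Complex.ofRealCLM.contDiff.comp (contDiff_const.inner ℝ hsub)).add
    ((Complex.ofRealCLM.contDiff.comp ((hsub.inner ℝ hsub).sub contDiff_const)).mul contDiff_const)

theorem fderiv_complexEquation (C : OrientedCircle) (q v : E3) :
    fderiv ℝ C.complexEquation q v =
      (inner ℝ C.normal v : ℝ) + (2 * inner ℝ (q - C.center) v : ℝ) * Complex.I := by
  have hsub : HasFDerivAt (fun x : E3 => x - C.center) (ContinuousLinearMap.id ℝ E3) q :=
    (hasFDerivAt_id q).sub_const _
  have hre := (hasFDerivAt_const C.normal q).inner ℝ hsub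
  have him := (hsub.inner ℝ hsub).sub_const (C.radius ^ 2)
  have := (Complex.ofRealCLM.hasFDerivAt.comp q hre).add
    ((Complex.ofRealCLM.hasFDerivAt.comp q him).mul_const Complex.I)
  refine (DFunLike.congr_fun (HasFDerivAt.fderiv this) v).trans ?_
  simpa [real_inner_comm, two_mul] using mul_comm _ _

theorem fderiv_complexEquation_ne_zero (hq : q ∈ C.carrier) (hvel : inner ℝ v (C.velocity q) = 0)
    (hv : v ≠ 0) : fderiv ℝ C.complexEquation q v ≠ 0 := by
  intro h
  rw [fderiv_complexEquation, Complex.ext_iff] at h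
  simp only [Complex.add_re, Complex.add_im, Complex.ofReal_re, Complex.ofReal_im,
    Complex.re_ofReal_mul, Complex.im_ofReal_mul, Complex.I_re, Complex.I_im, Complex.zero_re,
    Complex.zero_im, mul_zero, mul_one, add_zero, zero_add, mul_eq_zero, two_ne_zero, false_or,
    real_inner_comm v] at h
  have hspan : ‖C.velocity q‖ ^ 2 • v = (inner ℝ (C.velocity q) v : ℝ) • C.velocity q :=
    norm_sq_cross_smul_of_inner_eq_zero h.1 h.2
  rw [norm_velocity hq, real_inner_comm, hvel, zero_smul] at hspan
  exact hv ((smul_eq_zero.1 hspan).resolve_left (pow_pos C.radius_pos 2).ne')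

theorem continuous_foot : Continuous (C.foot q) :=
  C.continuous_rotate.comp (Real.continuous_arcsin.comp (by fun_prop))

theorem foot_self : C.foot q q = q := by simp [foot, C.rotate_zero]

theorem foot_mem_carrier (hq : q ∈ C.carrier) : C.foot q x ∈ C.carrier := rotate_mem_carrier hq _

theorem eventually_inner_sub_foot (hq : q ∈ C.carrier) :
    ∀ᶠ x in 𝓝 q, inner ℝ (x - C.foot q x) (C.velocity q) = 0 := by
  have hcoord : Continuous fun x : E3 => (inner ℝ (x - q) (C.velocity q) / C.radius ^ 2 : ℝ) := by
    fun_prop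
  filter_upwards [(hcoord.tendsto' q 0 (by simp)).eventually
    (Icc_mem_nhds (neg_lt_zero.2 one_pos) one_pos)] with x hx
  have hr := C.radius_pos.ne'
  rw [← sub_sub_sub_cancel_right x _ q, foot, rotate_sub_self, Real.sin_arcsin hx.1 hx.2,
    inner_sub_left, inner_add_left, real_inner_smul_left, real_inner_smul_left,
    real_inner_comm (C.velocity q) (q - C.center), inner_velocity_sub_center,
    real_inner_self_eq_norm_sq, norm_velocity hq]
  field_simp
  ring

/-- The direction of `C` rotated by a right angle about the unit normal `N` of the surface. -/
noncomputable def conormal (C : OrientedCircle) (N q : E3) : E3 := cross N (C.velocity q)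

theorem inner_conormal_velocity (C : OrientedCircle) (N q : E3) :
    inner ℝ (C.conormal N q) (C.velocity q) = 0 := inner_cross_right _ _

theorem inner_conormal_normal (C : OrientedCircle) (N q : E3) : inner ℝ (C.conormal N q) N = 0 :=
  inner_cross_left _ _

theorem norm_conormal (hN : IsNormalAt Φ q N) (hC : C.carrier ⊆ Φ) (hq : q ∈ C.carrier) :
    ‖C.conormal N q‖ = C.radius := by
  rw [← sq_eq_sq₀ (norm_nonneg _) C.radius_pos.le, conormal, norm_sq_cross, hN.norm_eq_one,
    norm_velocity hq, hN.inner_velocity hC hq]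
  ring

theorem conormal_ne_zero (hN : IsNormalAt Φ q N) (hC : C.carrier ⊆ Φ) (hq : q ∈ C.carrier) :
    C.conormal N q ≠ 0 :=
  norm_ne_zero_iff.1 (norm_conormal hN hC hq ▸ C.radius_pos.ne')

theorem radius_sq_smul_eq (hN : IsNormalAt Φ q N) (hC : C.carrier ⊆ Φ) (hq : q ∈ C.carrier)
    (v : E3) : C.radius ^ 2 • v = (inner ℝ (C.conormal N q) v : ℝ) • C.conormal N q +
      (C.radius ^ 2 * inner ℝ N v : ℝ) • N + (inner ℝ (C.velocity q) v : ℝ) • C.velocity q := by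
  have h := norm_sq_cross_smul N (C.velocity q) v
  rw [← conormal, norm_conormal hN hC hq, hN.inner_velocity hC hq, real_inner_self_eq_norm_sq,
    real_inner_self_eq_norm_sq, hN.norm_eq_one, norm_velocity hq, real_inner_comm N,
    real_inner_comm (C.velocity q)] at h
  rw [h]
  module

theorem tendsto_foot (hC : C.carrier ⊆ Φ) (hq : q ∈ C.carrier) :
    Tendsto (C.foot q) (𝓝[Φ] q) (𝓝[Φ] q) :=
  tendsto_nhdsWithin_iff.2
    ⟨tendsto_nhdsWithin_of_tendsto_nhds (continuous_foot.tendsto' q q foot_self),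
      .of_forall fun _ => hC (foot_mem_carrier hq)⟩

theorem eventually_sub_foot_eq (hN : IsNormalAt Φ q N) (hC : C.carrier ⊆ Φ)
    (hq : q ∈ C.carrier) : ∀ᶠ x in 𝓝[Φ] q, x - C.foot q x =
      (inner ℝ (C.conormal N q) (x - C.foot q x) : ℝ) • (C.radius ^ 2)⁻¹ • C.conormal N q +
        (inner ℝ N (x - C.foot q x) : ℝ) • N := by
  filter_upwards [(eventually_inner_sub_foot hq).filter_mono nhdsWithin_le_nhds] with x hx
  have hr : C.radius ^ 2 ≠ 0 := pow_ne_zero 2 C.radius_pos.ne'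
  refine smul_right_injective E3 hr ?_
  simp only
  rw [radius_sq_smul_eq hN hC hq (x - C.foot q x), real_inner_comm _ (C.velocity q), hx, zero_smul,
    add_zero, smul_add, smul_comm, smul_inv_smul₀ hr, mul_smul]

theorem isLittleO_inner_smul_normal (hN : IsNormalAt Φ q N) (hC : C.carrier ⊆ Φ)
    (hq : q ∈ C.carrier) : (fun x => (inner ℝ N (x - C.foot q x) : ℝ) • N) =o[𝓝[Φ] q]
      fun x => x - C.foot q x :=
  ((ContinuousLinearMap.toSpanSingleton ℝ N).isBigO_comp _ _).trans_isLittleO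
    (hN.isLittleO.comp_tendsto (tendsto_id.prodMk (tendsto_foot hC hq)))

theorem isBigO_sub_foot (hN : IsNormalAt Φ q N) (hC : C.carrier ⊆ Φ) (hq : q ∈ C.carrier) :
    (fun x => x - C.foot q x) =O[𝓝[Φ] q]
      fun x => (inner ℝ (C.conormal N q) (x - C.foot q x) : ℝ) := by
  refine (isLittleO_inner_smul_normal hN hC hq).right_isBigO_sub.trans ?_
  refine ((ContinuousLinearMap.toSpanSingleton ℝ ((C.radius ^ 2)⁻¹ • C.conormal N q)).isBigO_comp
    _ _).congr' ?_ .rfl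
  filter_upwards [eventually_sub_foot_eq hN hC hq] with x hx
  exact eq_sub_of_add_eq hx.symm

/-- The inner product is `C.radius` times the signed distance to the circle, up to higher order. -/
theorem tendsto_inv_inner_conormal_smul {F : Type*} [NormedAddCommGroup F] [NormedSpace ℝ F]
    {g : E3 → F} {g' : E3 →L[ℝ] F} (hN : IsNormalAt Φ q N) (hC : C.carrier ⊆ Φ)
    (hq : q ∈ C.carrier) (hg : HasStrictFDerivAt g g' q) (hg0 : ∀ x ∈ C.carrier, g x = 0) :
    Tendsto (fun x => (inner ℝ (C.conormal N q) (x - C.foot q x) : ℝ)⁻¹ • g x)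
      (𝓝[Φ \ C.carrier] q) (𝓝 ((C.radius ^ 2)⁻¹ • g' (C.conormal N q))) := by
  have hbigO := isBigO_sub_foot hN hC hq
  have hpair : Tendsto (fun x => (x, C.foot q x)) (𝓝[Φ] q) (𝓝 (q, q)) :=
    (tendsto_nhdsWithin_of_tendsto_nhds tendsto_id).prodMk_nhds
      ((tendsto_foot hC hq).mono_right nhdsWithin_le_nhds)
  have hstrict : (fun x => g x - g' (x - C.foot q x)) =o[𝓝[Φ] q] fun x => x - C.foot q x := by
    simpa only [hg0 _ (foot_mem_carrier hq), sub_zero, Function.comp_def] using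
      hg.isLittleO.comp_tendsto hpair
  have hnormal := ((g'.isBigO_comp _ _).trans_isLittleO (isLittleO_inner_smul_normal hN hC hq))
  have hlin : (fun x => g x - (inner ℝ (C.conormal N q) (x - C.foot q x) : ℝ) •
      (C.radius ^ 2)⁻¹ • g' (C.conormal N q)) =o[𝓝[Φ] q]
      fun x => (inner ℝ (C.conormal N q) (x - C.foot q x) : ℝ) := by
    refine ((hstrict.add hnormal).congr' ?_ .rfl).trans_isBigO hbigO
    filter_upwards [eventually_sub_foot_eq hN hC hq] with x hx
    rw [sub_add, ← map_sub, ← eq_sub_of_add_eq hx.symm, map_smul, map_smul]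
  have hle : 𝓝[Φ \ C.carrier] q ≤ 𝓝[Φ] q := nhdsWithin_mono q Set.sdiff_subset
  have hne : ∀ᶠ x in 𝓝[Φ \ C.carrier] q, inner ℝ (C.conormal N q) (x - C.foot q x) ≠ (0 : ℝ) := by
    filter_upwards [(hbigO.mono hle).eq_zero_imp,
      self_mem_nhdsWithin] with x hx hxC h0
    exact hxC.2 (sub_eq_zero.1 (hx h0) ▸ foot_mem_carrier hq)
  have hlim := (hlin.mono hle).tendsto_inv_smul_nhds_zero
  rw [← tendsto_sub_nhds_zero_iff]
  refine hlim.congr' ?_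
  filter_upwards [hne] with x hx
  rw [smul_sub, inv_smul_smul₀ hx]


theorem sphereFun_eq_re_conj_mul (hq : q ∈ C.carrier) (e : ℂ) (x : E3) :
    sphereFun (e.re • C.normal + (2 * e.im) • (q - C.center)) e.im q x =
      (conj e * C.complexEquation x).re := by
  obtain ⟨hq_radius, hq_plane⟩ := C.mem_carrier.1 hq
  have hsplit : x - C.center = (x - q) + (q - C.center) := by abel
  rw [sphereFun, complexEquation, hsplit, inner_add_right, real_inner_self_eq_norm_sq,
    norm_add_sq_real, hq_radius, inner_add_left, real_inner_smul_left, real_inner_smul_left,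
    real_inner_comm (x - q) (q - C.center), real_inner_comm (q - C.center) C.normal, hq_plane]
  simp [-Complex.ofReal_pow]
  ring

theorem exists_sphereFun_separating (hN : IsNormalAt Φ q N) (hC : C.carrier ⊆ Φ)
    (hq : q ∈ C.carrier) (hvel : inner ℝ v (C.velocity q) = 0) (hvN : inner ℝ v N = 0)
    (hv : v ≠ 0) :
    ∃ (w : E3) (b : ℝ), (∀ x ∈ C.carrier, sphereFun w b q x = 0) ∧ 0 < inner ℝ w v ∧
      inner ℝ w (C.velocity q) = 0 ∧ ∀ᶠ x in 𝓝[Φ] q, sphereFun w b q x = 0 → x ∈ C.carrier := by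
  set g' := fderiv ℝ C.complexEquation q with hg'
  set e := g' v with he
  have he0 : 0 < (conj e * e).re := by
    rw [mul_comm, Complex.mul_conj, Complex.ofReal_re]
    exact Complex.normSq_pos.2 (fderiv_complexEquation_ne_zero hq hvel hv)
  have hinner : ∀ u, inner ℝ (e.re • C.normal + (2 * e.im) • (q - C.center)) u =
      (conj e * g' u).re := by
    intro u
    rw [hg', fderiv_complexEquation, inner_add_left, real_inner_smul_left, real_inner_smul_left]
    simp
    ring
  refine ⟨e.re • C.normal + (2 * e.im) • (q - C.center), e.im, fun x hx => ?_, ?_, ?_, ?_⟩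
  · rw [sphereFun_eq_re_conj_mul hq, complexEquation_eq_zero_iff.2 hx, mul_zero, Complex.zero_re]
  · rwa [hinner]
  · rw [real_inner_comm, inner_add_right, real_inner_smul_right, real_inner_smul_right,
      inner_velocity_normal, inner_velocity_sub_center, mul_zero, mul_zero, add_zero]
  have hmul : inner ℝ (C.conormal N q) v * (conj e * g' (C.conormal N q)).re =
      C.radius ^ 2 * (conj e * e).re := by
    have h := congrArg (fun u => (conj e * g' u).re) (radius_sq_smul_eq hN hC hq v)
    rw [real_inner_comm v N, hvN, real_inner_comm v (C.velocity q), hvel] at h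
    simpa [← Complex.ofReal_pow, ← he, mul_add, mul_left_comm] using h.symm
  have hne : (conj e * ((C.radius ^ 2)⁻¹ • g' (C.conormal N q))).re ≠ 0 := by
    rw [mul_smul_comm, Complex.smul_re]
    have hprod := hmul ▸ (mul_pos (pow_pos C.radius_pos 2) he0).ne'
    exact smul_ne_zero (inv_ne_zero (pow_ne_zero 2 C.radius_pos.ne')) (right_ne_zero_of_mul hprod)
  have hlim := tendsto_inv_inner_conormal_smul hN hC hq
    (contDiff_complexEquation.contDiffAt.hasStrictFDerivAt (by simp))
    fun x hx => complexEquation_eq_zero_iff.2 hx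
  have hev := (((Complex.continuous_re.comp (continuous_const_mul (conj e))).tendsto _).comp
    hlim).eventually_ne hne
  rw [Set.sdiff_eq, nhdsWithin_inter', eventually_inf_principal] at hev
  filter_upwards [hev] with x hx hx0
  by_contra hxC
  refine hx hxC ?_
  rw [Function.comp_apply, Function.comp_apply, mul_smul_comm, Complex.smul_re,
    ← sphereFun_eq_re_conj_mul hq, hx0, smul_zero]

theorem inner_velocity_ne_zero_of_not_isTangentAt (hN : IsNormalAt Φ q N) (hC : C.carrier ⊆ Φ)
    (hD : D.carrier ⊆ Φ) (hqC : q ∈ C.carrier) (hqD : q ∈ D.carrier) (ht : ¬ IsTangentAt C D q)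
    (hw : inner ℝ w (C.velocity q) = 0) (hwν : inner ℝ w (C.conormal N q) ≠ 0) :
    inner ℝ w (D.velocity q) ≠ 0 := by
  intro hwD
  have hr := (pow_pos C.radius_pos 2).ne'
  have hexpand := radius_sq_smul_eq hN hC hqC (D.velocity q)
  rw [hN.inner_velocity hD hqD, mul_zero, zero_smul, add_zero] at hexpand
  have hconormal : inner ℝ (C.conormal N q) (D.velocity q) = (0 : ℝ) := by
    have h := congrArg (inner ℝ w) hexpand
    rw [inner_add_right, real_inner_smul_right, real_inner_smul_right, real_inner_smul_right, hwD,
      hw, mul_zero, mul_zero, add_zero] at h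
    exact (mul_eq_zero.1 h.symm).resolve_right hwν
  rw [hconormal, zero_smul, zero_add] at hexpand
  obtain ⟨k, hk⟩ : ∃ k : ℝ, D.velocity q = k • C.velocity q :=
    ⟨(C.radius ^ 2)⁻¹ * inner ℝ (C.velocity q) (D.velocity q),
      by rw [mul_smul, ← hexpand, inv_smul_smul₀ hr]⟩
  exact ht ⟨k, fun h0 => velocity_ne_zero hqD (by rw [hk, h0, zero_smul]), hk⟩

theorem eventually_rotate_notMem (hqC : q ∈ C.carrier) (hqD : q ∈ D.carrier)
    (hne : D.carrier ≠ C.carrier) : ∀ᶠ t in 𝓝[>] 0, D.rotate q t ∉ C.carrier := by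
  by_cases hsecond : ∃ s ∈ Set.Ioo 0 (2 * Real.pi), D.rotate q s ∈ C.carrier
  · obtain ⟨s, ⟨hs0, hs2⟩, hs⟩ := hsecond
    filter_upwards [Ioo_mem_nhdsGT hs0] with t ⟨ht0, hts⟩ ht
    refine hne (carrier_eq_of_three (rotate_mem_carrier hqD 0) (rotate_mem_carrier hqD t)
      (rotate_mem_carrier hqD s) (rotate_ne_rotate hqD ht0 ?_) (rotate_ne_rotate hqD hs0 ?_)
      (rotate_ne_rotate hqD hts ?_) (by rwa [rotate_zero]) ht hs) <;> linarith
  · filter_upwards [Ioo_mem_nhdsGT Real.two_pi_pos] with t ht htC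
    exact hsecond ⟨t, ht, htC⟩

theorem subset_closure_sdiff (h : ∀ b ∈ C.carrier, ∃ D : OrientedCircle, b ∈ D.carrier ∧
    D.carrier ⊆ Φ ∧ D.carrier ≠ C.carrier) : Φ ⊆ closure (Φ \ C.carrier) := by
  intro b hb
  by_cases hbC : b ∈ C.carrier
  swap
  · exact subset_closure ⟨hb, hbC⟩
  obtain ⟨D, hbD, hD, hne⟩ := h b hbC
  have hlim : Tendsto (D.rotate b) (𝓝[>] 0) (𝓝 b) :=
    ((D.continuous_rotate (x := b)).tendsto' 0 b D.rotate_zero).mono_left nhdsWithin_le_nhds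
  refine mem_closure_iff_frequently.2 (hlim.frequently (Eventually.frequently ?_))
  filter_upwards [eventually_rotate_notMem hbC hbD hne] with t ht
  exact ⟨hD (rotate_mem_carrier hbD t), ht⟩

theorem exists_tendsto_div_conj (hΦ : IsSmoothClosedSurface Φ) (hC : C.carrier ⊆ Φ) (hx : x ∈ Φ) :
    ∃ z ≠ 0, Tendsto (fun y => C.complexEquation y / conj (C.complexEquation y))
      (𝓝[Φ \ C.carrier] x) (𝓝 (z / conj z)) := by
  have hdiv : ∀ z : ℂ, z ≠ 0 → Tendsto (fun z : ℂ => z / conj z) (𝓝 z) (𝓝 (z / conj z)) :=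
    fun z hz => (tendsto_id.div (Complex.continuous_conj.tendsto z) (by simpa using hz))
  by_cases hxC : x ∈ C.carrier
  swap
  · have hx0 : C.complexEquation x ≠ 0 := fun h => hxC (complexEquation_eq_zero_iff.1 h)
    exact ⟨_, hx0, ((hdiv _ hx0).comp (contDiff_complexEquation.continuous.tendsto x)).mono_left
      nhdsWithin_le_nhds⟩
  obtain ⟨N, hN, -⟩ := hΦ.exists_normal hx
  have hz : (C.radius ^ 2)⁻¹ • fderiv ℝ C.complexEquation x (C.conormal N x) ≠ 0 :=
    smul_ne_zero (inv_ne_zero (pow_ne_zero 2 C.radius_pos.ne'))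
      (fderiv_complexEquation_ne_zero hxC (inner_conormal_velocity C N x)
        (conormal_ne_zero hN hC hxC))
  have hlim := tendsto_inv_inner_conormal_smul hN hC hxC
    (contDiff_complexEquation.contDiffAt.hasStrictFDerivAt (by simp))
    fun y hy => complexEquation_eq_zero_iff.2 hy
  refine ⟨_, hz, ((hdiv _ hz).comp hlim).congr' ?_⟩
  filter_upwards [hlim.eventually_ne hz] with y hy
  have hscalar := Complex.ofReal_ne_zero.2 (smul_ne_zero_iff.1 hy).1
  rw [Function.comp_apply, Complex.real_smul, map_mul, Complex.conj_ofReal,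
    mul_div_mul_left _ _ hscalar]

/-- The real line through the values of `C.complexEquation` extends continuously across the circle;
`m` is the square of its direction. -/
theorem exists_continuous_mul_conj_eq (hΦ : IsSmoothClosedSurface Φ) (hC : C.carrier ⊆ Φ)
    (hdense : Φ ⊆ closure (Φ \ C.carrier)) :
    ∃ m : Φ → Circle, Continuous m ∧
      ∀ x : Φ, m x * conj (C.complexEquation x) = C.complexEquation x := by
  set g : E3 → ℂ := fun y => C.complexEquation y / conj (C.complexEquation y)
  choose z hz0 hz using fun x (hx : x ∈ Φ) => exists_tendsto_div_conj hΦ hC hx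
  have hext : ∀ x : Φ, extendFrom (Φ \ C.carrier) g x = z x x.2 / conj (z x x.2) := fun x =>
    extendFrom_eq (hdense x.2) (hz x x.2)
  have hcont : Continuous fun x : Φ => extendFrom (Φ \ C.carrier) g x :=
    continuousOn_iff_continuous_domRestrict.1
      (continuousOn_extendFrom hdense fun x hx => ⟨_, hz x hx⟩)
  have hnorm : ∀ x : Φ, extendFrom (Φ \ C.carrier) g x ∈ Metric.sphere (0 : ℂ) 1 := fun x => by
    rw [mem_sphere_zero_iff_norm, hext, norm_div, RCLike.norm_conj,
      div_self (norm_ne_zero_iff.2 (hz0 x x.2))]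
  refine ⟨fun x => ⟨_, hnorm x⟩, hcont.subtype_mk _, fun x => ?_⟩
  by_cases hxC : (x : E3) ∈ C.carrier
  · rw [complexEquation_eq_zero_iff.2 hxC, map_zero, mul_zero]
  have hx0 : conj (C.complexEquation x) ≠ 0 :=
    (map_ne_zero _).2 fun h => hxC (complexEquation_eq_zero_iff.1 h)
  have hf := (contDiff_complexEquation (C := C)).continuous.tendsto x
  have hg : Tendsto g (𝓝 x) (𝓝 (g x)) :=
    hf.div ((Complex.continuous_conj.tendsto _).comp hf) hx0
  exact (congrArg (· * conj (C.complexEquation x))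
    (extendFrom_eq (hdense x.2) (hg.mono_left nhdsWithin_le_nhds))).trans (div_mul_cancel₀ _ hx0)

end OrientedCircle

/-! ### Winding numbers modulo two -/

section Winding

theorem exists_circle_lift {X : Type*} [TopologicalSpace X] [SimplyConnectedSpace X]
    [LocallyPathConnectedSpace X] {m : X → Circle} (hm : Continuous m) :
    ∃ θ : X → ℝ, Continuous θ ∧ ∀ x, Circle.exp (θ x) = m x := by
  have : Fact (0 < 2 * Real.pi) := ⟨Real.two_pi_pos⟩
  obtain ⟨x₀⟩ : Nonempty X := inferInstance
  let f : C(X, AddCircle (2 * Real.pi)) :=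
    ⟨fun x => AddCircle.homeomorphCircle'.symm (m x), by fun_prop⟩
  obtain ⟨e₀, he₀⟩ := QuotientAddGroup.mk_surjective (f x₀)
  obtain ⟨F, ⟨-, hF⟩, -⟩ :=
    (AddCircle.isCoveringMap_coe (2 * Real.pi)).existsUnique_continuousMap_lifts f x₀ e₀ he₀
  refine ⟨F, F.continuous, fun x => ?_⟩
  have hFx : ((F x : ℝ) : AddCircle (2 * Real.pi)) = AddCircle.homeomorphCircle'.symm (m x) :=
    congrFun hF x
  rw [← AddCircle.homeomorphCircle'_apply_mk, hFx, Homeomorph.apply_symm_apply]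

theorem exists_int_of_circleExp_eq {X : Type*} [TopologicalSpace X] [PreconnectedSpace X]
    {θ θ' : X → ℝ} (hθ : Continuous θ) (hθ' : Continuous θ')
    (hexp : ∀ x, Circle.exp (θ' x) = Circle.exp (θ x)) :
    ∃ k : ℤ, ∀ x, θ' x = θ x + k * (2 * Real.pi) := by
  choose k hk using fun x => Circle.exp_eq_exp.1 (hexp x)
  have hcont : Continuous k := by
    rw [Int.isClosedEmbedding_coe_real.isEmbedding.continuous_iff]
    refine ((hθ'.sub hθ).div_const (2 * Real.pi)).congr fun x => ?_
    rw [Pi.sub_apply, hk x, add_sub_cancel_left, mul_div_cancel_right₀ _ Real.two_pi_pos.ne',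
      Function.comp_apply]
  rcases isEmpty_or_nonempty X with hX | ⟨⟨x₀⟩⟩
  · exact ⟨0, fun x => (hX.false x).elim⟩
  · exact ⟨k x₀, fun x => PreconnectedSpace.constant inferInstance hcont (x := x₀) (y := x) ▸ hk x⟩

/-- The loop `μ` in the unit circle, parametrised by a period `[0, 2π]`, has even winding number:
it has a continuous square root that closes up. -/
def HasEvenWinding (μ : ℝ → Circle) : Prop :=
  ∃ η : ℝ → Circle, Continuous η ∧ (∀ t, η t ^ 2 = μ t) ∧ η (2 * Real.pi) = η 0

theorem HasEvenWinding.of_lift {μ : ℝ → Circle} {θ : ℝ → ℝ} (hθ : Continuous θ)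
    (hμ : ∀ t, Circle.exp (θ t) = μ t) {k : ℤ} (hk : Even k)
    (hperiod : θ (2 * Real.pi) = θ 0 + k * (2 * Real.pi)) : HasEvenWinding μ := by
  refine ⟨fun t => Circle.exp (θ t / 2), by fun_prop, fun t => ?_, ?_⟩
  · rw [← Circle.exp_natCast_mul, ← hμ]
    congr 1
    push_cast
    ring
  · obtain ⟨j, rfl⟩ := hk
    have hhalf : θ (2 * Real.pi) / 2 = θ 0 / 2 + j * (2 * Real.pi) := by
      rw [hperiod]
      push_cast
      ring
    simp only [hhalf, Circle.exp_add, Circle.exp_int_mul_two_pi, mul_one]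

/-- On a sphere minus a point every circle-valued map has a logarithm. -/
theorem HasEvenWinding.comp_of_sphere {X : Type*} [TopologicalSpace X]
    (H : X ≃ₜ Metric.sphere (0 : E3) 1) {m : X → Circle} (hm : Continuous m) {g : ℝ → X}
    (hg : Continuous g) (hclosed : g (2 * Real.pi) = g 0) {x₀ : X} (hx₀ : ∀ t, g t ≠ x₀) :
    HasEvenWinding (m ∘ g) := by
  have : Fact (Module.finrank ℝ E3 = 2 + 1) := ⟨by simp⟩
  set S := stereographic' 2 (H x₀) with hS
  have hsymm : Continuous S.symm := by
    have := S.continuousOn_symm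
    rw [hS, stereographic'_target] at this
    exact continuousOn_univ.1 this
  obtain ⟨θ, hθ, hθm⟩ := exists_circle_lift (hm.comp (H.symm.continuous.comp hsymm))
  have hmem : ∀ t, H (g t) ∈ S.source := by
    intro t
    rw [hS, stereographic'_source]
    exact fun h => hx₀ t (H.injective h)
  refine .of_lift (θ := fun t => θ (S (H (g t)))) (k := 0)
    (hθ.comp (S.continuousOn.comp_continuous (H.continuous.comp hg) hmem)) (fun t => ?_) .zero ?_
  · simp only [hθm, Function.comp_apply, S.left_inv (hmem t), Homeomorph.symm_apply_apply]
  · simp [hclosed]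

theorem hasDerivAt_mul_of_eq_zero {𝕜 : Type*} [NontriviallyNormedField 𝕜] {A : Type*}
    [NormedRing A] [NormedAlgebra 𝕜 A] {f e : 𝕜 → A} {a : 𝕜} {v : A} (hf : HasDerivAt f v a)
    (hfa : f a = 0) (he : ContinuousAt e a) : HasDerivAt (fun t => f t * e t) (v * e a) a := by
  rw [hasDerivAt_iff_tendsto_slope] at hf ⊢
  refine (hf.mul (he.tendsto.mono_left nhdsWithin_le_nhds)).congr fun t => ?_
  simp [slope, hfa]

theorem exists_eq_zero_of_hasDerivAt_eq {a b v : ℝ} {ρ : ℝ → ℝ} (hab : a < b)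
    (hρ : ContinuousOn ρ (Set.Icc a b)) (ha : ρ a = 0) (hb : ρ b = 0) (hva : HasDerivAt ρ v a)
    (hvb : HasDerivAt ρ v b) (hv : v ≠ 0) : ∃ t ∈ Set.Ioo a b, ρ t = 0 := by
  wlog hpos : 0 < v generalizing ρ v
  · obtain ⟨t, ht, ht0⟩ := this (ρ := -ρ) hρ.neg (by simp [ha]) (by simp [hb]) hva.neg hvb.neg
      (neg_ne_zero.2 hv) (neg_pos.2 (lt_of_le_of_ne (not_lt.1 hpos) hv))
    exact ⟨t, ht, neg_eq_zero.1 ht0⟩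
  obtain ⟨s, hsign_s, hs⟩ := ((eventually_nhdsWithin_sign_eq_of_deriv_pos (hva.deriv ▸ hpos)
    ha).filter_mono nhdsWithin_le_nhds |>.and (Ioo_mem_nhdsGT hab)).exists
  obtain ⟨t, hsign_t, ht⟩ := ((eventually_nhdsWithin_sign_eq_of_deriv_pos (hvb.deriv ▸ hpos)
    hb).filter_mono nhdsWithin_le_nhds |>.and (Ioo_mem_nhdsLT hs.2)).exists
  have hρs : 0 < ρ s := by
    rw [← sign_eq_one_iff, hsign_s, sign_eq_one_iff]
    exact sub_pos.2 hs.1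
  have hρt : ρ t < 0 := by
    rw [← sign_eq_neg_one_iff, hsign_t, sign_eq_neg_one_iff]
    exact sub_neg.2 ht.2
  obtain ⟨u, hu, hu0⟩ := intermediate_value_Icc' ht.1.le
    (hρ.mono (Set.Icc_subset_Icc hs.1.le ht.2.le)) ⟨hρt.le, hρs.le⟩
  exact ⟨u, ⟨hs.1.trans_le hu.1, hu.2.trans_lt ht.2⟩, hu0⟩

theorem ofReal_re_mul_conj {z : ℂ} {c η : Circle} (hη : η ^ 2 = c) (hz : c * conj z = z) :
    ((z * conj (η : ℂ)).re : ℂ) = z * conj (η : ℂ) := by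
  rw [← Complex.conj_eq_iff_re, map_mul, Complex.conj_conj]
  nth_rewrite 2 [← hz]
  rw [← hη, ← Circle.coe_inv_eq_conj]
  simp only [Circle.coe_pow, Circle.coe_inv]
  field_simp

theorem not_hasEvenWinding_of_simple_zero {f : ℝ → ℂ} {μ : ℝ → Circle} {v : ℂ} (hf : Continuous f)
    (hμ : ∀ t, μ t * conj (f t) = f t) (h0 : f 0 = 0) (h2π : f (2 * Real.pi) = 0)
    (hv : HasDerivAt f v 0) (hv' : HasDerivAt f v (2 * Real.pi)) (hv0 : v ≠ 0)
    (hne : ∀ t ∈ Set.Ioo 0 (2 * Real.pi), f t ≠ 0) : ¬ HasEvenWinding μ := by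
  rintro ⟨η, hη, hημ, hclosed⟩
  have hreal : ∀ t, ((f t * conj (η t : ℂ)).re : ℂ) = f t * conj (η t : ℂ) := fun t =>
    ofReal_re_mul_conj (hημ t) (hμ t)
  have hconj : Continuous fun t => conj (η t : ℂ) :=
    Complex.continuous_conj.comp (continuous_subtype_val.comp hη)
  have hconj_ne : ∀ t, conj (η t : ℂ) ≠ 0 := fun t => (map_ne_zero _).2 (Circle.coe_ne_zero _)
  have hderiv : ∀ t, f t = 0 → HasDerivAt f v t → η t = η 0 →
      HasDerivAt (fun s => (f s * conj (η s : ℂ)).re) (v * conj (η 0 : ℂ)).re t :=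
    fun t ht hvt hηt => by
      have hprod := hasDerivAt_mul_of_eq_zero hvt ht (hconj.continuousAt (x := t))
      rw [hηt] at hprod
      exact Complex.reCLM.hasFDerivAt.comp_hasDerivAt t hprod
  have hv_real : (v * conj (η 0 : ℂ)).re ≠ 0 := by
    have hcast := (hderiv 0 h0 hv rfl).ofReal_comp
    simp only [hreal] at hcast
    have := hcast.unique (hasDerivAt_mul_of_eq_zero hv h0 hconj.continuousAt)
    exact Complex.ofReal_ne_zero.1 (this ▸ mul_ne_zero hv0 (hconj_ne 0))
  obtain ⟨t, ht, ht0⟩ := exists_eq_zero_of_hasDerivAt_eq Real.two_pi_pos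
    (Complex.continuous_re.comp (hf.mul hconj)).continuousOn (by simp [h0]) (by simp [h2π])
    (hderiv 0 h0 hv rfl) (hderiv _ h2π hv' hclosed) hv_real
  refine mul_ne_zero (hne t ht) (hconj_ne t) ?_
  rw [← hreal, Complex.ofReal_eq_zero]
  exact ht0

end Winding

/-! ### Zero sets on the torus -/

section Torus
open Real
open scoped Pointwise

/-- The universal covering of the torus. -/
noncomputable def torusCover (z : ℝ × ℝ) : Circle × Circle := (Circle.exp z.1, Circle.exp z.2)

/-- The deck transformations of `torusCover`, as translation vectors indexed by the homology
classes of the torus. -/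
noncomputable def latticeVector (σ : ℤ × ℤ) : ℝ × ℝ := (σ.1 * (2 * π), σ.2 * (2 * π))

theorem continuous_torusCover : Continuous torusCover := by
  unfold torusCover
  fun_prop

theorem latticeVector_add (σ τ : ℤ × ℤ) :
    latticeVector (σ + τ) = latticeVector σ + latticeVector τ := by
  simp [latticeVector, add_mul]

theorem isClosedEmbedding_latticeVector : IsClosedEmbedding latticeVector := by
  have hmul : IsClosedEmbedding fun n : ℤ => (n : ℝ) * (2 * π) :=
    (Homeomorph.mulRight₀ (2 * π) two_pi_pos.ne').isClosedEmbedding.comp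
      Int.isClosedEmbedding_coe_real
  exact hmul.prodMap hmul

theorem torusCover_add_latticeVector (z : ℝ × ℝ) (σ : ℤ × ℤ) :
    torusCover (z + latticeVector σ) = torusCover z := by
  simp [torusCover, latticeVector, Circle.exp_add]

theorem exists_latticeVector_of_torusCover_eq {z w : ℝ × ℝ} (h : torusCover z = torusCover w) :
    ∃ σ, z = w + latticeVector σ := by
  simp only [torusCover, Prod.mk.injEq, Circle.exp_eq_exp] at h
  obtain ⟨⟨i, hi⟩, ⟨j, hj⟩⟩ := h
  exact ⟨(i, j), Prod.ext hi hj⟩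

theorem exists_torus_periods {m : Circle × Circle → Circle} (hm : Continuous m) :
    ∃ (θ : ℝ × ℝ → ℝ) (κ : ℤ × ℤ →+ ℤ), Continuous θ ∧
      (∀ z, Circle.exp (θ z) = m (torusCover z)) ∧
      ∀ z σ, θ (z + latticeVector σ) = θ z + κ σ * (2 * π) := by
  obtain ⟨θ, hθ, hθm⟩ := exists_circle_lift (hm.comp continuous_torusCover)
  have hperiod : ∀ σ, ∃ k : ℤ, ∀ z, θ (z + latticeVector σ) = θ z + k * (2 * π) := fun σ =>
    exists_int_of_circleExp_eq hθ (by fun_prop) fun z => by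
      rw [hθm, hθm, Function.comp_apply, Function.comp_apply, torusCover_add_latticeVector]
  choose κ hκ using hperiod
  refine ⟨θ, AddMonoidHom.mk' κ fun σ τ => ?_, hθ, hθm, fun z σ => hκ σ z⟩
  have hadd := hκ (σ + τ) 0
  rw [latticeVector_add, ← add_assoc, hκ, hκ, add_assoc, add_right_inj, ← add_mul] at hadd
  exact_mod_cast (mul_right_cancel₀ two_pi_pos.ne' hadd).symm

theorem exists_torus_loop_lift {g : ℝ → Circle × Circle} (hg : Continuous g)
    (hperiod : ∀ t, g (t + 2 * π) = g t) :
    ∃ (γ : ℝ → ℝ × ℝ) (τ : ℤ × ℤ), Continuous γ ∧ (∀ t, torusCover (γ t) = g t) ∧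
      ∀ t, γ (t + 2 * π) = γ t + latticeVector τ := by
  obtain ⟨a, ha, hag⟩ := exists_circle_lift (continuous_fst.comp hg)
  obtain ⟨b, hb, hbg⟩ := exists_circle_lift (continuous_snd.comp hg)
  obtain ⟨i, hi⟩ := exists_int_of_circleExp_eq ha (θ' := fun t => a (t + 2 * π)) (by fun_prop)
    fun t => by rw [hag, hag, Function.comp_apply, Function.comp_apply, hperiod]
  obtain ⟨j, hj⟩ := exists_int_of_circleExp_eq hb (θ' := fun t => b (t + 2 * π)) (by fun_prop)
    fun t => by rw [hbg, hbg, Function.comp_apply, Function.comp_apply, hperiod]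
  refine ⟨fun t => (a t, b t), (i, j), by fun_prop, fun t => ?_, fun t => ?_⟩
  · simp [torusCover, hag, hbg]
  · simp [latticeVector, hi, hj]

theorem exists_notMem_zmultiples (τ : ℤ × ℤ) : ∃ σ, σ ∉ AddSubgroup.zmultiples τ := by
  by_contra! h
  obtain ⟨k, hk⟩ := AddSubgroup.mem_zmultiples_iff.1 (h (1, 0))
  obtain ⟨l, hl⟩ := AddSubgroup.mem_zmultiples_iff.1 (h (0, 1))
  simp only [Prod.ext_iff, Prod.smul_fst, Prod.smul_snd, smul_eq_mul] at hk hl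
  have hk₀ : k ≠ 0 := by
    rintro rfl
    simp at hk
  rw [(mul_eq_zero.1 hk.2).resolve_left hk₀] at hl
  simp at hl

section LiftedLoop
variable {γ : ℝ → ℝ × ℝ} {τ : ℤ × ℤ} {S : Set (ℤ × ℤ)}

theorem lift_add_int (hγτ : ∀ t, γ (t + 2 * π) = γ t + latticeVector τ) (k : ℤ) (t : ℝ) :
    γ (t + k * (2 * π)) = γ t + latticeVector (k • τ) := by
  induction k using Int.induction_on generalizing t with
  | zero => simp [latticeVector]
  | succ n ih =>
    rw [show t + ((n + 1 : ℤ) : ℝ) * (2 * π) = (t + ((n : ℤ) : ℝ) * (2 * π)) + 2 * π by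
      push_cast; ring, hγτ, ih, add_smul, one_smul, latticeVector_add, add_assoc]
  | pred n ih =>
    have hstep := hγτ (t + ((-n - 1 : ℤ) : ℝ) * (2 * π))
    rw [show t + ((-n - 1 : ℤ) : ℝ) * (2 * π) + 2 * π = t + ((-n : ℤ) : ℝ) * (2 * π) by
      push_cast; ring, ih,
      show (-(n : ℤ)) • τ = (-(n : ℤ) - 1) • τ + τ by rw [sub_smul, one_smul, sub_add_cancel],
      latticeVector_add, ← add_assoc] at hstep
    exact (add_right_cancel hstep).symm

theorem isClosed_range_add_latticeVector (hγ : Continuous γ)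
    (hγτ : ∀ t, γ (t + 2 * π) = γ t + latticeVector τ)
    (hS : ∀ (k : ℤ), ∀ σ ∈ S, k • τ + σ ∈ S) :
    IsClosed (Set.range γ + latticeVector '' S) := by
  have hperiod : Set.range γ + latticeVector '' S
      = γ '' Set.Icc 0 (2 * π) + latticeVector '' S := by
    refine (Set.add_subset_add_right (Set.image_subset_range _ _)).antisymm' ?_
    rintro _ ⟨_, ⟨t, rfl⟩, _, ⟨σ, hσ, rfl⟩, rfl⟩
    have hmem := toIcoMod_mem_Ico two_pi_pos 0 t
    rw [zero_add] at hmem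
    refine ⟨_, ⟨toIcoMod two_pi_pos 0 t, Set.Ico_subset_Icc_self hmem, rfl⟩, _,
      ⟨toIcoDiv two_pi_pos 0 t • τ + σ, hS _ σ hσ, rfl⟩, ?_⟩
    dsimp only
    rw [latticeVector_add, ← add_assoc, ← lift_add_int hγτ, ← zsmul_eq_mul,
      toIcoMod_add_toIcoDiv_zsmul]
  rw [hperiod]
  exact (isClosedEmbedding_latticeVector.isClosedMap S (isClosed_discrete S)).add_left_of_isCompact
    (isCompact_Icc.image hγ)

theorem image_add_range_add_latticeVector (hS : ∀ (k : ℤ), ∀ σ ∈ S, k • τ + σ ∈ S) :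
    (· + latticeVector τ) '' (Set.range γ + latticeVector '' S)
      = Set.range γ + latticeVector '' S := by
  ext z
  constructor
  · rintro ⟨_, ⟨x, hx, _, ⟨σ, hσ, rfl⟩, rfl⟩, rfl⟩
    refine ⟨x, hx, _, ⟨(1 : ℤ) • τ + σ, hS 1 σ hσ, rfl⟩, ?_⟩
    simp only [latticeVector_add, one_smul]
    abel
  · rintro ⟨x, hx, _, ⟨σ, hσ, rfl⟩, rfl⟩
    refine ⟨_, ⟨x, hx, _, ⟨(-1 : ℤ) • τ + σ, hS (-1) σ hσ, rfl⟩, rfl⟩, ?_⟩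
    simp only [add_assoc, ← latticeVector_add, neg_smul, one_smul, neg_add_eq_sub,
      sub_add_cancel]

theorem disjoint_range_add_latticeVector (hγτ : ∀ t, γ (t + 2 * π) = γ t + latticeVector τ)
    (hinj : ∀ s t, torusCover (γ s) = torusCover (γ t) → ∃ k : ℤ, s = t + k * (2 * π))
    (hS : ∀ (k : ℤ), ∀ σ ∈ S, k • τ + σ ∈ S) :
    Disjoint (Set.range γ + latticeVector '' S) (Set.range γ + latticeVector '' Sᶜ) := by
  rw [Set.disjoint_left]
  rintro _ ⟨_, ⟨s, rfl⟩, _, ⟨σ, hσ, rfl⟩, rfl⟩ ⟨_, ⟨t, rfl⟩, _, ⟨σ', hσ', rfl⟩, heq⟩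
  have hcover := congrArg torusCover heq
  simp only [torusCover_add_latticeVector] at hcover
  obtain ⟨k, rfl⟩ := hinj _ _ hcover.symm
  simp only [lift_add_int hγτ, add_assoc, add_right_inj, ← latticeVector_add] at heq
  exact hσ' (isClosedEmbedding_latticeVector.injective heq ▸ hS k σ hσ)

end LiftedLoop

theorem exists_continuous_invariant_separating {X : Type*} [PseudoMetricSpace X] {A B : Set X}
    (hA : IsClosed A) (hB : IsClosed B) (hA₀ : A.Nonempty) (hB₀ : B.Nonempty) (hAB : Disjoint A B)
    {e : X → X} (he : Isometry e) (heA : e '' A = A) (heB : e '' B = B) :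
    ∃ u : X → ℝ, Continuous u ∧ (∀ x ∈ A, u x = 0) ∧ (∀ x ∈ B, u x = 1) ∧ ∀ x, u (e x) = u x := by
  have hsum : ∀ x, Metric.infDist x A + Metric.infDist x B ≠ 0 := by
    intro x hx
    have hnonnegA : 0 ≤ Metric.infDist x A := Metric.infDist_nonneg
    have hnonnegB : 0 ≤ Metric.infDist x B := Metric.infDist_nonneg
    exact Set.disjoint_left.1 hAB ((hA.mem_iff_infDist_zero hA₀).2 (by linarith))
      ((hB.mem_iff_infDist_zero hB₀).2 (by linarith))
  refine ⟨fun x => Metric.infDist x A / (Metric.infDist x A + Metric.infDist x B),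
    (Metric.continuous_infDist_pt A).div
      ((Metric.continuous_infDist_pt A).add (Metric.continuous_infDist_pt B)) hsum,
    fun x hx => ?_, fun x hx => ?_, fun x => ?_⟩
  · simp only [Metric.infDist_zero_of_mem hx, zero_div]
  · have hne := hsum x
    rw [Metric.infDist_zero_of_mem hx, add_zero] at hne
    simp only [Metric.infDist_zero_of_mem hx, add_zero, div_self hne]
  · have heA' := Metric.infDist_image he (x := x) (t := A)
    have heB' := Metric.infDist_image he (x := x) (t := B)
    rw [heA] at heA'
    rw [heB] at heB'
    simp only [heA', heB']

theorem lift_eq_of_curve {X : Type*} [TopologicalSpace X] {e : X → X} {Θ : X → ℝ}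
    (hΘ : Continuous Θ) {k : ℤ} (hk : ∀ x, Θ (e x) + Θ x = k * (2 * π)) {γ : ℝ → X}
    (hγ : Continuous γ) {ζ : Circle} (hζ : ∀ t, Circle.exp (Θ (γ t)) = ζ) {a b : ℝ}
    (hab : γ b = e (γ a)) : Θ (γ a) = k * π := by
  obtain ⟨j, hj⟩ := exists_int_of_circleExp_eq (θ := fun _ : ℝ => Θ (γ a)) continuous_const
    (hΘ.comp hγ) fun t => by rw [Function.comp_apply, hζ, hζ]
  have hja := hj a
  have hjb := hj b
  have hka := hk (γ a)
  rw [Function.comp_apply, hab] at hjb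
  rw [Function.comp_apply] at hja
  linarith

section OddFunction
variable {X : Type*} [TopologicalSpace X] [SimplyConnectedSpace X] [LocallyPathConnectedSpace X]
  {e : X → X} {ρ u : X → ℝ}

-- `exp (i Θ)` turns by `+π u` where `ρ` is positive and by `-π u` where `ρ` is negative; the two
-- choices agree on the zero set of `ρ`, where `u` is an integer, and `e` exchanges them.
theorem exists_lift_of_odd (he : Continuous e) (hρ : Continuous ρ) (hu : Continuous u)
    (hρe : ∀ x, ρ (e x) = -ρ x) (hue : ∀ x, u (e x) = u x)
    (hzero : ∀ x, ρ x = 0 → u x = 0 ∨ u x = 1) :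
    ∃ Θ : X → ℝ, Continuous Θ ∧ (∃ k : ℤ, ∀ x, Θ (e x) + Θ x = k * (2 * π)) ∧
      (∀ x, u x = 0 → Circle.exp (Θ x) = 1) ∧ ∀ x, u x = 1 → Circle.exp (Θ x) = Circle.exp π := by
  have hexp_neg_pi : (Circle.exp π)⁻¹ = Circle.exp π := by
    rw [← Circle.exp_neg, Circle.exp_eq_exp]
    exact ⟨-1, by push_cast; ring⟩
  have hagree : ∀ x, ρ x = 0 → Circle.exp (π * u x) = Circle.exp (-(π * u x)) := by
    intro x hx
    rcases hzero x hx with hux | hux <;> simp [hux, hexp_neg_pi]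
  let M : X → Circle := fun x => if 0 ≤ ρ x then Circle.exp (π * u x) else Circle.exp (-(π * u x))
  have hM : Continuous M := Continuous.if_le (by fun_prop) (by fun_prop) continuous_const hρ
    fun x hx => hagree x hx.symm
  have hMe : ∀ x, M (e x) * M x = 1 := by
    intro x
    simp only [M, hρe, hue]
    rcases lt_trichotomy (ρ x) 0 with hx | hx | hx
    · rw [if_pos (by linarith), if_neg hx.not_ge, ← Circle.exp_add, add_neg_cancel, Circle.exp_zero]
    · rw [if_pos (by linarith), if_pos hx.ge]
      nth_rewrite 2 [hagree x hx]
      rw [← Circle.exp_add, add_neg_cancel, Circle.exp_zero]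
    · rw [if_neg (by linarith), if_pos hx.le, ← Circle.exp_add, neg_add_cancel, Circle.exp_zero]
  obtain ⟨Θ, hΘ, hΘM⟩ := exists_circle_lift hM
  obtain ⟨k, hk⟩ := exists_int_of_circleExp_eq (θ := fun _ : X => (0 : ℝ))
    (θ' := fun x => Θ (e x) + Θ x) continuous_const (by fun_prop) fun x => by
      rw [Circle.exp_add, hΘM, hΘM, hMe, Circle.exp_zero]
  refine ⟨Θ, hΘ, ⟨k, fun x => by rw [hk, zero_add]⟩, fun x hx => ?_, fun x hx => ?_⟩
  · simp [hΘM, M, hx]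
  · simp [hΘM, M, hx, hexp_neg_pi]

theorem false_of_odd_of_curves (he : Continuous e) (hρ : Continuous ρ) (hu : Continuous u)
    (hρe : ∀ x, ρ (e x) = -ρ x) (hue : ∀ x, u (e x) = u x)
    (hzero : ∀ x, ρ x = 0 → u x = 0 ∨ u x = 1) {γ δ : ℝ → X} (hγ : Continuous γ)
    (hδ : Continuous δ) (hγu : ∀ t, u (γ t) = 0) (hδu : ∀ t, u (δ t) = 1) {a b : ℝ}
    (hγe : γ b = e (γ a)) (hδe : δ b = e (δ a)) : False := by
  obtain ⟨Θ, hΘ, ⟨k, hk⟩, hΘ₀, hΘ₁⟩ := exists_lift_of_odd he hρ hu hρe hue hzero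
  have hγΘ := lift_eq_of_curve hΘ hk hγ (fun t => hΘ₀ _ (hγu t)) hγe
  have hδΘ := lift_eq_of_curve hΘ hk hδ (fun t => hΘ₁ _ (hδu t)) hδe
  exact Circle.exp_pi_ne_one (by rw [← hΘ₁ _ (hδu a), hδΘ, ← hγΘ, hΘ₀ _ (hγu a)])

end OddFunction

section Period
variable {f : Circle × Circle → ℂ} {m : Circle × Circle → Circle} {θ : ℝ × ℝ → ℝ} {γ : ℝ → ℝ × ℝ}
  {τ : ℤ × ℤ}

theorem exists_odd_of_odd_period (hf : Continuous f) (hfm : ∀ x, m x * conj (f x) = f x)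
    (hθ : Continuous θ) (hθm : ∀ z, Circle.exp (θ z) = m (torusCover z)) {k : ℤ} (hk : Odd k)
    (hθτ : ∀ z, θ (z + latticeVector τ) = θ z + k * (2 * π)) :
    ∃ ρ : ℝ × ℝ → ℝ, Continuous ρ ∧ (∀ z, ρ (z + latticeVector τ) = -ρ z) ∧
      ∀ z, ρ z = 0 → f (torusCover z) = 0 := by
  let η : ℝ × ℝ → Circle := fun z => Circle.exp (θ z / 2)
  have hη : Continuous η := by fun_prop
  have hηm : ∀ z, η z ^ 2 = m (torusCover z) := by
    intro z
    rw [← hθm, ← Circle.exp_natCast_mul]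
    congr 1
    push_cast
    ring
  have hητ : ∀ z, (η (z + latticeVector τ) : ℂ) = -η z := by
    intro z
    obtain ⟨j, rfl⟩ := hk
    have hhalf : θ (z + latticeVector τ) / 2 = θ z / 2 + (j * (2 * π) + π) := by
      rw [hθτ]
      push_cast
      ring
    simp only [η, hhalf, Circle.exp_add, Circle.exp_int_mul_two_pi, one_mul, Circle.coe_mul]
    simp
  refine ⟨fun z => (f (torusCover z) * conj (η z : ℂ)).re, ?_, fun z => ?_, fun z hz => ?_⟩
  · exact Complex.continuous_re.comp ((hf.comp continuous_torusCover).mul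
      (Complex.continuous_conj.comp (continuous_subtype_val.comp hη)))
  · simp only [hητ, torusCover_add_latticeVector, map_neg, mul_neg, Complex.neg_re]
  · have hreal := ofReal_re_mul_conj (hηm z) (hfm (torusCover z))
    rw [show (f (torusCover z) * conj (η z : ℂ)).re = 0 from hz, Complex.ofReal_zero, eq_comm,
      mul_eq_zero] at hreal
    exact hreal.resolve_right (by simp)

-- The translates of the lifted curve by the multiples of its period and the other translates are
-- disjoint closed sets, so the preimage of the curve falls into two invariant pieces, to which
-- `false_of_odd_of_curves` applies.
theorem even_period_of_zero_set_eq_loop (hf : Continuous f)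
    (hfm : ∀ x, m x * conj (f x) = f x) (hθ : Continuous θ)
    (hθm : ∀ z, Circle.exp (θ z) = m (torusCover z)) {k : ℤ}
    (hθτ : ∀ z, θ (z + latticeVector τ) = θ z + k * (2 * π)) (hγ : Continuous γ)
    (hγτ : ∀ t, γ (t + 2 * π) = γ t + latticeVector τ)
    (hinj : ∀ s t, torusCover (γ s) = torusCover (γ t) → ∃ k : ℤ, s = t + k * (2 * π))
    (hzero : ∀ x, f x = 0 → ∃ t, torusCover (γ t) = x) : Even k := by
  by_contra hodd
  obtain ⟨ρ, hρ, hρτ, hρzero⟩ :=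
    exists_odd_of_odd_period hf hfm hθ hθm (Int.not_even_iff_odd.1 hodd) hθτ
  let T : Set (ℤ × ℤ) := AddSubgroup.zmultiples τ
  have hT : ∀ (k : ℤ), ∀ σ ∈ T, k • τ + σ ∈ T := fun k σ hσ =>
    add_mem (AddSubgroup.zsmul_mem_zmultiples τ k) hσ
  have hTc : ∀ (k : ℤ), ∀ σ ∈ Tᶜ, k • τ + σ ∈ Tᶜ := fun k σ hσ hmem =>
    hσ ((AddSubgroup.add_mem_cancel_left _ (AddSubgroup.zsmul_mem_zmultiples τ k)).1 hmem)
  have hmem : ∀ {S : Set (ℤ × ℤ)} t, ∀ σ ∈ S,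
      γ t + latticeVector σ ∈ Set.range γ + latticeVector '' S := fun t σ hσ =>
    Set.add_mem_add ⟨t, rfl⟩ ⟨σ, hσ, rfl⟩
  obtain ⟨σ₁, hσ₁⟩ : ∃ σ, σ ∈ Tᶜ := exists_notMem_zmultiples τ
  have h0T : 0 ∈ T := zero_mem _
  obtain ⟨u, hu, hu₀, hu₁, huτ⟩ := exists_continuous_invariant_separating
    (isClosed_range_add_latticeVector hγ hγτ hT) (isClosed_range_add_latticeVector hγ hγτ hTc)
    ⟨_, hmem 0 0 h0T⟩ ⟨_, hmem 0 σ₁ hσ₁⟩ (disjoint_range_add_latticeVector hγτ hinj hT)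
    (isometry_add_right (latticeVector τ)) (image_add_range_add_latticeVector hT)
    (image_add_range_add_latticeVector hTc)
  have huzero : ∀ z, ρ z = 0 → u z = 0 ∨ u z = 1 := by
    intro z hz
    obtain ⟨t, ht⟩ := hzero _ (hρzero z hz)
    obtain ⟨σ, rfl⟩ := exists_latticeVector_of_torusCover_eq ht.symm
    by_cases hσ : σ ∈ T
    · exact .inl (hu₀ _ (hmem t σ hσ))
    · exact .inr (hu₁ _ (hmem t σ hσ))
  have htranslate : ∀ σ, γ (0 + 2 * π) + latticeVector σ
      = γ 0 + latticeVector σ + latticeVector τ := fun σ => by rw [hγτ, add_right_comm]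
  exact false_of_odd_of_curves (continuous_add_const _) hρ hu hρτ huτ huzero
    (hγ.add_const (latticeVector 0)) (hγ.add_const (latticeVector σ₁))
    (fun t => hu₀ _ (hmem t 0 h0T)) (fun t => hu₁ _ (hmem t σ₁ hσ₁)) (htranslate 0) (htranslate σ₁)

end Period

end Torus

/-! ### Circles with even intersection -/

section Parity

/-- The class modulo `2` of a homomorphism `ℤ × ℤ → ℤ`. -/
def parityClass (κ : ℤ × ℤ →+ ℤ) : ZMod 2 × ZMod 2 := (κ (1, 0), κ (0, 1))

theorem intCast_apply_eq_parityClass (κ : ℤ × ℤ →+ ℤ) (σ : ℤ × ℤ) :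
    (κ σ : ZMod 2) = σ.1 * (parityClass κ).1 + σ.2 * (parityClass κ).2 := by
  have hσ : σ = σ.1 • ((1, 0) : ℤ × ℤ) + σ.2 • ((0, 1) : ℤ × ℤ) := by ext <;> simp
  have hκσ : κ σ = σ.1 * κ (1, 0) + σ.2 * κ (0, 1) := by
    conv_lhs => rw [hσ, map_add, map_zsmul, map_zsmul, smul_eq_mul, smul_eq_mul]
  rw [hκσ, parityClass]
  push_cast
  rfl

theorem even_apply_iff_of_parityClass_eq {κ κ' : ℤ × ℤ →+ ℤ} (h : parityClass κ = parityClass κ')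
    (σ : ℤ × ℤ) : Even (κ σ) ↔ Even (κ' σ) := by
  rw [← ZMod.intCast_eq_zero_iff_even, ← ZMod.intCast_eq_zero_iff_even,
    intCast_apply_eq_parityClass, intCast_apply_eq_parityClass, h]

theorem exists_three_of_parityClass {ι : Type*} [Fintype ι] (hι : 7 ≤ Fintype.card ι)
    (c : ι → ZMod 2 × ZMod 2) {E : ι → ι → Prop}
    (h : ∀ i j, c i = c j ∨ c i = 0 ∨ c j = 0 → E i j) :
    ∃ i j k, i ≠ j ∧ i ≠ k ∧ j ≠ k ∧ E i j ∧ E i k ∧ E j k := by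
  classical
  let c' : ι → ZMod 2 × ZMod 2 := fun i => if c i = 0 then (1, 0) else c i
  have hmaps : ∀ i ∈ Finset.univ, c' i ∈ (Finset.univ.erase 0 : Finset (ZMod 2 × ZMod 2)) := by
    intro i _
    simp only [Finset.mem_erase, Finset.mem_univ, and_true, c']
    split_ifs with hi
    exacts [by decide, hi]
  have hcard : (Finset.univ.erase (0 : ZMod 2 × ZMod 2)).card * 2
      < (Finset.univ : Finset ι).card := by
    rw [show (Finset.univ.erase (0 : ZMod 2 × ZMod 2)).card = 3 by decide, Finset.card_univ]
    lia
  obtain ⟨y, -, hy⟩ := Finset.exists_lt_card_fiber_of_mul_lt_card_of_maps_to hmaps hcard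
  obtain ⟨i, hi, j, hj, k, hk, hij, hik, hjk⟩ := Finset.two_lt_card.1 hy
  simp only [Finset.mem_filter, Finset.mem_univ, true_and] at hi hj hk
  have hE : ∀ a b, c' a = y → c' b = y → E a b := by
    intro a b ha hb
    apply h
    by_contra! hab
    simp only [c', if_neg hab.2.1, if_neg hab.2.2] at ha hb
    exact hab.1 (ha.trans hb.symm)
  exact ⟨i, j, k, hij, hik, hjk, hE _ _ hi hj, hE _ _ hi hk, hE _ _ hj hk⟩

theorem exists_three_of_even {ι : Type*} [Fintype ι] (hι : 7 ≤ Fintype.card ι)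
    {κ : ι → ℤ × ℤ →+ ℤ} {τ : ι → ℤ × ℤ} (hself : ∀ i, Even (κ i (τ i))) {E : ι → ι → Prop}
    (hE : ∀ i j, Even (κ i (τ j)) ∨ Even (κ j (τ i)) → E i j) :
    ∃ i j k, i ≠ j ∧ i ≠ k ∧ j ≠ k ∧ E i j ∧ E i k ∧ E j k := by
  have hzero : ∀ i σ, parityClass (κ i) = 0 → Even (κ i σ) := fun i σ hi =>
    (even_apply_iff_of_parityClass_eq (κ' := 0) (by rw [hi]; rfl) σ).2 Even.zero
  refine exists_three_of_parityClass hι (fun i => parityClass (κ i)) ?_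
  rintro i j (hij | hi | hj)
  · exact hE i j (.inl ((even_apply_iff_of_parityClass_eq hij _).2 (hself j)))
  · exact hE i j (.inl (hzero i _ hi))
  · exact hE i j (.inr (hzero j _ hj))

end Parity

namespace OrientedCircle
open Real
variable {C D : OrientedCircle} {p : E3} {Φ : Set E3}

/-- Two circles through `p` are tangent at `p` or meet in a further point. For circles on a surface
this is what an even intersection number forces. -/
def MeetsEvenlyAt (C D : OrientedCircle) (p : E3) : Prop :=
  C.IsTangentAt D p ∨ ∃ q, q ≠ p ∧ q ∈ C.carrier ∧ q ∈ D.carrier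

theorem MeetsEvenlyAt.symm (h : C.MeetsEvenlyAt D p) : D.MeetsEvenlyAt C p :=
  h.imp IsTangentAt.symm fun ⟨q, hqp, hqC, hqD⟩ => ⟨q, hqp, hqD, hqC⟩

/-- A circle on `Φ` as a closed curve in `Φ`. -/
noncomputable def loop (D : OrientedCircle) (hD : D.carrier ⊆ Φ) (hp : p ∈ D.carrier) (t : ℝ) : Φ :=
  ⟨D.rotate p t, hD (rotate_mem_carrier hp t)⟩

theorem continuous_loop (hD : D.carrier ⊆ Φ) (hp : p ∈ D.carrier) : Continuous (D.loop hD hp) :=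
  D.continuous_rotate.subtype_mk _

theorem loop_add_two_pi (hD : D.carrier ⊆ Φ) (hp : p ∈ D.carrier) (t : ℝ) :
    D.loop hD hp (t + 2 * π) = D.loop hD hp t := Subtype.ext (D.rotate_add_two_pi t)

theorem exists_int_of_loop_eq (hD : D.carrier ⊆ Φ) (hp : p ∈ D.carrier) {s t : ℝ}
    (h : D.loop hD hp s = D.loop hD hp t) : ∃ k : ℤ, s = t + k * (2 * π) := by
  obtain ⟨k, hk⟩ := sin_eq_zero_iff.1 ((rotate_eq_rotate_iff hp).1 (congrArg Subtype.val h))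
  exact ⟨k, by linarith⟩

theorem complexEquation_eq_zero_iff_loop (hD : D.carrier ⊆ Φ) (hp : p ∈ D.carrier) (x : Φ) :
    D.complexEquation x = 0 ↔ ∃ t, D.loop hD hp t = x := by
  rw [complexEquation_eq_zero_iff]
  constructor
  · intro h
    obtain ⟨t, -, ht⟩ := exists_rotate_eq hp h
    exact ⟨t, Subtype.ext ht⟩
  · rintro ⟨t, rfl⟩
    exact rotate_mem_carrier hp t

theorem exists_loop_ne (hD : D.carrier ⊆ Φ) (hp : p ∈ D.carrier)
    (hdense : Φ ⊆ closure (Φ \ D.carrier)) : ∃ x : Φ, ∀ t, D.loop hD hp t ≠ x := by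
  obtain ⟨y, hyΦ, hyD⟩ := closure_nonempty_iff.1 ⟨p, hdense (hD hp)⟩
  refine ⟨⟨y, hyΦ⟩, fun t ht => hyD ?_⟩
  rw [← complexEquation_eq_zero_iff]
  exact (complexEquation_eq_zero_iff_loop hD hp ⟨y, hyΦ⟩).2 ⟨t, ht⟩

-- Otherwise the equation of `C` has, along `D`, a single zero, which is simple: it would change its
-- sign relative to a square root of its squared direction an odd number of times.
theorem meetsEvenlyAt_of_hasEvenWinding (hpC : p ∈ C.carrier) (hD : D.carrier ⊆ Φ)
    (hpD : p ∈ D.carrier) {m : Φ → Circle}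
    (hm : ∀ x : Φ, m x * conj (C.complexEquation x) = C.complexEquation x)
    (h : HasEvenWinding (m ∘ D.loop hD hpD)) : C.MeetsEvenlyAt D p := by
  by_contra hcon
  simp only [MeetsEvenlyAt, not_or, not_exists, not_and] at hcon
  obtain ⟨hnot_tangent, hnot_meet⟩ := hcon
  have hderiv : ∀ t, D.rotate p t = p → HasDerivAt (fun s => C.complexEquation (D.rotate p s))
      (fderiv ℝ C.complexEquation p (D.velocity p)) t := fun t ht => by
    have hcomp := ((contDiff_complexEquation (C := C)).differentiable (by simp)
      (D.rotate p t)).hasFDerivAt.comp_hasDerivAt t (hasDerivAt_rotate hpD t)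
    rwa [ht] at hcomp
  have hrotate_two_pi : D.rotate p (2 * π) = p := by
    rw [← zero_add (2 * π), rotate_add_two_pi, rotate_zero]
  have hzero := complexEquation_eq_zero_iff.2 hpC
  refine not_hasEvenWinding_of_simple_zero (f := fun t => C.complexEquation (D.rotate p t))
    (contDiff_complexEquation.continuous.comp D.continuous_rotate)
    (fun t => hm (D.loop hD hpD t)) (by rwa [rotate_zero]) (by rwa [hrotate_two_pi])
    (hderiv 0 D.rotate_zero) (hderiv _ hrotate_two_pi) (fun h0 => ?_) (fun t ht h0 => ?_) h
  · rw [fderiv_complexEquation, Complex.ext_iff] at h0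
    refine hnot_tangent (isTangentAt_of_inner hpC hpD ?_ ?_)
    · simpa [real_inner_comm] using h0.1
    · simpa [real_inner_comm] using h0.2
  · refine hnot_meet (D.rotate p t) (fun hp => ?_) (complexEquation_eq_zero_iff.1 h0)
      (rotate_mem_carrier hpD t)
    exact rotate_ne_rotate hpD ht.1 (by linarith [ht.2]) (D.rotate_zero.trans hp.symm)

theorem meetsEvenlyAt_of_homeomorph_sphere (hΦ : IsSmoothClosedSurface Φ)
    (H : Φ ≃ₜ Metric.sphere (0 : E3) 1) (hpC : p ∈ C.carrier) (hC : C.carrier ⊆ Φ)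
    (hCdense : Φ ⊆ closure (Φ \ C.carrier)) (hpD : p ∈ D.carrier) (hD : D.carrier ⊆ Φ)
    (hDdense : Φ ⊆ closure (Φ \ D.carrier)) : C.MeetsEvenlyAt D p := by
  obtain ⟨m, hm, hmC⟩ := exists_continuous_mul_conj_eq hΦ hC hCdense
  obtain ⟨x, hx⟩ := exists_loop_ne hD hpD hDdense
  have hclosed := loop_add_two_pi hD hpD 0
  rw [zero_add] at hclosed
  exact meetsEvenlyAt_of_hasEvenWinding hpC hD hpD hmC
    (.comp_of_sphere H hm (continuous_loop hD hpD) hclosed hx)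

/-- The homomorphisms `κ i` and the vectors `τ i` are the classes of the circles in the first
cohomology and the first homology of the torus. -/
theorem exists_torus_classes (hΦ : IsSmoothClosedSurface Φ) (H : Φ ≃ₜ Circle × Circle) {ι : Type*}
    {C : ι → OrientedCircle} (hp : ∀ i, p ∈ (C i).carrier) (hC : ∀ i, (C i).carrier ⊆ Φ)
    (hdense : ∀ i, Φ ⊆ closure (Φ \ (C i).carrier)) :
    ∃ (κ : ι → ℤ × ℤ →+ ℤ) (τ : ι → ℤ × ℤ), (∀ i, Even (κ i (τ i))) ∧
      ∀ i j, Even (κ i (τ j)) → (C i).MeetsEvenlyAt (C j) p := by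
  choose m hm hmC using fun i => exists_continuous_mul_conj_eq hΦ (hC i) (hdense i)
  choose θ κ hθ hθm hκ using fun i => exists_torus_periods ((hm i).comp H.symm.continuous)
  choose γ τ hγ hγloop hγτ using fun i =>
    exists_torus_loop_lift (g := fun t => H ((C i).loop (hC i) (hp i) t))
      (H.continuous.comp (continuous_loop _ _)) fun t => by rw [loop_add_two_pi]
  refine ⟨κ, τ, fun i => ?_, fun i j hij => ?_⟩
  · refine even_period_of_zero_set_eq_loop (f := fun x => (C i).complexEquation (H.symm x))
      (contDiff_complexEquation.continuous.comp
        (continuous_subtype_val.comp H.symm.continuous))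
      (fun x => hmC i (H.symm x)) (hθ i) (hθm i) (fun z => hκ i z (τ i)) (hγ i) (hγτ i)
      (fun s t hst => ?_) fun x hx => ?_
    · rw [hγloop, hγloop] at hst
      exact exists_int_of_loop_eq (hC i) (hp i) (H.injective hst)
    · obtain ⟨t, ht⟩ := (complexEquation_eq_zero_iff_loop (hC i) (hp i) _).1 hx
      exact ⟨t, by rw [hγloop, ht, H.apply_symm_apply]⟩
  · refine meetsEvenlyAt_of_hasEvenWinding (hp i) (hC j) (hp j) (hmC i)
      (.of_lift ((hθ i).comp (hγ j)) (fun t => ?_) hij ?_)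
    · rw [Function.comp_apply, hθm, hγloop, Function.comp_apply, H.symm_apply_apply,
        Function.comp_apply]
    · have hperiod := hγτ j 0
      rw [zero_add] at hperiod
      simp only [Function.comp_apply, hperiod, hκ]

theorem exists_three_meetsEvenlyAt (hΦ : IsSmoothClosedSurface Φ) {n : ℕ}
    (htop : 3 ≤ n ∧ Nonempty (Φ ≃ₜ Metric.sphere (0 : E3) 1) ∨
      7 ≤ n ∧ Nonempty (Φ ≃ₜ Circle × Circle))
    {C : Fin n → OrientedCircle} (hp : ∀ i, p ∈ (C i).carrier) (hC : ∀ i, (C i).carrier ⊆ Φ)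
    (hdense : ∀ i, Φ ⊆ closure (Φ \ (C i).carrier)) :
    ∃ i j k, i ≠ j ∧ i ≠ k ∧ j ≠ k ∧ (C i).MeetsEvenlyAt (C j) p ∧ (C i).MeetsEvenlyAt (C k) p ∧
      (C j).MeetsEvenlyAt (C k) p := by
  rcases htop with ⟨hn, ⟨H⟩⟩ | ⟨hn, ⟨H⟩⟩
  · have hmeet : ∀ i j, (C i).MeetsEvenlyAt (C j) p := fun i j =>
      meetsEvenlyAt_of_homeomorph_sphere hΦ H (hp i) (hC i) (hdense i) (hp j) (hC j) (hdense j)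
    refine ⟨⟨0, by lia⟩, ⟨1, by lia⟩, ⟨2, by lia⟩, ?_, ?_, ?_, hmeet _ _, hmeet _ _, hmeet _ _⟩
    all_goals simp
  · obtain ⟨κ, τ, hself, hmeet⟩ := exists_torus_classes hΦ H hp hC hdense
    exact exists_three_of_even (by simpa using hn) hself fun i j hij =>
      hij.elim (hmeet i j) fun hji => (hmeet j i hji).symm

end OrientedCircle

/-! ### Continuous families of circles -/

theorem exists_neg_pos_of_hasDerivAt {g : ℝ → ℝ} {d t₀ : ℝ} (hd : HasDerivAt g d t₀) (hd0 : 0 < d)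
    (h0 : g t₀ = 0) {S : Set ℝ} (hS : S ∈ 𝓝 t₀) :
    ∃ s t, s ≤ t ∧ Set.Icc s t ⊆ S ∧ g s < 0 ∧ 0 < g t := by
  have hsign := eventually_nhdsWithin_sign_eq_of_deriv_pos (hd.deriv.symm ▸ hd0) h0
  obtain ⟨ε, hε, hball⟩ := Metric.nhds_basis_closedBall.eventually_iff.1 (hsign.and hS)
  rw [Real.closedBall_eq_Icc] at hball
  have hleft := (hball (x := t₀ - ε) ⟨le_rfl, by linarith⟩).1
  have hright := (hball (x := t₀ + ε) ⟨by linarith, le_rfl⟩).1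
  refine ⟨t₀ - ε, t₀ + ε, by linarith, fun x hx => (hball hx).2, ?_, ?_⟩
  · rw [← sign_eq_neg_one_iff, hleft, sign_eq_neg_one_iff]
    linarith
  · rw [← sign_eq_one_iff, hright, sign_eq_one_iff]
    linarith

/-- A family of circles on `Φ`, continuous at `p`; the circle with index `x` passes through `x`. -/
structure IsCircleFamilyAt (Φ : Set E3) (p : E3) (Γ : E3 → OrientedCircle) : Prop where
  tendsto_center : Tendsto (fun x => (Γ x).center) (𝓝[Φ] p) (𝓝 (Γ p).center)
  tendsto_normal : Tendsto (fun x => (Γ x).normal) (𝓝[Φ] p) (𝓝 (Γ p).normal)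
  mem : ∀ᶠ x in 𝓝[Φ] p, x ∈ (Γ x).carrier ∧ (Γ x).carrier ⊆ Φ

namespace IsCircleFamilyAt

variable {Φ : Set E3} {p q N : E3} {Γ : E3 → OrientedCircle} {C D : OrientedCircle} {a : ℝ}

theorem tendsto_rotate (h : IsCircleFamilyAt Φ p Γ) (t₀ : ℝ) :
    Tendsto (fun z : E3 × ℝ => (Γ z.1).rotate z.1 z.2) (𝓝[Φ] p ×ˢ 𝓝 t₀)
      (𝓝 ((Γ p).rotate p t₀)) := by
  have hpoint : Tendsto (fun z : E3 × ℝ => z.1) (𝓝[Φ] p ×ˢ 𝓝 t₀) (𝓝 p) :=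
    tendsto_fst.mono_right nhdsWithin_le_nhds
  have hangle : Tendsto (fun z : E3 × ℝ => z.2) (𝓝[Φ] p ×ˢ 𝓝 t₀) (𝓝 t₀) := tendsto_snd
  have hcenter := h.tendsto_center.comp (tendsto_fst (g := 𝓝 t₀))
  have hnormal := h.tendsto_normal.comp (tendsto_fst (g := 𝓝 t₀))
  have hradial := hpoint.sub hcenter
  have hvelocity := (continuous_cross.tendsto ((Γ p).normal, p - (Γ p).center)).comp
    (hnormal.prodMk_nhds hradial)
  exact (hcenter.add (((Real.continuous_cos.tendsto t₀).comp hangle).smul hradial)).add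
    (((Real.continuous_sin.tendsto t₀).comp hangle).smul hvelocity)

theorem tendsto_rotate_const (h : IsCircleFamilyAt Φ p Γ) (t₀ : ℝ) :
    Tendsto (fun x => (Γ x).rotate x t₀) (𝓝[Φ] p) (𝓝 ((Γ p).rotate p t₀)) := by
  have hpair : Tendsto (fun x => (x, t₀)) (𝓝[Φ] p) (𝓝[Φ] p ×ˢ 𝓝 t₀) :=
    tendsto_id.prodMk tendsto_const_nhds
  simpa only [Function.comp_def] using (h.tendsto_rotate t₀).comp hpair

theorem eventually_exists_zero_of_deriv_pos (h : IsCircleFamilyAt Φ p Γ) {f : E3 → ℝ}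
    (hf : Continuous f) {t₀ d : ℝ} (hd : HasDerivAt (fun t => f ((Γ p).rotate p t)) d t₀)
    (hd0 : 0 < d) (h0 : f ((Γ p).rotate p t₀) = 0) {O : Set E3}
    (hO : O ∈ 𝓝 ((Γ p).rotate p t₀)) :
    ∀ᶠ x in 𝓝[Φ] p, ∃ t, (Γ x).rotate x t ∈ O ∧ f ((Γ x).rotate x t) = 0 := by
  obtain ⟨near, hnear, close, hclose, hO⟩ :=
    eventually_prod_iff.1 ((h.tendsto_rotate t₀).eventually hO)
  obtain ⟨s, t, hst, hIcc, hs, ht⟩ := exists_neg_pos_of_hasDerivAt hd hd0 h0 hclose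
  have hlim (u : ℝ) := (hf.tendsto _).comp (h.tendsto_rotate_const u)
  filter_upwards [hnear, (hlim s).eventually_lt_const hs, (hlim t).eventually_const_lt ht]
    with x hx hxs hxt
  obtain ⟨u, hu, hu0⟩ := intermediate_value_Icc hst
    (hf.comp (Γ x).continuous_rotate).continuousOn ⟨hxs.le, hxt.le⟩
  exact ⟨u, hO hx (hIcc hu), hu0⟩

theorem eventually_exists_zero (h : IsCircleFamilyAt Φ p Γ) {f : E3 → ℝ} (hf : Continuous f)
    {t₀ d : ℝ} (hd : HasDerivAt (fun t => f ((Γ p).rotate p t)) d t₀) (hd0 : d ≠ 0)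
    (h0 : f ((Γ p).rotate p t₀) = 0) {O : Set E3} (hO : O ∈ 𝓝 ((Γ p).rotate p t₀)) :
    ∀ᶠ x in 𝓝[Φ] p, ∃ t, (Γ x).rotate x t ∈ O ∧ f ((Γ x).rotate x t) = 0 := by
  rcases hd0.lt_or_gt with hneg | hpos
  · simpa using h.eventually_exists_zero_of_deriv_pos hf.neg hd.fun_neg (neg_pos.2 hneg)
      (neg_eq_zero.2 h0) hO
  · exact h.eventually_exists_zero_of_deriv_pos hf hd hpos h0 hO

theorem eventually_exists_mem (hΦ : IsSmoothClosedSurface Φ) (hp : p ∈ Φ)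
    (h : IsCircleFamilyAt Φ p Γ) (hC : C.carrier ⊆ Φ) (hqC : q ∈ C.carrier)
    (hq : q ∈ (Γ p).carrier) (ht : ¬ C.IsTangentAt (Γ p) q) {O : Set E3} (hO : O ∈ 𝓝 q) :
    ∀ᶠ x in 𝓝[Φ] p, ∃ y ∈ O, y ∈ (Γ x).carrier ∧ y ∈ C.carrier := by
  obtain ⟨hpΓ, hΓ⟩ := h.mem.self_of_nhdsWithin hp
  obtain ⟨N, hN, -⟩ := hΦ.exists_normal (hC hqC)
  obtain ⟨w, b, -, hwpos, hwvel, hsep⟩ := OrientedCircle.exists_sphereFun_separating hN hC hqC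
    (C.inner_conormal_velocity N q) (C.inner_conormal_normal N q)
    (OrientedCircle.conormal_ne_zero hN hC hqC)
  have hderiv := OrientedCircle.inner_velocity_ne_zero_of_not_isTangentAt hN hC hΓ hqC hq ht hwvel
    hwpos.ne'
  obtain ⟨t₀, -, rfl⟩ := OrientedCircle.exists_rotate_eq hpΓ hq
  have hzero := h.eventually_exists_zero (continuous_sphereFun w b _)
    (OrientedCircle.hasDerivAt_sphereFun_rotate hpΓ rfl) hderiv (sphereFun_self _ _ _)
    (inter_mem hO (eventually_nhdsWithin_iff.1 hsep))
  filter_upwards [hzero, h.mem] with x ⟨t, ⟨htO, htC⟩, ht0⟩ ⟨hx, hxΦ⟩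
  have hmem := OrientedCircle.rotate_mem_carrier hx t
  exact ⟨_, htO, hmem, htC (hxΦ hmem) ht0⟩

theorem eventually_sphereFun_eq_zero_of_ne {q' : E3} (hΦ : IsSmoothClosedSurface Φ) (hp : p ∈ Φ)
    (h : IsCircleFamilyAt Φ p Γ) (hC : C.carrier ⊆ Φ) (hD : D.carrier ⊆ Φ) (hpC : p ∈ C.carrier)
    (hpt : ¬ C.IsTangentAt (Γ p) p) (hqC : q ∈ C.carrier) (hqΓ : q ∈ (Γ p).carrier)
    (hqt : ¬ C.IsTangentAt (Γ p) q) (hqD : q' ∈ D.carrier) (hqΓ' : q' ∈ (Γ p).carrier)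
    (hqt' : ¬ D.IsTangentAt (Γ p) q') (hpq : p ≠ q) (hpq' : p ≠ q') (hqq' : q ≠ q')
    (hCN : ∀ x ∈ C.carrier, sphereFun N a p x = 0)
    (hDN : ∀ x ∈ D.carrier, sphereFun N a p x = 0) :
    ∀ᶠ x in 𝓝[Φ] p, sphereFun N a p x = 0 := by
  have hpΓ := (h.mem.self_of_nhdsWithin hp).1
  obtain ⟨U, V, hU, hV, hpU, hqV, hUV⟩ := t2_separation hpq
  obtain ⟨U', V', hU', hV', hpU', hqV', hUV'⟩ := t2_separation hpq'
  obtain ⟨W, W', hW, hW', hqW, hqW', hWW'⟩ := t2_separation hqq'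
  filter_upwards [h.mem,
    eventually_exists_mem hΦ hp h hC hpC hpΓ hpt (inter_mem (hU.mem_nhds hpU) (hU'.mem_nhds hpU')),
    eventually_exists_mem hΦ hp h hC hqC hqΓ hqt (inter_mem (hV.mem_nhds hqV) (hW.mem_nhds hqW)),
    eventually_exists_mem hΦ hp h hD hqD hqΓ' hqt'
      (inter_mem (hV'.mem_nhds hqV') (hW'.mem_nhds hqW'))]
    with x ⟨hx, _⟩ ⟨y, hy, hyΓ, hyC⟩ ⟨z, hz, hzΓ, hzC⟩ ⟨z', hz', hzΓ', hzD⟩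
  exact OrientedCircle.sphereFun_eq_zero_of_three hyΓ hzΓ hzΓ' (hUV.ne_of_mem hy.1 hz.1)
    (hUV'.ne_of_mem hy.2 hz'.1) (hWW'.ne_of_mem hz.2 hz'.2) (hCN y hyC) (hCN z hzC) (hDN z' hzD) hx

theorem eventually_sphereFun_eq_zero_of_common (hΦ : IsSmoothClosedSurface Φ) (hp : p ∈ Φ)
    (h : IsCircleFamilyAt Φ p Γ) (hN : IsNormalAt Φ p N) (hC : C.carrier ⊆ Φ) (hD : D.carrier ⊆ Φ)
    (hpC : p ∈ C.carrier) (hpD : p ∈ D.carrier) (hCD : C.carrier ≠ D.carrier)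
    (hptC : ¬ C.IsTangentAt (Γ p) p) (hptD : ¬ D.IsTangentAt (Γ p) p) (hqΓ : q ∈ (Γ p).carrier)
    (hqC : q ∈ C.carrier) (hqD : q ∈ D.carrier) (hqtC : ¬ C.IsTangentAt (Γ p) q)
    (hqtD : ¬ D.IsTangentAt (Γ p) q) (hpq : p ≠ q) (hCN : ∀ x ∈ C.carrier, sphereFun N a p x = 0)
    (hDN : ∀ x ∈ D.carrier, sphereFun N a p x = 0) :
    ∀ᶠ x in 𝓝[Φ] p, sphereFun N a p x = 0 := by
  have hpΓ := (h.mem.self_of_nhdsWithin hp).1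
  obtain ⟨U, V, hU, hV, hpU, hqV, hUV⟩ := t2_separation hpq
  filter_upwards [h.mem,
    eventually_exists_mem hΦ hp h hC hpC hpΓ hptC (hU.mem_nhds hpU),
    eventually_exists_mem hΦ hp h hD hpD hpΓ hptD (hU.mem_nhds hpU),
    eventually_exists_mem hΦ hp h hC hqC hqΓ hqtC (hV.mem_nhds hqV),
    eventually_exists_mem hΦ hp h hD hqD hqΓ hqtD (hV.mem_nhds hqV)]
    with x ⟨hx, hxΦ⟩ ⟨y, hyU, hyΓ, hyC⟩ ⟨y', hyU', hyΓ', hyD⟩ ⟨z, hzV, hzΓ, hzC⟩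
      ⟨z', hzV', hzΓ', hzD⟩
  have hyz := hUV.ne_of_mem hyU hzV
  by_cases hyy' : y ≠ y'
  · exact OrientedCircle.sphereFun_eq_zero_of_three hyΓ hyΓ' hzΓ hyy' hyz
      (hUV.ne_of_mem hyU' hzV) (hCN y hyC) (hDN y' hyD) (hCN z hzC) hx
  by_cases hzz' : z ≠ z'
  · exact OrientedCircle.sphereFun_eq_zero_of_three hyΓ hzΓ hzΓ' hyz
      (hUV.ne_of_mem hyU hzV') hzz' (hCN y hyC) (hCN z hzC) (hDN z' hzD) hx
  -- The two distinct circles share `p`, `q`, `y`, `z`, so `Γ x` passes through `p` and `q`.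
  push Not at hyy' hzz'
  subst hyy' hzz'
  obtain rfl : y = p := by
    by_contra hyp
    exact hCD (OrientedCircle.carrier_eq_of_three hyC hpC hqC hyp (hUV.ne_of_mem hyU hqV) hpq hyD
      hpD hqD)
  exact OrientedCircle.sphereFun_eq_zero_of_tangent hyΓ hzΓ hyz.symm
    (hN.inner_velocity hxΦ hyΓ) (hCN z hzC) hx

/-- The neighbours of `Γ p` meet the two circles in at least three points of the sphere, hence lie
on it. -/
theorem eventually_sphereFun_eq_zero_of_transversal (hΦ : IsSmoothClosedSurface Φ) (hp : p ∈ Φ)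
    (h : IsCircleFamilyAt Φ p Γ) (hN : IsNormalAt Φ p N) (hC : C.carrier ⊆ Φ) (hD : D.carrier ⊆ Φ)
    (hpC : p ∈ C.carrier) (hpD : p ∈ D.carrier) (hCD : C.carrier ≠ D.carrier)
    (hΓC : C.carrier ≠ (Γ p).carrier) (hΓD : D.carrier ≠ (Γ p).carrier)
    (htC : ¬ C.IsTangentAt (Γ p) p) (htD : ¬ D.IsTangentAt (Γ p) p)
    (heC : C.MeetsEvenlyAt (Γ p) p) (heD : D.MeetsEvenlyAt (Γ p) p)
    (hCN : ∀ x ∈ C.carrier, sphereFun N a p x = 0)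
    (hDN : ∀ x ∈ D.carrier, sphereFun N a p x = 0) :
    ∀ᶠ x in 𝓝[Φ] p, sphereFun N a p x = 0 := by
  have hpΓ := (h.mem.self_of_nhdsWithin hp).1
  obtain ⟨q, hqp, hqC, hqΓ⟩ := heC.resolve_left htC
  obtain ⟨q', hqp', hqD, hqΓ'⟩ := heD.resolve_left htD
  have hqtC : ¬ C.IsTangentAt (Γ p) q := fun ht =>
    hΓC (OrientedCircle.carrier_eq_of_isTangentAt hqC hqΓ ht hpC hpΓ hqp.symm)
  have hqtD : ¬ D.IsTangentAt (Γ p) q' := fun ht =>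
    hΓD (OrientedCircle.carrier_eq_of_isTangentAt hqD hqΓ' ht hpD hpΓ hqp'.symm)
  rcases eq_or_ne q q' with rfl | hqq'
  · exact h.eventually_sphereFun_eq_zero_of_common hΦ hp hN hC hD hpC hpD hCD htC htD hqΓ hqC hqD
      hqtC hqtD hqp.symm hCN hDN
  · exact h.eventually_sphereFun_eq_zero_of_ne hΦ hp hC hD hpC htC hqC hqΓ hqtC hqD hqΓ' hqtD
      hqp.symm hqp'.symm hqq' hCN hDN

end IsCircleFamilyAt

namespace OrientedCircle

variable {Φ : Set E3} {p N ν w : E3} {C D : OrientedCircle} {b : ℝ}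

theorem inner_curvatureVector_velocity (C : OrientedCircle) (p : E3) :
    inner ℝ (C.curvatureVector p) (C.velocity p) = 0 := by
  rw [curvatureVector, inner_smul_left, real_inner_comm, ← neg_sub p, inner_neg_right,
    inner_velocity_sub_center]
  simp

theorem inner_curvatureVector_normal (hp : p ∈ C.carrier) :
    inner ℝ C.normal (C.curvatureVector p) = 0 := by
  rw [curvatureVector, inner_smul_right, real_inner_comm, ← neg_sub p, inner_neg_left,
    (C.mem_carrier.1 hp).2]
  simp

theorem inner_curvatureVector_sub_center (hp : p ∈ C.carrier) :
    inner ℝ (p - C.center) (C.curvatureVector p) = -1 := by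
  rw [curvatureVector, inner_smul_right, ← neg_sub p, inner_neg_right, real_inner_self_eq_norm_sq,
    (C.mem_carrier.1 hp).1, mul_neg, inv_mul_cancel₀ (pow_pos C.radius_pos 2).ne']

theorem IsTangentAt.inner_velocity_eq_zero (ht : C.IsTangentAt D p)
    (hν : inner ℝ ν (C.velocity p) = 0) : inner ℝ ν (D.velocity p) = 0 := by
  obtain ⟨k, -, hk⟩ := ht
  rw [hk, inner_smul_right, hν, mul_zero]

theorem carrier_subset_of_curvatureVector_eq (hpC : p ∈ C.carrier) (hpD : p ∈ D.carrier)
    (ht : C.IsTangentAt D p) (hκ : C.curvatureVector p = D.curvatureVector p) :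
    D.carrier ⊆ C.carrier := fun x hx => by
  refine (mem_carrier_iff_sphereFun hpC).2
    ⟨sphereFun_eq_zero_of_curvatureVector hpD (ht.inner_velocity_eq_zero ?_) ?_ hx,
      sphereFun_eq_zero_of_curvatureVector hpD (ht.inner_velocity_eq_zero ?_) ?_ hx⟩
  · rw [real_inner_comm, inner_velocity_normal]
  · rw [← hκ, inner_curvatureVector_normal hpC]
    ring
  · rw [real_inner_smul_left, real_inner_comm, inner_velocity_sub_center, mul_zero]
  · rw [← hκ, real_inner_smul_left, inner_curvatureVector_sub_center hpC]
    ring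

theorem carrier_eq_of_curvatureVector_eq (hpC : p ∈ C.carrier) (hpD : p ∈ D.carrier)
    (ht : C.IsTangentAt D p) (hκ : C.curvatureVector p = D.curvatureVector p) :
    C.carrier = D.carrier :=
  (carrier_subset_of_curvatureVector_eq hpD hpC ht.symm hκ.symm).antisymm
    (carrier_subset_of_curvatureVector_eq hpC hpD ht hκ)

theorem exists_eq_smul_of_inner_eq_zero {u : E3} (hN : IsNormalAt Φ p N) (hC : C.carrier ⊆ Φ)
    (hp : p ∈ C.carrier) (hνvel : inner ℝ ν (C.velocity p) = 0) (hνN : inner ℝ ν N = 0)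
    (hν : ν ≠ 0) (huvel : inner ℝ u (C.velocity p) = 0) (huN : inner ℝ u N = 0) :
    ∃ s : ℝ, u = s • ν := by
  have hr := (pow_pos C.radius_pos 2).ne'
  have hexpand {v : E3} (hvvel : inner ℝ v (C.velocity p) = 0) (hvN : inner ℝ v N = 0) :
      C.radius ^ 2 • v = (inner ℝ (C.conormal N p) v : ℝ) • C.conormal N p := by
    rw [radius_sq_smul_eq hN hC hp v, real_inner_comm v N, hvN, real_inner_comm v (C.velocity p),
      hvvel]
    simp
  have hinner : inner ℝ (C.conormal N p) ν ≠ (0 : ℝ) := fun h0 => by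
    have hzero := hexpand hνvel hνN
    rw [h0, zero_smul] at hzero
    exact hν ((smul_eq_zero.1 hzero).resolve_left hr)
  refine ⟨inner ℝ (C.conormal N p) u / inner ℝ (C.conormal N p) ν,
    smul_right_injective E3 hr ?_⟩
  simp only
  rw [hexpand huvel huN, smul_comm, hexpand hνvel hνN, smul_smul, div_mul_cancel₀ _ hinner]

/-- By Meusnier's theorem the normal components of the curvature vectors agree. -/
theorem exists_curvatureVector_sub_eq_smul (hN : IsNormalAt Φ p N) (hC : C.carrier ⊆ Φ)
    (hD : D.carrier ⊆ Φ) (hpC : p ∈ C.carrier) (hpD : p ∈ D.carrier) (ht : C.IsTangentAt D p)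
    (hνvel : inner ℝ ν (C.velocity p) = 0) (hνN : inner ℝ ν N = 0) (hν : ν ≠ 0) :
    ∃ s : ℝ, C.curvatureVector p - D.curvatureVector p = s • ν := by
  refine exists_eq_smul_of_inner_eq_zero hN hC hpC hνvel hνN hν ?_ ?_
  · rw [inner_sub_left, inner_curvatureVector_velocity,
      ht.symm.inner_velocity_eq_zero (D.inner_curvatureVector_velocity p), sub_zero]
  · rw [real_inner_comm, inner_sub_right, hN.inner_curvatureVector_eq hC hD hpC hpD ht, sub_self]

theorem inner_curvatureVector_ne (hN : IsNormalAt Φ p N) (hC : C.carrier ⊆ Φ) (hD : D.carrier ⊆ Φ)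
    (hpC : p ∈ C.carrier) (hpD : p ∈ D.carrier) (ht : C.IsTangentAt D p)
    (hνvel : inner ℝ ν (C.velocity p) = 0) (hνN : inner ℝ ν N = 0) (hν : ν ≠ 0)
    (hne : C.carrier ≠ D.carrier) :
    inner ℝ ν (C.curvatureVector p) ≠ inner ℝ ν (D.curvatureVector p) := fun heq => by
  obtain ⟨s, hs⟩ := exists_curvatureVector_sub_eq_smul hN hC hD hpC hpD ht hνvel hνN hν
  have hinner := congrArg (inner ℝ ν) hs
  rw [inner_sub_right, heq, sub_self, real_inner_smul_right] at hinner
  have hs0 := (mul_eq_zero.1 hinner.symm).resolve_right (inner_self_ne_zero.2 hν)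
  rw [hs0, zero_smul, sub_eq_zero] at hs
  exact hne (carrier_eq_of_curvatureVector_eq hpC hpD ht hs)

theorem sphereFun_neg_of_inner_curvatureVector_lt {x : E3} (hN : IsNormalAt Φ p N)
    (hC : C.carrier ⊆ Φ) (hD : D.carrier ⊆ Φ) (hpC : p ∈ C.carrier) (hpD : p ∈ D.carrier)
    (ht : C.IsTangentAt D p) (hνvel : inner ℝ ν (C.velocity p) = 0) (hνN : inner ℝ ν N = 0)
    (hν : ν ≠ 0) (hCw : ∀ x ∈ C.carrier, sphereFun w b p x = 0) (hwν : 0 < inner ℝ w ν)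
    (hwvel : inner ℝ w (C.velocity p) = 0)
    (hlt : inner ℝ ν (D.curvatureVector p) < inner ℝ ν (C.curvatureVector p)) (hx : x ∈ D.carrier)
    (hxp : x ≠ p) : sphereFun w b p x < 0 := by
  have hopposite : C.rotate p Real.pi ≠ p := by
    rw [Ne, rotate_eq_self_iff hpC, Real.sin_pi_div_two]
    exact one_ne_zero
  have hCκ := two_mul_add_inner_curvatureVector_eq_zero hpC (rotate_mem_carrier hpC Real.pi)
    hopposite hwvel (hCw _ (rotate_mem_carrier hpC Real.pi))
  obtain ⟨s, hs⟩ := exists_curvatureVector_sub_eq_smul hN hC hD hpC hpD ht hνvel hνN hν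
  have hinner (v : E3) : inner ℝ v (C.curvatureVector p) - inner ℝ v (D.curvatureVector p) =
      s * inner ℝ v ν := by
    rw [← inner_sub_right, hs, real_inner_smul_right]
  have hspos : 0 < s := by
    have hprod := hinner ν ▸ sub_pos.2 hlt
    exact pos_of_mul_pos_left hprod real_inner_self_nonneg
  have hDκ : 2 * b + inner ℝ w (D.curvatureVector p) < 0 := by
    linarith [hinner w, mul_pos hspos hwν]
  obtain ⟨t, -, rfl⟩ := exists_rotate_eq hpD hx
  rw [Ne, rotate_eq_self_iff hpD] at hxp
  rw [sphereFun_rotate hpD, ht.inner_velocity_eq_zero hwvel, mul_zero, zero_add]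
  have hpos : 0 < 2 * (D.radius ^ 2 * Real.sin (t / 2) ^ 2) :=
    mul_pos two_pos (mul_pos (pow_pos D.radius_pos 2) (sq_pos_of_ne_zero hxp))
  calc _ = 2 * (D.radius ^ 2 * Real.sin (t / 2) ^ 2) *
        (2 * b + inner ℝ w (D.curvatureVector p)) := by ring
    _ < 0 := mul_neg_of_pos_of_neg hpos hDκ

end OrientedCircle

namespace IsCircleFamilyAt

variable {Φ : Set E3} {p N : E3} {Γ : E3 → OrientedCircle} {C D : OrientedCircle} {a : ℝ}
  {f g : E3 → ℝ}

theorem exists_eventually_rotate_mem (h : IsCircleFamilyAt Φ p Γ)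
    (hfC : ∀ᶠ x in 𝓝[Φ] p, f x = 0 → x ∈ C.carrier) :
    ∃ s ∈ Set.Ioo 0 Real.pi, ∀ᶠ x in 𝓝[Φ] p, ∀ t ∈ Set.Icc (-s) s,
      f ((Γ x).rotate x t) = 0 → (Γ x).rotate x t ∈ C.carrier := by
  have hnhds : {x | x ∈ Φ → f x = 0 → x ∈ C.carrier} ∈ 𝓝 ((Γ p).rotate p 0) := by
    rw [(Γ p).rotate_zero]
    exact eventually_nhdsWithin_iff.1 hfC
  obtain ⟨near, hnear, small, hsmall, hmem⟩ :=
    eventually_prod_iff.1 ((h.tendsto_rotate 0).eventually hnhds)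
  obtain ⟨η, hη, hball⟩ := Metric.nhds_basis_closedBall.eventually_iff.1 hsmall
  rw [Real.closedBall_eq_Icc, zero_sub, zero_add] at hball
  obtain ⟨s, hs, hslt⟩ := exists_between (lt_min hη Real.pi_pos)
  obtain ⟨hsη, hsπ⟩ := lt_min_iff.1 hslt
  refine ⟨s, ⟨hs, hsπ⟩, ?_⟩
  filter_upwards [hnear, h.mem] with x hx ⟨hxΓ, hΓ⟩ t ht ht0
  exact hmem hx (hball ⟨by linarith [ht.1], by linarith [ht.2]⟩)
    (hΓ (OrientedCircle.rotate_mem_carrier hxΓ t)) ht0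

theorem eventually_exists_rotate_eq_zero (h : IsCircleFamilyAt Φ p Γ) (hf : Continuous f) {s : ℝ}
    (hs : f ((Γ p).rotate p s) < 0) :
    ∀ᶠ x in 𝓝[Φ] p, 0 < f x → ∃ u ∈ Set.Ioo (0 : ℝ) 1, f ((Γ x).rotate x (u * s)) = 0 := by
  filter_upwards [((hf.tendsto _).comp (h.tendsto_rotate_const s)).eventually_lt_const hs]
    with x hxs hx
  have hcont : Continuous fun u : ℝ => f ((Γ x).rotate x (u * s)) :=
    hf.comp ((Γ x).continuous_rotate.comp (continuous_mul_const s))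
  refine intermediate_value_Ioo' zero_le_one hcont.continuousOn ⟨?_, ?_⟩
  · simpa using hxs
  · simpa [OrientedCircle.rotate_zero] using hx

/-- Close to `x` the circle `Γ x` follows `Γ p`, along which `f` is negative, while `f x` is
positive. -/
theorem eventually_exists_mem_both_sides (h : IsCircleFamilyAt Φ p Γ) (hpΦ : p ∈ Φ)
    (hf : Continuous f) (hfC : ∀ᶠ x in 𝓝[Φ] p, f x = 0 → x ∈ C.carrier)
    (hneg : ∀ x ∈ (Γ p).carrier, x ≠ p → f x < 0) :
    ∀ᶠ x in 𝓝[Φ] p, 0 < f x →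
      (∃ t ∈ Set.Ioo 0 Real.pi, (Γ x).rotate x t ∈ C.carrier) ∧
      ∃ t ∈ Set.Ioo (-Real.pi) 0, (Γ x).rotate x t ∈ C.carrier := by
  have hp := (h.mem.self_of_nhdsWithin hpΦ).1
  obtain ⟨s, ⟨hs, hsπ⟩, hmem⟩ := h.exists_eventually_rotate_mem hfC
  have hright := hneg _ (OrientedCircle.rotate_mem_carrier hp s) <| by
    simpa [(Γ p).rotate_zero] using
      (OrientedCircle.rotate_ne_rotate hp hs (by linarith)).symm
  have hleft := hneg _ (OrientedCircle.rotate_mem_carrier hp (-s)) <| by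
    simpa [(Γ p).rotate_zero] using
      OrientedCircle.rotate_ne_rotate hp (neg_lt_zero.2 hs) (by linarith)
  filter_upwards [hmem, h.eventually_exists_rotate_eq_zero hf hright,
    h.eventually_exists_rotate_eq_zero hf hleft] with x hx hxright hxleft hxpos
  obtain ⟨u, ⟨hu, hu'⟩, hu0⟩ := hxright hxpos
  obtain ⟨v, ⟨hv, hv'⟩, hv0⟩ := hxleft hxpos
  have hus := mul_pos hu hs
  have hvs := mul_pos hv hs
  have hus' : u * s < s := mul_lt_of_lt_one_left hs hu'
  have hvs' : v * s < s := mul_lt_of_lt_one_left hs hv'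
  rw [mul_neg] at hv0
  exact ⟨⟨u * s, ⟨hus, by linarith⟩, hx _ ⟨by linarith, by linarith⟩ hu0⟩,
    ⟨-(v * s), ⟨by linarith, by linarith⟩, hx _ ⟨by linarith, by linarith⟩ hv0⟩⟩

theorem eventually_sphereFun_eq_zero_of_touching (h : IsCircleFamilyAt Φ p Γ) (hpΦ : p ∈ Φ)
    (hf : Continuous f) (hg : Continuous g) (hfC : ∀ᶠ x in 𝓝[Φ] p, f x = 0 → x ∈ C.carrier)
    (hgD : ∀ᶠ x in 𝓝[Φ] p, g x = 0 → x ∈ D.carrier)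
    (hfneg : ∀ x ∈ (Γ p).carrier, x ≠ p → f x < 0) (hgneg : ∀ x ∈ (Γ p).carrier, x ≠ p → g x < 0)
    (hCD : ∀ x ∈ C.carrier, x ∈ D.carrier → x = p)
    (hCN : ∀ x ∈ C.carrier, sphereFun N a p x = 0)
    (hDN : ∀ x ∈ D.carrier, sphereFun N a p x = 0) :
    ∀ᶠ x in 𝓝[Φ] p, 0 < f x → 0 < g x → sphereFun N a p x = 0 := by
  filter_upwards [h.mem, h.eventually_exists_mem_both_sides hpΦ hf hfC hfneg,
    h.eventually_exists_mem_both_sides hpΦ hg hgD hgneg] with x ⟨hx, _⟩ hC hD hfx hgx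
  obtain ⟨⟨t, ht, htC⟩, t', ht', htC'⟩ := hC hfx
  obtain ⟨⟨s, hs, hsD⟩, s', hs', hsD'⟩ := hD hgx
  have hne {u v : ℝ} (hu : u ∈ Set.Ioo 0 Real.pi) (hv : v ∈ Set.Ioo (-Real.pi) 0) :
      (Γ x).rotate x u ≠ (Γ x).rotate x v :=
    (OrientedCircle.rotate_ne_rotate hx (hv.2.trans hu.1) (by linarith [hu.2, hv.1])).symm
  have hmem := OrientedCircle.rotate_mem_carrier hx
  by_cases hts : (Γ x).rotate x t = (Γ x).rotate x s
  · have hts' : (Γ x).rotate x t' ≠ (Γ x).rotate x s' := fun heq =>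
      hne ht ht' ((hCD _ htC (hts ▸ hsD)).trans (hCD _ htC' (heq ▸ hsD')).symm)
    exact OrientedCircle.sphereFun_eq_zero_of_three (hmem t) (hmem t') (hmem s') (hne ht ht')
      (hne ht hs') hts' (hCN _ htC) (hCN _ htC') (hDN _ hsD') hx
  · exact OrientedCircle.sphereFun_eq_zero_of_three (hmem t) (hmem s) (hmem t') hts (hne ht ht')
      (hne hs ht') (hCN _ htC) (hDN _ hsD) (hCN _ htC') hx

end IsCircleFamilyAt

/-! ### Spherical pieces of the surface -/

/-- Arbitrarily close to `p` there are points with a neighbourhood in which `Φ` lies on one fixed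
sphere or plane. The point `p` itself need not have such a neighbourhood. -/
def SphericalNear (Φ : Set E3) (p : E3) : Prop :=
  ∃ (N q : E3) (a : ℝ), ‖N‖ = 1 ∧ ∃ U : Set E3, IsOpen U ∧ (∃ᶠ x in 𝓝[Φ] p, x ∈ U) ∧
    ∀ᶠ x in 𝓝[Φ] p, x ∈ U → sphereFun N a q x = 0

theorem eventually_sphereFun_pos_of_hasDerivAt {σ : ℝ → E3} {p v w : E3} {b : ℝ}
    (hσ : HasDerivAt σ v 0) (hσp : σ 0 = p) (hw : 0 < inner ℝ w v) :
    ∀ᶠ t in 𝓝[>] 0, 0 < sphereFun w b p (σ t) := by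
  have hderiv := hasDerivAt_sphereFun_comp (w := w) (b := b) (p := p) hσ
  rw [hσp, sub_self, smul_zero, add_zero] at hderiv
  have hsign := eventually_nhdsWithin_sign_eq_of_deriv_pos (hderiv.deriv.symm ▸ hw)
    (by rw [hσp, sphereFun_self])
  filter_upwards [nhdsWithin_le_nhds hsign, self_mem_nhdsWithin] with t ht htpos
  rw [← sign_eq_one_iff, ht, sub_zero, sign_eq_one_iff]
  exact htpos

namespace IsCircleFamilyAt

variable {Φ : Set E3} {p N ν : E3} {Γ : E3 → OrientedCircle} {C D : OrientedCircle} {a : ℝ}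

theorem sphericalNear_of_transversal (hΦ : IsSmoothClosedSurface Φ) (hp : p ∈ Φ)
    (h : IsCircleFamilyAt Φ p Γ) (hN : IsNormalAt Φ p N) (hC : C.carrier ⊆ Φ) (hD : D.carrier ⊆ Φ)
    (hpC : p ∈ C.carrier) (hpD : p ∈ D.carrier) (hCD : C.carrier ≠ D.carrier)
    (hΓC : C.carrier ≠ (Γ p).carrier) (hΓD : D.carrier ≠ (Γ p).carrier)
    (htC : ¬ C.IsTangentAt (Γ p) p) (htD : ¬ D.IsTangentAt (Γ p) p)
    (heC : C.MeetsEvenlyAt (Γ p) p) (heD : D.MeetsEvenlyAt (Γ p) p)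
    (hCN : ∀ x ∈ C.carrier, sphereFun N a p x = 0)
    (hDN : ∀ x ∈ D.carrier, sphereFun N a p x = 0) : SphericalNear Φ p := by
  have : (𝓝[Φ] p).NeBot := mem_closure_iff_nhdsWithin_neBot.1 (subset_closure hp)
  refine ⟨N, p, a, hN.norm_eq_one, Set.univ, isOpen_univ, .of_forall Set.mem_univ, ?_⟩
  filter_upwards [h.eventually_sphereFun_eq_zero_of_transversal hΦ hp hN hC hD hpC hpD hCD hΓC hΓD
    htC htD heC heD hCN hDN] with x hx _ using hx

theorem sphericalNear_of_touching (hp : p ∈ Φ) (h : IsCircleFamilyAt Φ p Γ) (hN : IsNormalAt Φ p N)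
    (hC : C.carrier ⊆ Φ) (hD : D.carrier ⊆ Φ) (hpC : p ∈ C.carrier) (hpD : p ∈ D.carrier)
    (hCD : C.carrier ≠ D.carrier) (htC : C.IsTangentAt (Γ p) p) (htD : D.IsTangentAt (Γ p) p)
    (hνvel : inner ℝ ν ((Γ p).velocity p) = 0) (hνN : inner ℝ ν N = 0) (hν : ν ≠ 0)
    (hltC : inner ℝ ν ((Γ p).curvatureVector p) < inner ℝ ν (C.curvatureVector p))
    (hltD : inner ℝ ν ((Γ p).curvatureVector p) < inner ℝ ν (D.curvatureVector p))
    (hσ : ∃ σ : ℝ → E3, HasDerivAt σ ν 0 ∧ σ 0 = p ∧ ∀ t, σ t ∈ Φ)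
    (hCN : ∀ x ∈ C.carrier, sphereFun N a p x = 0)
    (hDN : ∀ x ∈ D.carrier, sphereFun N a p x = 0) : SphericalNear Φ p := by
  obtain ⟨hpΓ, hΓ⟩ := h.mem.self_of_nhdsWithin hp
  have hνC := htC.symm.inner_velocity_eq_zero hνvel
  have hνD := htD.symm.inner_velocity_eq_zero hνvel
  obtain ⟨w, b, hCw, hwν, hwvel, hwC⟩ :=
    OrientedCircle.exists_sphereFun_separating hN hC hpC hνC hνN hν
  obtain ⟨v, d, hDv, hvν, hvvel, hvD⟩ :=
    OrientedCircle.exists_sphereFun_separating hN hD hpD hνD hνN hν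
  refine ⟨N, p, a, hN.norm_eq_one, {x | 0 < sphereFun w b p x} ∩ {x | 0 < sphereFun v d p x},
    (isOpen_lt continuous_const (continuous_sphereFun w b p)).inter
      (isOpen_lt continuous_const (continuous_sphereFun v d p)), ?_, ?_⟩
  · obtain ⟨σ, hderiv, hσp, hσΦ⟩ := hσ
    have hσtends : Tendsto σ (𝓝[>] 0) (𝓝[Φ] p) := tendsto_nhdsWithin_iff.2
      ⟨hσp ▸ hderiv.continuousAt.tendsto.mono_left nhdsWithin_le_nhds, .of_forall hσΦ⟩
    exact hσtends.frequently ((eventually_sphereFun_pos_of_hasDerivAt hderiv hσp hwν).and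
      (eventually_sphereFun_pos_of_hasDerivAt hderiv hσp hvν)).frequently
  · filter_upwards [h.eventually_sphereFun_eq_zero_of_touching hp (continuous_sphereFun w b p)
      (continuous_sphereFun v d p) hwC hvD
      (fun x hx hxp => OrientedCircle.sphereFun_neg_of_inner_curvatureVector_lt hN hC hΓ hpC hpΓ htC
        hνC hνN hν hCw hwν hwvel hltC hx hxp)
      (fun x hx hxp => OrientedCircle.sphereFun_neg_of_inner_curvatureVector_lt hN hD hΓ hpD hpΓ htD
        hνD hνN hν hDv hvν hvvel hltD hx hxp)
      (fun x hxC hxD => by_contra fun hxp => hCD <|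
        OrientedCircle.carrier_eq_of_isTangentAt hpC hpD (htC.trans htD.symm) hxC hxD hxp)
      hCN hDN] with x hx hxU using hx hxU.1 hxU.2

/-- Among three mutually tangent circles, the one whose curvature vector has the smallest conormal
component lies on one side of the other two. -/
theorem sphericalNear_of_isTangentAt {A B C : E3 → OrientedCircle} (hp : p ∈ Φ)
    (hN : IsNormalAt Φ p N)
    (hσ : ∀ v, inner ℝ N v = 0 → ∃ σ : ℝ → E3, HasDerivAt σ v 0 ∧ σ 0 = p ∧ ∀ t, σ t ∈ Φ)
    (hA : IsCircleFamilyAt Φ p A) (hB : IsCircleFamilyAt Φ p B) (hC : IsCircleFamilyAt Φ p C)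
    (hAB : (A p).carrier ≠ (B p).carrier) (hAC : (A p).carrier ≠ (C p).carrier)
    (hBC : (B p).carrier ≠ (C p).carrier) (htAB : (A p).IsTangentAt (B p) p)
    (htAC : (A p).IsTangentAt (C p) p) (hAN : ∀ x ∈ (A p).carrier, sphereFun N a p x = 0)
    (hBN : ∀ x ∈ (B p).carrier, sphereFun N a p x = 0)
    (hCN : ∀ x ∈ (C p).carrier, sphereFun N a p x = 0) : SphericalNear Φ p := by
  obtain ⟨hpA, hAΦ⟩ := hA.mem.self_of_nhdsWithin hp
  obtain ⟨hpB, hBΦ⟩ := hB.mem.self_of_nhdsWithin hp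
  obtain ⟨hpC, hCΦ⟩ := hC.mem.self_of_nhdsWithin hp
  have htBC := htAB.symm.trans htAC
  set ν := (A p).conormal N p
  have hνA : inner ℝ ν ((A p).velocity p) = 0 := (A p).inner_conormal_velocity N p
  have hνN : inner ℝ ν N = 0 := (A p).inner_conormal_normal N p
  have hν : ν ≠ 0 := OrientedCircle.conormal_ne_zero hN hAΦ hpA
  have hνB := htAB.inner_velocity_eq_zero hνA
  have hνC := htAC.inner_velocity_eq_zero hνA
  have hσν := hσ ν (by rw [real_inner_comm, hνN])
  have touchA := (hA.sphericalNear_of_touching hp hN hBΦ hCΦ hpB hpC hBC htAB.symm htAC.symm hνA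
    hνN hν · · hσν hBN hCN)
  have touchB := (hB.sphericalNear_of_touching hp hN hAΦ hCΦ hpA hpC hAC htAB htBC.symm hνB hνN hν
    · · hσν hAN hCN)
  have touchC := (hC.sphericalNear_of_touching hp hN hAΦ hBΦ hpA hpB hAB htAC htBC hνC hνN hν
    · · hσν hAN hBN)
  rcases lt_or_gt_of_ne (OrientedCircle.inner_curvatureVector_ne hN hAΦ hBΦ hpA hpB htAB hνA hνN hν
    hAB) with hlt | hlt
  · rcases lt_or_gt_of_ne (OrientedCircle.inner_curvatureVector_ne hN hAΦ hCΦ hpA hpC htAC hνA hνN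
      hν hAC) with hlt' | hlt'
    · exact touchA hlt hlt'
    · exact touchC hlt' (hlt'.trans hlt)
  · rcases lt_or_gt_of_ne (OrientedCircle.inner_curvatureVector_ne hN hBΦ hCΦ hpB hpC htBC hνB hνN
      hν hBC) with hlt' | hlt'
    · exact touchB hlt hlt'
    · exact touchC (hlt'.trans hlt) hlt'

end IsCircleFamilyAt

theorem IsNormalAt.sphereFun_eq_zero {Φ : Set E3} {p N x : E3} {C : OrientedCircle}
    (hN : IsNormalAt Φ p N) (hC : C.carrier ⊆ Φ) (hp : p ∈ C.carrier) (hx : x ∈ C.carrier) :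
    sphereFun N (-inner ℝ N (C.curvatureVector p) / 2) p x = 0 :=
  OrientedCircle.sphereFun_eq_zero_of_curvatureVector hp (hN.inner_velocity hC hp) (by ring) hx

theorem IsNormalAt.inner_curvatureVector_eq_of_meetsEvenlyAt {Φ : Set E3} {p N : E3}
    {C D : OrientedCircle} (hN : IsNormalAt Φ p N) (hC : C.carrier ⊆ Φ) (hD : D.carrier ⊆ Φ)
    (hpC : p ∈ C.carrier) (hpD : p ∈ D.carrier) (h : C.MeetsEvenlyAt D p) :
    inner ℝ N (C.curvatureVector p) = inner ℝ N (D.curvatureVector p) := by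
  rcases h with ht | ⟨q, hqp, hqC, hqD⟩
  · exact hN.inner_curvatureVector_eq hC hD hpC hpD ht
  · have hq := OrientedCircle.two_mul_add_inner_curvatureVector_eq_zero hpD hqD hqp
      (hN.inner_velocity hD hpD) (hN.sphereFun_eq_zero hC hpC hqC)
    linarith

theorem sphericalNear_of_three {Φ : Set E3} {p : E3} {A B C : E3 → OrientedCircle}
    (hΦ : IsSmoothClosedSurface Φ) (hp : p ∈ Φ) (hA : IsCircleFamilyAt Φ p A)
    (hB : IsCircleFamilyAt Φ p B) (hC : IsCircleFamilyAt Φ p C)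
    (hAB : (A p).carrier ≠ (B p).carrier) (hAC : (A p).carrier ≠ (C p).carrier)
    (hBC : (B p).carrier ≠ (C p).carrier) (heAB : (A p).MeetsEvenlyAt (B p) p)
    (heAC : (A p).MeetsEvenlyAt (C p) p) (heBC : (B p).MeetsEvenlyAt (C p) p) :
    SphericalNear Φ p := by
  obtain ⟨N, hN, hσ⟩ := hΦ.exists_normal hp
  obtain ⟨hpA, hAΦ⟩ := hA.mem.self_of_nhdsWithin hp
  obtain ⟨hpB, hBΦ⟩ := hB.mem.self_of_nhdsWithin hp
  obtain ⟨hpC, hCΦ⟩ := hC.mem.self_of_nhdsWithin hp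
  have hκAB := hN.inner_curvatureVector_eq_of_meetsEvenlyAt hAΦ hBΦ hpA hpB heAB
  have hκAC := hN.inner_curvatureVector_eq_of_meetsEvenlyAt hAΦ hCΦ hpA hpC heAC
  have hAN := fun x => hN.sphereFun_eq_zero (x := x) hAΦ hpA
  have hBN := fun x => hκAB ▸ hN.sphereFun_eq_zero (x := x) hBΦ hpB
  have hCN := fun x => hκAC ▸ hN.sphereFun_eq_zero (x := x) hCΦ hpC
  by_cases htAB : (A p).IsTangentAt (B p) p
  · by_cases htAC : (A p).IsTangentAt (C p) p
    · exact IsCircleFamilyAt.sphericalNear_of_isTangentAt hp hN hσ hA hB hC hAB hAC hBC htAB htAC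
        hAN hBN hCN
    · exact hC.sphericalNear_of_transversal hΦ hp hN hAΦ hBΦ hpA hpB hAB hAC hBC htAC
        (fun ht => htAC (htAB.trans ht)) heAC heBC hAN hBN
  · by_cases htAC : (A p).IsTangentAt (C p) p
    · exact hB.sphericalNear_of_transversal hΦ hp hN hAΦ hCΦ hpA hpC hAC hAB hBC.symm htAB
        (fun ht => htAB (htAC.trans ht)) heAB heBC.symm hAN hCN
    · exact hA.sphericalNear_of_transversal hΦ hp hN hBΦ hCΦ hpB hpC hBC hAB.symm hAC.symm
        (fun ht => htAB ht.symm) (fun ht => htAC ht.symm) heAB.symm heAC.symm hBN hCN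

namespace HasCirclesThroughEachPoint

variable {n : ℕ} {Φ : Set E3} {p : E3}

theorem exists_families (h : HasCirclesThroughEachPoint n Φ) (hp : p ∈ Φ) :
    ∃ Γ : Fin n → E3 → OrientedCircle, (∀ i, IsCircleFamilyAt Φ p (Γ i)) ∧
      Function.Injective fun i => (Γ i p).carrier := by
  classical
  obtain ⟨V, hV, hpV, γ, hγ, hγmem⟩ := h p hp
  choose c n r hc hn _ hcircle using hγ
  let Γ i x : OrientedCircle :=
    if hx : x ∈ Φ ∩ V then ⟨c i x, n i x, r i x, (hcircle i x hx).1, (hcircle i x hx).2.1⟩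
    else ⟨0, EuclideanSpace.single 0 1, 1, one_pos, by simp⟩
  have hcenter (i) : Set.EqOn (fun x => (Γ i x).center) (c i) (Φ ∩ V) := fun x hx => by
    simp only [Γ, dif_pos hx]
  have hnormal (i) : Set.EqOn (fun x => (Γ i x).normal) (n i) (Φ ∩ V) := fun x hx => by
    simp only [Γ, dif_pos hx]
  have hcarrier (i) : ∀ x ∈ Φ ∩ V, (Γ i x).carrier = γ i x := fun x hx => by
    rw [(hcircle i x hx).2.2]
    simp only [Γ, dif_pos hx, OrientedCircle.carrier]
  have hnhds : 𝓝[Φ ∩ V] p = 𝓝[Φ] p :=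
    nhdsWithin_inter_of_mem' (mem_nhdsWithin_of_mem_nhds (hV.mem_nhds hpV))
  refine ⟨Γ, fun i => ⟨?_, ?_, ?_⟩, fun i j hij => (hγmem p ⟨hp, hpV⟩).2 ?_⟩
  · exact hnhds ▸ (hc i).congr (hcenter i) p ⟨hp, hpV⟩
  · exact hnhds ▸ (hn i).congr (hnormal i) p ⟨hp, hpV⟩
  · rw [← hnhds]
    filter_upwards [self_mem_nhdsWithin] with x hx
    exact hcarrier i x hx ▸ (hγmem x hx).1 i
  · simpa only [hcarrier _ p ⟨hp, hpV⟩] using hij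

theorem subset_closure_sdiff (h : HasCirclesThroughEachPoint n Φ) (hn : 2 ≤ n) {C : OrientedCircle}
    (hC : C.carrier ⊆ Φ) : Φ ⊆ closure (Φ \ C.carrier) := by
  refine OrientedCircle.subset_closure_sdiff fun b hb => ?_
  obtain ⟨Γ, hΓ, hinj⟩ := h.exists_families (hC hb)
  have : Nontrivial (Fin n) := Fin.nontrivial_iff_two_le.2 hn
  obtain ⟨i, hi⟩ := hinj.exists_ne C.carrier
  obtain ⟨hbΓ, hΓΦ⟩ := (hΓ i).mem.self_of_nhdsWithin (hC hb)
  exact ⟨Γ i b, hbΓ, hΓΦ, hi⟩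

theorem sphericalNear (hΦ : IsSmoothClosedSurface Φ)
    (htop : 3 ≤ n ∧ Nonempty (Φ ≃ₜ Metric.sphere (0 : E3) 1) ∨
      7 ≤ n ∧ Nonempty (Φ ≃ₜ Circle × Circle))
    (h : HasCirclesThroughEachPoint n Φ) (hp : p ∈ Φ) : SphericalNear Φ p := by
  obtain ⟨Γ, hΓ, hinj⟩ := h.exists_families hp
  have hmem i := (hΓ i).mem.self_of_nhdsWithin hp
  obtain ⟨i, j, k, hij, hik, hjk, heij, heik, hejk⟩ :=
    OrientedCircle.exists_three_meetsEvenlyAt hΦ htop (fun i => (hmem i).1) (fun i => (hmem i).2)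
      fun i => h.subset_closure_sdiff (by lia) (hmem i).2
  exact sphericalNear_of_three hΦ hp (hΓ i) (hΓ j) (hΓ k) (hinj.ne hij) (hinj.ne hik)
    (hinj.ne hjk) heij heik hejk

end HasCirclesThroughEachPoint

/-! ### Unique continuation -/

theorem eventually_eq_of_sq_eq_one {X : Type*} [TopologicalSpace X] {f : X → ℝ} {x : X}
    (hf : ContinuousAt f x) (hsq : ∀ᶠ y in 𝓝 x, f y ^ 2 = 1) : ∀ᶠ y in 𝓝 x, f y = f x := by
  have hx := hsq.self_of_nhds
  have hpos : ∀ᶠ y in 𝓝 x, 0 < f y * f x :=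
    (hf.mul_const (f x)).eventually_const_lt (by simp only [← pow_two, hx, one_pos])
  filter_upwards [hsq, hpos] with y hy hypos
  refine (sq_eq_sq_iff_eq_or_eq_neg.1 (hy.trans hx.symm)).resolve_right fun hneg => ?_
  rw [hneg] at hypos
  linarith

theorem eq_of_frequently_eventuallyConst {E F : Type*} [NormedAddCommGroup E] [NormedSpace ℝ E]
    [NormedAddCommGroup F] [NormedSpace ℝ F] {f : E → F} (hf : ContDiff ℝ 1 f)
    (h : ∀ u, ∃ᶠ v in 𝓝 u, EventuallyConst f (𝓝 v)) (u v : E) : f u = f v := by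
  have hclosed : IsClosed {u | fderiv ℝ f u = 0} :=
    isClosed_eq (hf.continuous_fderiv one_ne_zero) continuous_const
  refine is_const_of_fderiv_eq_zero (𝕜 := ℝ) (hf.differentiable one_ne_zero) (fun u =>
    isClosed_iff_frequently.1 hclosed u ((h u).mono fun v hv => ?_)) u v
  obtain ⟨c, hc⟩ := eventuallyConst_iff_exists_eventuallyEq.1 hv
  exact hc.fderiv_eq.trans (fderiv_const_apply c)

section UnitNormal

variable {E F : Type*} [NormedAddCommGroup E] [NormedSpace ℝ E]
  [NormedAddCommGroup F] [InnerProductSpace ℝ F] {φ ν : E → F} {N q : F} {a s : ℝ} {e u : E}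

/-- A smooth unit normal field along the hypersurface parametrised by `φ`. -/
structure IsUnitNormalAlong (φ ν : E → F) : Prop where
  contDiff : ContDiff ℝ ∞ ν
  norm_eq_one : ∀ u, ‖ν u‖ = 1
  inner_fderiv : ∀ u d, inner ℝ (ν u) (fderiv ℝ φ u d) = 0
  eq_smul : ∀ u v, (∀ d, inner ℝ v (fderiv ℝ φ u d) = 0) → v = (inner ℝ (ν u) v : ℝ) • ν u

/-- The normal curvature of the hypersurface parametrised by `φ` in the direction `e`, with respect
to the normal field `ν`; the sign is such that `dν = normalCurvature φ ν e u • dφ` at an umbilic. -/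
noncomputable def normalCurvature (φ ν : E → F) (e u : E) : ℝ :=
  inner ℝ (fderiv ℝ ν u e) (fderiv ℝ φ u e) / ‖fderiv ℝ φ u e‖ ^ 2

theorem contDiff_normalCurvature (hφ : ContDiff ℝ ∞ φ) (hν : ContDiff ℝ ∞ ν)
    (he : ∀ u, fderiv ℝ φ u e ≠ 0) : ContDiff ℝ ∞ (normalCurvature φ ν e) := by
  have hφe : ContDiff ℝ ∞ fun u => fderiv ℝ φ u e :=
    (hφ.fderiv_right (by simp)).clm_apply contDiff_const
  have hνe : ContDiff ℝ ∞ fun u => fderiv ℝ ν u e :=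
    (hν.fderiv_right (by simp)).clm_apply contDiff_const
  exact (hνe.inner ℝ hφe).div (hφe.norm_sq ℝ) fun u => by simpa using he u

theorem eventually_normalCurvature_eq (hφ : Differentiable ℝ φ) (he : ∀ u, fderiv ℝ φ u e ≠ 0)
    (hν : ∀ᶠ v in 𝓝 u, ν v = s • (N + (2 * a) • (φ v - q))) :
    ∀ᶠ v in 𝓝 u, normalCurvature φ ν e v = s * (2 * a) := by
  filter_upwards [hν.eventually_nhds] with v (hv : ν =ᶠ[𝓝 v] _)
  have hderiv : HasFDerivAt (fun v => s • (N + (2 * a) • (φ v - q)))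
      (s • (2 * a) • fderiv ℝ φ v) v :=
    ((((hφ v).hasFDerivAt.sub_const q).const_smul (2 * a)).const_add N).const_smul s
  have hfderiv : fderiv ℝ ν v = s • (2 * a) • fderiv ℝ φ v := hv.fderiv_eq.trans hderiv.fderiv
  have hnorm : ‖fderiv ℝ φ v e‖ ^ 2 ≠ 0 := by simpa using he v
  rw [normalCurvature, hfderiv, div_eq_iff hnorm]
  simp [inner_smul_left, mul_assoc]

theorem fderiv_sphereFun_comp (hφ : Differentiable ℝ φ) (N : F) (a : ℝ) (q : F) (u d : E) :
    fderiv ℝ (fun u => sphereFun N a q (φ u)) u d =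
      inner ℝ (N + (2 * a) • (φ u - q)) (fderiv ℝ φ u d) :=
  congrArg (· d) ((hasFDerivAt_sphereFun N a q (φ u)).comp u (hφ u).hasFDerivAt).fderiv

namespace IsUnitNormalAlong

/-- The right-hand side is the gradient of the equation of the sphere, which has norm `1` on it. -/
theorem exists_eventually_eq_smul (hν : IsUnitNormalAlong φ ν) (hφ : Differentiable ℝ φ)
    (hN : ‖N‖ = 1) (h : ∀ᶠ v in 𝓝 u, sphereFun N a q (φ v) = 0) :
    ∃ s : ℝ, s ^ 2 = 1 ∧ ∀ᶠ v in 𝓝 u, ν v = s • (N + (2 * a) • (φ v - q)) := by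
  set g : E → F := fun v => N + (2 * a) • (φ v - q)
  have hg : Continuous fun v => inner ℝ (ν v) (g v) :=
    hν.contDiff.continuous.inner (by have := hφ.continuous; fun_prop)
  have hgν : ∀ᶠ v in 𝓝 u, g v = (inner ℝ (ν v) (g v) : ℝ) • ν v := by
    filter_upwards [h.eventually_nhds] with v hv
    refine hν.eq_smul v _ fun d => ?_
    have hzero : (fun v => sphereFun N a q (φ v)) =ᶠ[𝓝 v] fun _ => 0 := hv
    rw [← fderiv_sphereFun_comp hφ, hzero.fderiv_eq, fderiv_const_apply,
      zero_apply]
  have hsq : ∀ᶠ v in 𝓝 u, (inner ℝ (ν v) (g v) : ℝ) ^ 2 = 1 := by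
    filter_upwards [h, hgν] with v hv hgv
    have hnorm : ‖g v‖ ^ 2 = 1 := by rw [norm_sq_add_smul_sub, hv, hN]; ring
    rwa [hgv, norm_smul, hν.norm_eq_one, mul_one, Real.norm_eq_abs, sq_abs] at hnorm
  refine ⟨inner ℝ (ν u) (g u), hsq.self_of_nhds, ?_⟩
  filter_upwards [hgν, hsq, eventually_eq_of_sq_eq_one hg.continuousAt hsq] with v hgv hsqv hconst
  rw [← hconst]
  calc ν v = (inner ℝ (ν v) (g v) : ℝ) • (inner ℝ (ν v) (g v) : ℝ) • ν v := by
        rw [smul_smul, ← pow_two, hsqv, one_smul]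
    _ = (inner ℝ (ν v) (g v) : ℝ) • g v := congrArg _ hgv.symm

/-- Unique continuation. Where `φ` is spherical, both `normalCurvature φ ν e` and
`ν - normalCurvature φ ν e • φ` are constant, and together they determine the sphere. Having
vanishing derivative on a dense set, they are constant everywhere. -/
theorem sphereFun_eq_zero_of_eventually (hν : IsUnitNormalAlong φ ν) (hφ : ContDiff ℝ ∞ φ)
    (he : ∀ u, fderiv ℝ φ u e ≠ 0)
    (hdense : ∀ u, ∃ᶠ v in 𝓝 u, ∃ (N q : F) (a : ℝ), ‖N‖ = 1 ∧
      ∀ᶠ v' in 𝓝 v, sphereFun N a q (φ v') = 0)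
    (hN : ‖N‖ = 1) (h : ∀ᶠ v in 𝓝 u, sphereFun N a q (φ v) = 0) (v : E) :
    sphereFun N a q (φ v) = 0 := by
  have hdiff : Differentiable ℝ φ := hφ.differentiable (by simp)
  set κ := normalCurvature φ ν e
  set B : E → F := fun v => ν v - κ v • φ v
  have hpiece {N q : F} {a : ℝ} {u : E} (hN : ‖N‖ = 1)
      (h : ∀ᶠ v in 𝓝 u, sphereFun N a q (φ v) = 0) : ∃ s : ℝ, s ^ 2 = 1 ∧
      (∀ᶠ v in 𝓝 u, κ v = s * (2 * a)) ∧ ∀ᶠ v in 𝓝 u, B v = s • (N - (2 * a) • q) := by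
    obtain ⟨s, hs, hνs⟩ := hν.exists_eventually_eq_smul hdiff hN h
    have hκ : ∀ᶠ v in 𝓝 u, κ v = s * (2 * a) := eventually_normalCurvature_eq hdiff he hνs
    refine ⟨s, hs, hκ, ?_⟩
    filter_upwards [hνs, hκ] with v hνv hκv
    simp only [B, hνv, hκv]
    module
  have hκsmooth : ContDiff ℝ ∞ κ := contDiff_normalCurvature hφ hν.contDiff he
  have hBsmooth : ContDiff ℝ ∞ B := hν.contDiff.sub (hκsmooth.smul hφ)
  have hκconst := eq_of_frequently_eventuallyConst (hκsmooth.of_le (by simp)) fun u =>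
    (hdense u).mono fun v ⟨N, q, a, hN, hv⟩ =>
      let ⟨_, _, hκv, _⟩ := hpiece hN hv
      eventuallyConst_iff_exists_eventuallyEq.2 ⟨_, hκv⟩
  have hBconst := eq_of_frequently_eventuallyConst (hBsmooth.of_le (by simp)) fun u =>
    (hdense u).mono fun v ⟨N, q, a, hN, hv⟩ =>
      let ⟨_, _, _, hBv⟩ := hpiece hN hv
      eventuallyConst_iff_exists_eventuallyEq.2 ⟨_, hBv⟩
  obtain ⟨s, hs, hκu, hBu⟩ := hpiece hN h
  have hgrad (v : E) : N + (2 * a) • (φ v - q) = s • ν v := by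
    have hνv : ν v = κ v • φ v + B v := by simp only [B]; module
    rw [hνv, hκconst v u, hBconst v u, hκu.self_of_nhds, hBu.self_of_nhds, smul_add, smul_smul,
      smul_smul, ← mul_assoc, ← pow_two, hs]
    module
  have hfderiv (v : E) : fderiv ℝ (fun v => sphereFun N a q (φ v)) v = 0 := by
    ext d
    rw [fderiv_sphereFun_comp hdiff, hgrad, real_inner_smul_left, hν.inner_fderiv, mul_zero,
      zero_apply]
  have hsphere : Differentiable ℝ fun v => sphereFun N a q (φ v) := fun v =>
    (hasFDerivAt_sphereFun N a q (φ v)).differentiableAt.comp v (hdiff v)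
  rw [is_const_of_fderiv_eq_zero hsphere hfderiv v u]
  exact h.self_of_nhds

end IsUnitNormalAlong

end UnitNormal

theorem contDiff_cross {E : Type*} [NormedAddCommGroup E] [NormedSpace ℝ E] {f g : E → E3}
    {n : WithTop ℕ∞} (hf : ContDiff ℝ n f) (hg : ContDiff ℝ n g) :
    ContDiff ℝ n fun u => cross (f u) (g u) := by
  rw [contDiff_euclidean] at hf hg ⊢
  intro i
  fin_cases i
  · exact ((hf 1).mul (hg 2)).sub ((hf 2).mul (hg 1))
  · exact ((hf 2).mul (hg 0)).sub ((hf 0).mul (hg 2))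
  · exact ((hf 0).mul (hg 1)).sub ((hf 1).mul (hg 0))

theorem cross_ne_zero_of_linearIndependent {a b : E3} (h : LinearIndependent ℝ ![a, b]) :
    cross a b ≠ 0 := by
  have hofLp : LinearIndependent ℝ ![a.ofLp, b.ofLp] :=
    LinearIndependent.pair_iff.2 fun s t hst =>
      LinearIndependent.pair_iff.1 h s t (WithLp.ofLp_injective 2 (by simpa using hst))
  exact fun hcross => crossProduct_ne_zero_iff_linearIndependent.2 hofLp
    (congrArg WithLp.ofLp hcross)

theorem exists_isUnitNormalAlong {φ : E2 → E3} (hφ : ContDiff ℝ ∞ φ)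
    (hinj : ∀ u, Function.Injective (fderiv ℝ φ u)) : ∃ ν, IsUnitNormalAlong φ ν := by
  set b := (EuclideanSpace.basisFun (Fin 2) ℝ).toBasis
  set m : E2 → E3 := fun u => cross (fderiv ℝ φ u (b 0)) (fderiv ℝ φ u (b 1))
  have hpartial (d : E2) : ContDiff ℝ ∞ fun u => fderiv ℝ φ u d :=
    (hφ.fderiv_right (by simp)).clm_apply contDiff_const
  have hm : ContDiff ℝ ∞ m := contDiff_cross (hpartial _) (hpartial _)
  have hm0 (u : E2) : m u ≠ 0 := by
    refine cross_ne_zero_of_linearIndependent (LinearIndependent.pair_iff.2 fun s t hst => ?_)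
    have hker : fderiv ℝ φ u (s • b 0 + t • b 1) = 0 := by rw [map_add, map_smul, map_smul, hst]
    have hzero := (map_eq_zero_iff _ (hinj u)).1 hker
    have hcoord (i : Fin 2) := congrArg (b.repr · i) hzero
    exact ⟨by simpa using hcoord 0, by simpa using hcoord 1⟩
  have hnorm (u : E2) : ‖m u‖ ≠ 0 := norm_ne_zero_iff.2 (hm0 u)
  refine ⟨fun u => ‖m u‖⁻¹ • m u, ((hm.norm ℝ hm0).inv hnorm).smul hm, fun u =>
    norm_smul_inv_norm (hm0 u), fun u d => ?_, fun u v hv => ?_⟩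
  · rw [← b.sum_repr d, Fin.sum_univ_two, map_add, map_smul, map_smul, inner_add_right,
      inner_smul_right, inner_smul_right, real_inner_smul_left, real_inner_smul_left,
      inner_cross_left, inner_cross_right]
    simp
  · have hv' := norm_sq_cross_smul_of_inner_eq_zero (hv (b 0)) (hv (b 1))
    have hsq : ‖m u‖⁻¹ * ‖m u‖⁻¹ * ‖m u‖ ^ 2 = 1 := by field_simp [hnorm u]
    rw [real_inner_smul_left, smul_smul, mul_right_comm, mul_smul, ← hv', smul_smul, hsq, one_smul]

/-! ### Closed surfaces contained in a sphere -/

theorem map_nhds_add_smul_normal {φ : E2 → E3} {L : E2 →L[ℝ] E3} {u : E2} {m : E3}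
    (hφ : HasStrictFDerivAt φ L u) (hL : Function.Injective L) (hm : m ≠ 0)
    (hperp : ∀ d, inner ℝ m (L d) = 0) :
    map (fun z : E2 × ℝ => φ z.1 + z.2 • m) (𝓝 (u, 0)) = 𝓝 (φ u) := by
  set M : ℝ →L[ℝ] E3 := ContinuousLinearMap.toSpanSingleton ℝ m
  have hderiv : HasStrictFDerivAt (fun z : E2 × ℝ => φ z.1 + z.2 • m) (L.coprod M) (u, 0) :=
    (HasStrictFDerivAt.comp (u, (0 : ℝ)) (f := Prod.fst) hφ hasStrictFDerivAt_fst).add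
      (M.comp (.snd ℝ E2 ℝ)).hasStrictFDerivAt
  have hinj : Function.Injective (L.coprod M) := by
    rw [injective_iff_map_eq_zero]
    rintro ⟨d, s⟩ hds
    have hsum : L d + s • m = 0 := by simpa [M] using hds
    have hs : s = 0 := by
      have hinner := congrArg (fun x => (inner ℝ m x : ℝ)) hsum
      simpa [inner_add_right, hperp, inner_smul_right, hm] using hinner
    rw [hs, zero_smul, add_zero, map_eq_zero_iff L hL] at hsum
    rw [hsum, hs, Prod.mk_zero_zero]
  have hsurj : Function.Surjective (L.coprod M) :=
    (LinearMap.injective_iff_surjective_of_finrank_eq_finrank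
      (f := (L.coprod M : E2 × ℝ →ₗ[ℝ] E3)) (by simp)).1 hinj
  simpa using hderiv.map_nhds_eq_of_surj (LinearMap.range_eq_top.2 hsurj)

section Sphere

variable {Φ : Set E3} {N q p : E3} {a : ℝ}

theorem IsSmoothClosedSurface.eventually_mem_of_sphereFun_eq_zero (hΦ : IsSmoothClosedSurface Φ)
    (hN : ‖N‖ = 1) (hsub : ∀ x ∈ Φ, sphereFun N a q x = 0) (hp : p ∈ Φ) :
    ∀ᶠ x in 𝓝 p, sphereFun N a q x = 0 → x ∈ Φ := by
  obtain ⟨φ, u₀, hφ, hinj, -, hmem, rfl⟩ := hΦ.exists_chart hp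
  have hdiff : Differentiable ℝ φ := hφ.differentiable (by simp)
  set m : E3 := N + (2 * a) • (φ u₀ - q) with hm
  have hmnorm : ‖m‖ ^ 2 = 1 := by rw [norm_sq_add_smul_sub, hsub _ hp, hN]; ring
  have hm0 : m ≠ 0 := fun hzero => by simp [hzero] at hmnorm
  have hperp (d : E2) : inner ℝ m (fderiv ℝ φ u₀ d) = 0 := by
    have hzero : (fun u => sphereFun N a q (φ u)) = fun _ => 0 := funext fun u => hsub _ (hmem u)
    rw [← fderiv_sphereFun_comp hdiff, hzero, fderiv_const_apply, zero_apply]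
  rw [← map_nhds_add_smul_normal (hφ.contDiffAt.hasStrictFDerivAt (by simp)) (hinj u₀) hm0 hperp,
    eventually_map]
  -- On the normal line the equation is `z.2 * slope z`, and `slope` is `1` at the base point.
  set slope : E2 × ℝ → ℝ := fun z =>
    inner ℝ (N + (2 * a) • (φ z.1 - q)) m + a * z.2 * ‖m‖ ^ 2
  have hslope : Continuous slope := by
    have := hφ.continuous
    fun_prop
  have hbase : slope (u₀, 0) = 1 := by simp [slope, ← hm, hmnorm]
  filter_upwards [hslope.continuousAt.eventually_const_lt (hbase ▸ one_pos)] with z hz hzero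
  have hfactor : z.2 * slope z = 0 := by
    rw [sphereFun_add, hsub _ (hmem _), zero_add, inner_smul_right, norm_smul, mul_pow,
      Real.norm_eq_abs, sq_abs] at hzero
    linear_combination hzero
  rw [(mul_eq_zero.1 hfactor).resolve_right hz.ne', zero_smul, add_zero]
  exact hmem _

theorem setOf_sphereFun_eq_zero (hN : ‖N‖ = 1) (ha : a ≠ 0) :
    {x | sphereFun N a q x = 0} = Metric.sphere (q - (1 / (2 * a)) • N) (1 / (2 * |a|)) := by
  ext x
  have hgrad : N + (2 * a) • (x - q) = (2 * a) • (x - (q - (1 / (2 * a)) • N)) := by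
    match_scalars <;> field_simp
  have hnorm := norm_sq_add_smul_sub N a q x
  rw [hgrad, hN, norm_smul, Real.norm_eq_abs, abs_mul, abs_two] at hnorm
  rw [Set.mem_ofPred_eq, mem_sphere_iff_norm, eq_div_iff (by positivity), mul_comm ‖_‖,
    ← sq_eq_sq₀ (by positivity) zero_le_one, hnorm]
  simp [ha]

theorem isPreconnected_sphereFun_eq_zero (hN : ‖N‖ = 1) :
    IsPreconnected {x | sphereFun N a q x = 0} := by
  by_cases ha : a = 0
  · have hplane : {x | sphereFun N a q x = 0} = {x | innerSL ℝ N x = inner ℝ N q} := by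
      ext x
      simp [sphereFun, ha, inner_sub_right, sub_eq_zero]
    rw [hplane]
    exact (convex_hyperplane (innerSL ℝ N).isLinear _).isPreconnected
  · rw [setOf_sphereFun_eq_zero hN ha]
    refine isPreconnected_sphere ?_ _ _
    rw [← Module.finrank_eq_rank]
    simp

theorem not_isBounded_sphereFun_zero_eq_zero (N q : E3) :
    ¬Bornology.IsBounded {x | sphereFun N 0 q x = 0} := by
  intro hbdd
  obtain ⟨v, hvN, hv0⟩ : ∃ v ∈ (ℝ ∙ N)ᗮ, v ≠ 0 := by
    refine Submodule.exists_mem_ne_zero_of_ne_bot fun hbot => ?_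
    have hfinrank := Submodule.finrank_add_finrank_orthogonal (ℝ ∙ N)
    have hspan : Module.finrank ℝ (ℝ ∙ N) ≤ 1 := by
      simpa using finrank_span_le_card (R := ℝ) ({N} : Set E3)
    rw [hbot, finrank_bot, finrank_euclideanSpace_fin] at hfinrank
    lia
  rw [Submodule.mem_orthogonal_singleton_iff_inner_right] at hvN
  obtain ⟨R, hR⟩ := hbdd.subset_ball q
  have hfar : q + (|R| / ‖v‖) • v ∈ Metric.ball q R :=
    hR (by simp [sphereFun, inner_smul_right, hvN])
  rw [Metric.mem_ball, dist_eq_norm, add_sub_cancel_left, norm_smul, norm_div, norm_norm,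
    div_mul_cancel₀ _ (norm_ne_zero_iff.2 hv0), Real.norm_eq_abs, abs_abs] at hfar
  exact (le_abs_self R).not_gt hfar

theorem IsSmoothClosedSurface.eq_sphere_of_subset (hΦ : IsSmoothClosedSurface Φ)
    (hne : Φ.Nonempty) (hN : ‖N‖ = 1) (hsub : ∀ x ∈ Φ, sphereFun N a q x = 0) :
    ∃ (c : E3) (r : ℝ), 0 < r ∧ Φ = Metric.sphere c r := by
  obtain ⟨p, hp⟩ := hne
  have heq : Φ = {x | sphereFun N a q x = 0} := by
    refine Set.Subset.antisymm hsub fun x hx => ?_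
    by_contra hxΦ
    obtain ⟨y, hy, hyU, hyΦ⟩ := isPreconnected_sphereFun_eq_zero (q := q) (a := a) hN
      {x | ∀ᶠ y in 𝓝 x, sphereFun N a q y = 0 → y ∈ Φ} Φᶜ isOpen_setOfPred_eventually_nhds
      hΦ.1.isClosed.isOpen_compl
      (fun y _ => (em (y ∈ Φ)).imp (hΦ.eventually_mem_of_sphereFun_eq_zero hN hsub) id)
      ⟨p, hsub _ hp, hΦ.eventually_mem_of_sphereFun_eq_zero hN hsub hp⟩ ⟨x, hx, hxΦ⟩
    exact hyΦ (hyU.self_of_nhds hy)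
  have ha : a ≠ 0 := by
    rintro rfl
    exact not_isBounded_sphereFun_zero_eq_zero N q (heq ▸ hΦ.1.isBounded)
  exact ⟨_, 1 / (2 * |a|), by positivity, heq.trans (setOf_sphereFun_eq_zero hN ha)⟩

theorem SphericalNear.frequently_eventually_sphereFun_eq_zero {φ : E2 → E3} {u : E2}
    (h : SphericalNear Φ (φ u)) (hφ : Continuous φ) (hmap : map φ (𝓝 u) = 𝓝[Φ] (φ u)) :
    ∃ᶠ v in 𝓝 u, ∃ (N q : E3) (a : ℝ), ‖N‖ = 1 ∧ ∀ᶠ v' in 𝓝 v, sphereFun N a q (φ v') = 0 := by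
  obtain ⟨N, q, a, hN, U, hU, hfreq, hzero⟩ := h
  rw [← hmap] at hfreq hzero
  rw [eventually_map] at hzero
  rw [frequently_map] at hfreq
  refine (hfreq.and_eventually hzero.eventually_nhds).mono fun v ⟨hvU, hv⟩ => ⟨N, q, a, hN, ?_⟩
  filter_upwards [hv, hφ.continuousAt.eventually (hU.mem_nhds hvU)] with v' hv' hU'
  exact hv' hU'

theorem IsSmoothClosedSurface.exists_eventually_sphereFun_eq_zero (hΦ : IsSmoothClosedSurface Φ)
    (hp : p ∈ Φ) (h : SphericalNear Φ p) : ∃ (N q : E3) (a : ℝ), ‖N‖ = 1 ∧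
      ∃ x ∈ Φ, ∀ᶠ y in 𝓝[Φ] x, sphereFun N a q y = 0 := by
  obtain ⟨φ, u₀, hφ, -, hmap, hmem, rfl⟩ := hΦ.exists_chart hp
  obtain ⟨v, N, q, a, hN, hv⟩ :=
    (h.frequently_eventually_sphereFun_eq_zero hφ.continuous (hmap u₀)).exists
  refine ⟨N, q, a, hN, φ v, hmem v, ?_⟩
  rwa [← hmap v, eventually_map]

theorem IsSmoothClosedSurface.eventually_sphereFun_eq_zero_of_frequently
    (hΦ : IsSmoothClosedSurface Φ) (h : ∀ x ∈ Φ, SphericalNear Φ x) (hN : ‖N‖ = 1) (hp : p ∈ Φ)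
    (hfreq : ∃ᶠ x in 𝓝[Φ] p, ∀ᶠ y in 𝓝[Φ] x, sphereFun N a q y = 0) :
    ∀ᶠ x in 𝓝[Φ] p, sphereFun N a q x = 0 := by
  obtain ⟨φ, u₀, hφ, hinj, hmap, hmem, rfl⟩ := hΦ.exists_chart hp
  obtain ⟨ν, hν⟩ := exists_isUnitNormalAlong hφ hinj
  obtain ⟨e, he⟩ := exists_ne (0 : E2)
  rw [← hmap, frequently_map] at hfreq
  obtain ⟨v, hv⟩ := hfreq.exists
  rw [← hmap, eventually_map] at hv ⊢
  exact .of_forall (hν.sphereFun_eq_zero_of_eventually hφ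
    (fun u => (map_ne_zero_iff _ (hinj u)).2 he)
    (fun u => (h _ (hmem u)).frequently_eventually_sphereFun_eq_zero hφ.continuous (hmap u)) hN hv)

theorem IsSmoothClosedSurface.eq_sphere_of_sphericalNear (hΦ : IsSmoothClosedSurface Φ)
    (hconn : IsConnected Φ) (h : ∀ p ∈ Φ, SphericalNear Φ p) :
    ∃ (c : E3) (r : ℝ), 0 < r ∧ Φ = Metric.sphere c r := by
  obtain ⟨p, hp⟩ := hconn.nonempty
  obtain ⟨N, q, a, hN, x₀, hx₀, hnear⟩ := hΦ.exists_eventually_sphereFun_eq_zero hp (h p hp)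
  have := isConnected_iff_connectedSpace.1 hconn
  set A : Set Φ := {x : Φ | ∀ᶠ y : Φ in 𝓝 x, sphereFun N a q (y : E3) = 0}
  have hA (x : Φ) : x ∈ A ↔ ∀ᶠ y in 𝓝[Φ] (x : E3), sphereFun N a q y = 0 := by
    rw [← map_nhds_subtype_val, eventually_map]
    rfl
  have hclosed : IsClosed A := isClosed_iff_frequently.2 fun x hx => by
    refine (hA x).2 (hΦ.eventually_sphereFun_eq_zero_of_frequently h hN x.2 ?_)
    rw [← map_nhds_subtype_val, frequently_map]
    exact hx.mono fun y hy => (hA y).1 hy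
  have huniv : A = Set.univ :=
    IsClopen.eq_univ ⟨hclosed, isOpen_setOfPred_eventually_nhds⟩ ⟨⟨x₀, hx₀⟩, (hA _).2 hnear⟩
  refine hΦ.eq_sphere_of_subset (q := q) (a := a) hconn.nonempty hN fun x hx => ?_
  exact ((hA ⟨x, hx⟩).1 (huniv ▸ Set.mem_univ _)).self_of_nhdsWithin hx

end Sphere

theorem isConnected_of_homeomorph_sphere_or_torus {Φ : Set E3}
    (htop : Nonempty (Φ ≃ₜ Metric.sphere (0 : E3) 1) ∨ Nonempty (Φ ≃ₜ Circle × Circle)) :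
    IsConnected Φ := by
  rw [isConnected_iff_connectedSpace]
  rcases htop with ⟨⟨e⟩⟩ | ⟨⟨e⟩⟩
  · have : ConnectedSpace (Metric.sphere (0 : E3) 1) := by
      refine isConnected_iff_connectedSpace.1 (isConnected_sphere ?_ _ zero_le_one)
      rw [← Module.finrank_eq_rank]
      simp
    exact e.symm.surjective.connectedSpace e.symm.continuous
  · exact e.symm.surjective.connectedSpace e.symm.continuous

theorem theorem2_general {n : ℕ} {Φ : Set E3} (hΦ : IsSmoothClosedSurface Φ)
    (htop : 3 ≤ n ∧ Nonempty (Φ ≃ₜ Metric.sphere (0 : E3) 1) ∨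
      7 ≤ n ∧ Nonempty (Φ ≃ₜ Circle × Circle))
    (hcirc : HasCirclesThroughEachPoint n Φ) :
    ∃ (c : E3) (r : ℝ), 0 < r ∧ Φ = Metric.sphere c r :=
  hΦ.eq_sphere_of_sphericalNear
    (isConnected_of_homeomorph_sphere_or_torus (htop.imp And.right And.right))
    fun _ hp => hcirc.sphericalNear hΦ htop hp

theorem theorem2 (Φ : Set E3) (hΦ : IsSmoothClosedSurface Φ)
    (htop : Nonempty (Φ ≃ₜ Metric.sphere (0 : E3) 1) ∨ Nonempty (Φ ≃ₜ Circle × Circle))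
    (hcirc : HasCirclesThroughEachPoint 7 Φ) :
    ∃ (c : E3) (r : ℝ), 0 < r ∧ Φ = Metric.sphere c r :=
  theorem2_general hΦ (htop.imp (⟨by norm_num, ·⟩) (⟨le_rfl, ·⟩)) hcirc
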